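/- Let $k$ be a field and $B$ a (possibly noncommutative) unital $k$-algebra. **Conventions.** Let $L$ be a $k$-algebra with an algebra map $s:B\to L$ and an antialgebra map $t:B\to L$ whose images commute; write $b=s(b)$, $\overline b=t(b)$ inside $L$. Put $L\otimes_{\overline B}L=L\otimes_k L/(X\overline b\otimes Y-X\otimes\overline bY)$, and, for a $B$-bimodule $M$, $L\diamond_B M=L\otimes_k M/(\overline bX\otimes m-X\otimes bm)$ and $L\times_BM=\{\sum X_i\otimes m_i\in L\diamond_BM : \sum X_i\overline b\otimes m_i=\sum X_i\otimes m_ib\ \ \forall b\in B\}$; in $L\diamond_BL$ and $L\times_BL$ the second factor is $L$ with $b.X.b'=s(b)Xs(b')$. A *left bialgebroid* structure on $L$ over $B$ consists of $k$-linear maps $\Delta:L\to L\times_BL$, $X\mapsto X_1\otimes X_2$, and $\varepsilon:L\to B$ such that $\Delta(a\overline bX)=aX_1\otimes\overline bX_2$, $\varepsilon(a\overline bX)=a\varepsilon(X)b$; $\Delta$ is coassociative with counit $\varepsilon$ (that is, $\varepsilon(X_1)X_2=X=\overline{\varepsilon(X_2)}X_1$); $\Delta(1)=1\otimes1$, $\Delta(XY)=X_1Y_1\otimes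 X_2Y_2$; $\varepsilon(1)=1$ and $\varepsilon(XY)=\varepsilon(X\varepsilon(Y))=\varepsilon(X\overline{\varepsilon(Y)})$. It is a *left Hopf algebroid* if $\lambda:L\otimes_{\overline B}L\to L\diamond_BL$, $\lambda(X\otimes Y)=X_1\otimes X_2Y$, is bijective; then write $X_+\otimes X_-=\lambda^{-1}(X\otimes 1)\in L\otimes_{\overline B}L$. A *left $L$-comodule* is a $B$-bimodule $M$ with a map $\delta:M\to L\times_BM$, $m\mapsto m_{-1}\otimes m_0$, that is coassociative and counital ($\varepsilon(m_{-1})m_0=m$) and satisfies $\delta(bmb')=bm_{-1}b'\otimes m_0$. A *left 2-cocycle* on a left bialgebroid $L$ is a $k$-linear map $\Gamma:L\otimes_{\overline B}L\to B$ with $\Gamma(\overline bX,Y)=\Gamma(X,Y)b$ such that $$\Gamma(X,\Gamma(Y_1,Z_1)Y_2Z_2)=\Gamma(\Gamma(X_1,Y_1)X_2Y_2,Z),\qquad \Gamma(1,X)=\varepsilon(X)=\Gamma(X,1).$$ For a left $L$-comodule $M$ and $a\in B$ put $a\cdot_\Gamma m=\Gamma(a,m_{-1})m_0$ and $m\cdot_\Gamma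 a=\Gamma(m_{-1},a)m_0$. The 2-cocycle $\Gamma$ is *invertible* if for all left $L$-comodules $M,N$ the map $$\Gamma^\#:\ M\otimes_kN/(m\cdot_\Gamma a\otimes n-m\otimes a\cdot_\Gamma n)\ \longrightarrow\ M\otimes_BN,\qquad m\otimes n\mapsto\Gamma(m_{-1},n_{-1})m_0\otimes n_0,$$ is bijective. **Theorem.** Let $\Gamma$ be an invertible left 2-cocycle on a left Hopf algebroid $L$ over $B$. Let $B^\Gamma$ be the vector space $B$ with product $a\cdot_\Gamma b=\Gamma(a,b)$, and let $L^\Gamma$ be the vector space $L$ with product $$X\cdot_\Gamma Y=\Gamma(X_1,Y_1)\,X_{2+}Y_{2+}\,\overline{\Gamma(Y_{2-},X_{2-})}.$$ Then $B^\Gamma$ and $L^\Gamma$ are unital $k$-algebras with the units of $B$ and $L$, and $L^\Gamma$ is a left Hopf algebroid over $B^\Gamma$ with the same underlying maps $s,t$, with counit $\varepsilon^\Gamma(X)=\Gamma(X_+,X_-)$ and with coproduct $\Delta^\Gamma=(\Gamma^\#)^{-1}\circ\Delta$, where $$\Gamma^\#:L^\Gamma\diamond_{B^\Gamma}L^\Gamma\to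 L\diamond_BL,\qquad X\otimes Y\mapsto X_+\overline{\Gamma(X_-,Y_1)}\otimes Y_2,$$ is a bijection. -/

import Mathlib

open scoped TensorProduct
open MulOpposite

universe w u v v'

namespace Cotwist

/-! ### Balanced tensor products over a noncommutative algebra -/

section Balanced

variable {k : Type*} {B : Type*} {M N M' N' P : Type*} [Field k]
  [AddCommGroup M] [Module k M] [AddCommGroup N] [Module k N]
  [AddCommGroup M'] [Module k M'] [AddCommGroup N'] [Module k N'] [AddCommGroup P] [Module k P]

/-- The subspace of `M ⊗ N` spanned by all `r b m ⊗ n - m ⊗ l b n`. -/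
def balRel (r : B → M →ₗ[k] M) (l : B → N →ₗ[k] N) : Submodule k (M ⊗[k] N) :=
  Submodule.span k {z | ∃ b m n, z = r b m ⊗ₜ[k] n - m ⊗ₜ[k] l b n}

/-- The balanced tensor product: `M ⊗ N` modulo `r b m ⊗ n = m ⊗ l b n` for all `b`. -/
abbrev BalTensor (r : B → M →ₗ[k] M) (l : B → N →ₗ[k] N) : Type _ :=
  (M ⊗[k] N) ⧸ balRel r l

namespace BalTensor

variable (r : B → M →ₗ[k] M) (l : B → N →ₗ[k] N) (r' : B → M' →ₗ[k] M') (l' : B → N' →ₗ[k] N')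

/-- The universal balanced bilinear map `(m, n) ↦ m ⊗ n`. -/
def tmul : M →ₗ[k] N →ₗ[k] BalTensor r l :=
  (TensorProduct.mk k M N).compr₂ (balRel r l).mkQ

theorem tmul_balanced (b : B) (m : M) (n : N) :
    tmul r l (r b m) n = tmul r l m (l b n) := by
  refine (Submodule.Quotient.eq _).2 (Submodule.subset_span ⟨b, m, n, rfl⟩)

variable {r l r' l'}

theorem ext_lin {f g : BalTensor r l →ₗ[k] P}
    (h : ∀ m n, f (tmul r l m n) = g (tmul r l m n)) : f = g := by
  apply Submodule.linearMap_qext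
  apply TensorProduct.ext'
  intro m n
  exact h m n

/-- A balanced bilinear map descends to the balanced tensor product. -/
def lift (f : M →ₗ[k] N →ₗ[k] P) (h : ∀ b m n, f (r b m) n = f m (l b n)) :
    BalTensor r l →ₗ[k] P :=
  (balRel r l).liftQ (TensorProduct.lift f) (by
    refine Submodule.span_le.2 ?_
    rintro _ ⟨b, m, n, rfl⟩
    simp [h])

@[simp] theorem lift_tmul (f : M →ₗ[k] N →ₗ[k] P) (h) (m : M) (n : N) :
    lift (r := r) (l := l) f h (tmul r l m n) = f m n := by
  exact TensorProduct.lift.tmul _ _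

/-- The map `f ⊗ g` between balanced tensor products. -/
def map (f : M →ₗ[k] M') (g : N →ₗ[k] N') (hf : ∀ b m, f (r b m) = r' b (f m))
    (hg : ∀ b n, g (l b n) = l' b (g n)) : BalTensor r l →ₗ[k] BalTensor r' l' :=
  lift ((tmul r' l').compl₁₂ f g) (by
    intro b m n
    simp only [LinearMap.compl₁₂_apply, hf, hg, tmul_balanced])

@[simp] theorem map_tmul (f : M →ₗ[k] M') (g : N →ₗ[k] N') (hf) (hg) (m : M) (n : N) :
    map (r := r) (l := l) (r' := r') (l' := l') f g hf hg (tmul r l m n)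
      = tmul r' l' (f m) (g n) := by
  simp [map]

end BalTensor

end Balanced

/-! ### Bimodules and `Bᵉ`-rings -/

/-- A `B`-bimodule structure (with central action of `k`) on the `k`-vector space `M`:
commuting left and right actions `l` and `r`. -/
structure Bimod (k : Type w) (B : Type u) (M : Type v') [Field k] [Ring B] [Algebra k B]
    [AddCommGroup M] [Module k M] where
  l : B →ₐ[k] Module.End k M
  r : Bᵐᵒᵖ →ₐ[k] Module.End k M
  comm : ∀ (a b : B) (m : M), l a (r (op b) m) = r (op b) (l a m)

/-- The tensor product `M ⊗_B N`. -/
abbrev Bimod.Tensor {k : Type w} {B : Type u} {M N : Type*} [Field k] [Ring B] [Algebra k B]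
    [AddCommGroup M] [Module k M] [AddCommGroup N] [Module k N]
    (CM : Bimod k B M) (CN : Bimod k B N) : Type _ :=
  BalTensor (fun b : B => CM.r (op b)) (fun b : B => CN.l b)

/-- The class of `m ⊗ n` in `M ⊗_B N`. -/
def Bimod.tmul {k : Type w} {B : Type u} {M N : Type*} [Field k] [Ring B] [Algebra k B]
    [AddCommGroup M] [Module k M] [AddCommGroup N] [Module k N]
    (CM : Bimod k B M) (CN : Bimod k B N) : M →ₗ[k] N →ₗ[k] CM.Tensor CN :=
  BalTensor.tmul _ _

theorem Bimod.tmul_balanced {k : Type w} {B : Type u} {M N : Type*} [Field k] [Ring B]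
    [Algebra k B] [AddCommGroup M] [Module k M] [AddCommGroup N] [Module k N]
    (CM : Bimod k B M) (CN : Bimod k B N) (b : B) (m : M) (n : N) :
    CM.tmul CN (CM.r (op b) m) n = CM.tmul CN m (CN.l b n) :=
  BalTensor.tmul_balanced (fun b : B => CM.r (op b)) (fun b : B => CN.l b) b m n

/-- A balanced bilinear map descends to `M ⊗_B N`. -/
def Bimod.tensorLift {k : Type w} {B : Type u} {M N P : Type*} [Field k] [Ring B] [Algebra k B]
    [AddCommGroup M] [Module k M] [AddCommGroup N] [Module k N] [AddCommGroup P] [Module k P]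
    (CM : Bimod k B M) (CN : Bimod k B N) (f : M →ₗ[k] N →ₗ[k] P)
    (h : ∀ (b : B) (m : M) (n : N), f (CM.r (op b) m) n = f m (CN.l b n)) :
    CM.Tensor CN →ₗ[k] P :=
  BalTensor.lift f h

@[simp] theorem Bimod.tensorLift_tmul {k : Type w} {B : Type u} {M N P : Type*} [Field k] [Ring B]
    [Algebra k B] [AddCommGroup M] [Module k M] [AddCommGroup N] [Module k N] [AddCommGroup P]
    [Module k P] (CM : Bimod k B M) (CN : Bimod k B N) (f : M →ₗ[k] N →ₗ[k] P) (h) (m : M)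
    (n : N) : CM.tensorLift CN f h (CM.tmul CN m n) = f m n :=
  BalTensor.lift_tmul f h m n

/-- An algebra `L` with an algebra map `s : B → L` and an antialgebra map `t : B → L` whose images
commute. The element `t b` is the `b̄` of the usual notation. -/
structure BeRing (k : Type w) (B : Type u) (L : Type v) [Field k] [Ring B] [Algebra k B]
    [Ring L] [Algebra k L] where
  s : B →ₐ[k] L
  t : Bᵐᵒᵖ →ₐ[k] L
  comm : ∀ a b : B, s a * t (op b) = t (op b) * s a

section Be

variable {k : Type w} {B : Type u} {L : Type v} [Field k] [Ring B] [Algebra k B]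
  [Ring L] [Algebra k L]

namespace BeRing

variable (S : BeRing k B L)

/-- `L` as a `B`-bimodule by `b . X . b' = s b * X * s b'`. -/
def regular : Bimod k B L where
  l := AlgHom.ofLinearMap ((LinearMap.mul k L).comp S.s.toLinearMap)
    (by ext; simp) (by intros; ext; simp [mul_assoc])
  r := AlgHom.ofLinearMap
    ((LinearMap.mul k L).flip.comp (S.s.toLinearMap.comp (opLinearEquiv k).symm.toLinearMap))
    (by ext; simp) (by intros; ext; simp [mul_assoc])
  comm := by intros; simp [mul_assoc]

/-- `L` as a `B`-bimodule by `b . X . b' = t b' * X * t b`. -/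
def opposite : Bimod k B L where
  l := AlgHom.ofLinearMap
    ((LinearMap.mul k L).flip.comp (S.t.toLinearMap.comp (opLinearEquiv k).toLinearMap))
    (by ext; simp) (by intros; ext; simp [mul_assoc])
  r := AlgHom.ofLinearMap ((LinearMap.mul k L).comp S.t.toLinearMap)
    (by ext; simp) (by intros; ext; simp [mul_assoc])
  comm := by intros; simp [mul_assoc]

@[simp] theorem regular_l (b : B) (X : L) : S.regular.l b X = S.s b * X := rfl
@[simp] theorem regular_r (b : B) (X : L) : S.regular.r (op b) X = X * S.s b := rfl
@[simp] theorem opposite_l (b : B) (X : L) : S.opposite.l b X = X * S.t (op b) := rfl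
@[simp] theorem opposite_r (b : B) (X : L) : S.opposite.r (op b) X = S.t (op b) * X := rfl

/-- `L ⊗_{B̄} L`: here `X * t b ⊗ Y = X ⊗ t b * Y`. -/
abbrev TensorBar : Type _ :=
  BalTensor (fun b : B => LinearMap.mulRight k (S.t (op b)))
    (fun b : B => LinearMap.mulLeft k (S.t (op b)))

/-- The class of `X ⊗ Y` in `L ⊗_{B̄} L`. -/
def tbar : L →ₗ[k] L →ₗ[k] S.TensorBar := BalTensor.tmul _ _

theorem tbar_balanced (b : B) (X Y : L) :
    S.tbar (X * S.t (op b)) Y = S.tbar X (S.t (op b) * Y) :=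
  BalTensor.tmul_balanced (fun b : B => LinearMap.mulRight k (S.t (op b)))
    (fun b : B => LinearMap.mulLeft k (S.t (op b))) b X Y

theorem tbar_ext {P : Type*} [AddCommGroup P] [Module k P] {f g : S.TensorBar →ₗ[k] P}
    (h : ∀ X Y, f (S.tbar X Y) = g (S.tbar X Y)) : f = g :=
  BalTensor.ext_lin h

/-- `X ⊗ Y ↦ X ⊗ Y * Z` on `L ⊗_{B̄} L`. -/
def tbarMulRight (Z : L) : S.TensorBar →ₗ[k] S.TensorBar :=
  BalTensor.map LinearMap.id (LinearMap.mulRight k Z)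
    (by intros; rfl) (by intros; simp [mul_assoc])

@[simp] theorem tbarMulRight_tbar (Z X Y : L) :
    S.tbarMulRight Z (S.tbar X Y) = S.tbar X (Y * Z) := rfl

/-- `X ⊗ Y ↦ Z * X ⊗ Y` on `L ⊗_{B̄} L`. -/
def tbarMulLeft (Z : L) : S.TensorBar →ₗ[k] S.TensorBar :=
  BalTensor.map (LinearMap.mulLeft k Z) LinearMap.id
    (by intros; simp [mul_assoc]) (by intros; rfl)

@[simp] theorem tbarMulLeft_tbar (Z X Y : L) :
    S.tbarMulLeft Z (S.tbar X Y) = S.tbar (Z * X) Y := rfl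

/-- `X ⊗ Y ↦ X * s b ⊗ Y` on `L ⊗_{B̄} L`. -/
def tbarMulMid (b : B) : S.TensorBar →ₗ[k] S.TensorBar :=
  BalTensor.map (LinearMap.mulRight k (S.s b)) LinearMap.id
    (by intros; simp [mul_assoc, S.comm]) (by intros; rfl)

@[simp] theorem tbarMulMid_tbar (b : B) (X Y : L) :
    S.tbarMulMid b (S.tbar X Y) = S.tbar (X * S.s b) Y := rfl

/-- A bilinear map on `L × L` that is balanced over `B̄` descends to `L ⊗_{B̄} L`. -/
def tbarLift {P : Type*} [AddCommGroup P] [Module k P] (f : L →ₗ[k] L →ₗ[k] P)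
    (h : ∀ (b : B) (X Y : L), f (X * S.t (op b)) Y = f X (S.t (op b) * Y)) :
    S.TensorBar →ₗ[k] P :=
  BalTensor.lift f h

@[simp] theorem tbarLift_tbar {P : Type*} [AddCommGroup P] [Module k P] (f : L →ₗ[k] L →ₗ[k] P)
    (h) (X Y : L) : S.tbarLift f h (S.tbar X Y) = f X Y :=
  BalTensor.lift_tmul f h X Y

section Diamond

variable {M : Type v'} [AddCommGroup M] [Module k M] (CM : Bimod k B M)

/-- `L ⋄_B M`: here `t b * X ⊗ m = X ⊗ b . m`. -/
abbrev Diamond : Type _ :=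
  BalTensor (fun b : B => S.opposite.r (op b)) (fun b : B => CM.l b)

/-- The class of `X ⊗ m` in `L ⋄_B M`. -/
def dia : L →ₗ[k] M →ₗ[k] S.Diamond CM := BalTensor.tmul _ _

theorem dia_balanced (b : B) (X : L) (m : M) :
    S.dia CM (S.t (op b) * X) m = S.dia CM X (CM.l b m) :=
  BalTensor.tmul_balanced (fun b : B => S.opposite.r (op b)) (fun b : B => CM.l b) b X m

variable {CM} in
theorem dia_ext {P : Type*} [AddCommGroup P] [Module k P] {f g : S.Diamond CM →ₗ[k] P}
    (h : ∀ X m, f (S.dia CM X m) = g (S.dia CM X m)) : f = g :=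
  BalTensor.ext_lin h

/-- A bilinear map on `L × M` that is balanced over `B` descends to `L ⋄_B M`. -/
def diaLift {P : Type*} [AddCommGroup P] [Module k P] (f : L →ₗ[k] M →ₗ[k] P)
    (h : ∀ (b : B) (X : L) (m : M), f (S.t (op b) * X) m = f X (CM.l b m)) :
    S.Diamond CM →ₗ[k] P :=
  BalTensor.lift f h

@[simp] theorem diaLift_dia {P : Type*} [AddCommGroup P] [Module k P] (f : L →ₗ[k] M →ₗ[k] P)
    (h) (X : L) (m : M) : S.diaLift CM f h (S.dia CM X m) = f X m :=
  BalTensor.lift_tmul f h X m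

/-- `X ⊗ m ↦ X * Y ⊗ m` on `L ⋄_B M`. -/
def diaMulRight (Y : L) : S.Diamond CM →ₗ[k] S.Diamond CM :=
  BalTensor.map (LinearMap.mulRight k Y) LinearMap.id
    (by intros; simp [mul_assoc]) (by intros; rfl)

/-- `X ⊗ m ↦ X ⊗ m . b` on `L ⋄_B M`. -/
def diaActRight (b : B) : S.Diamond CM →ₗ[k] S.Diamond CM :=
  BalTensor.map LinearMap.id (CM.r (op b)) (by intros; rfl) (by intros; simp [CM.comm])

/-- `X ⊗ m ↦ s a * X * s b ⊗ m` on `L ⋄_B M`. -/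
def diaBimod (a b : B) : S.Diamond CM →ₗ[k] S.Diamond CM :=
  BalTensor.map (LinearMap.mulRight k (S.s b) ∘ₗ LinearMap.mulLeft k (S.s a)) LinearMap.id
    (by
      intro c m
      simp only [opposite_r, LinearMap.comp_apply, LinearMap.mulLeft_apply,
        LinearMap.mulRight_apply, ← mul_assoc, S.comm])
    (by intros; rfl)

@[simp] theorem diaMulRight_dia (Y X : L) (m : M) :
    S.diaMulRight CM Y (S.dia CM X m) = S.dia CM (X * Y) m := rfl

@[simp] theorem diaActRight_dia (b : B) (X : L) (m : M) :
    S.diaActRight CM b (S.dia CM X m) = S.dia CM X (CM.r (op b) m) := rfl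

/-- The Takeuchi product `L ×_B M`, as a subspace of `L ⋄_B M`. -/
def Takeuchi : Submodule k (S.Diamond CM) where
  carrier := {z | ∀ b : B, S.diaMulRight CM (S.t (op b)) z = S.diaActRight CM b z}
  add_mem' := by
    intro x y hx hy b
    rw [map_add, map_add, hx b, hy b]
  zero_mem' := by intro b; simp
  smul_mem' := by
    intro c x hx b
    rw [map_smul, map_smul, hx b]

/-- The relations defining `L ⋄_B L ⋄_B M`: `t b * X ⊗ Y ⊗ m = X ⊗ s b * Y ⊗ m` and
`X ⊗ t b * Y ⊗ m = X ⊗ Y ⊗ b . m`. -/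
def diamond₃Rel : Submodule k (L ⊗[k] (L ⊗[k] M)) :=
  Submodule.span k
    ({z | ∃ (b : B) (X Y : L) (m : M), z = (S.t (op b) * X) ⊗ₜ[k] (Y ⊗ₜ[k] m)
        - X ⊗ₜ[k] ((S.s b * Y) ⊗ₜ[k] m)} ∪
     {z | ∃ (b : B) (X Y : L) (m : M), z = X ⊗ₜ[k] ((S.t (op b) * Y) ⊗ₜ[k] m)
        - X ⊗ₜ[k] (Y ⊗ₜ[k] CM.l b m)})

/-- `L ⋄_B L ⋄_B M`. -/
abbrev Diamond₃ : Type _ := (L ⊗[k] (L ⊗[k] M)) ⧸ S.diamond₃Rel CM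

/-- The class of `X ⊗ Y ⊗ m` in `L ⋄_B L ⋄_B M`. -/
def dia₃ : L →ₗ[k] L →ₗ[k] M →ₗ[k] S.Diamond₃ CM :=
  (TensorProduct.lcurry (RingHom.id k) L M (S.Diamond₃ CM)) ∘ₗ
    (TensorProduct.mk k L (L ⊗[k] M)).compr₂ (S.diamond₃Rel CM).mkQ

theorem dia₃_eq (X Y : L) (m : M) :
    S.dia₃ CM X Y m = Submodule.Quotient.mk (X ⊗ₜ[k] (Y ⊗ₜ[k] m)) := rfl

/-- The map `(X ⊗ Y) ↦ (m ↦ X ⊗ Y ⊗ m)` from `L ⋄_B L`. -/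
def diaTail : S.Diamond S.regular →ₗ[k] M →ₗ[k] S.Diamond₃ CM :=
  S.diaLift S.regular (S.dia₃ CM) (by
    intro b X Y
    ext m
    exact (Submodule.Quotient.eq _).2 (Submodule.subset_span (Or.inl ⟨b, X, Y, m, rfl⟩)))

/-- The map `Y ⊗ m ↦ X ⊗ Y ⊗ m` from `L ⋄_B M`. -/
def diaHead (X : L) : S.Diamond CM →ₗ[k] S.Diamond₃ CM :=
  S.diaLift CM (S.dia₃ CM X) (by
    intro b Y m
    exact (Submodule.Quotient.eq _).2 (Submodule.subset_span (Or.inr ⟨b, X, Y, m, rfl⟩)))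

theorem diaTail_dia (X Y : L) (m : M) :
    S.diaTail CM (S.dia S.regular X Y) m = S.dia₃ CM X Y m :=
  LinearMap.congr_fun (S.diaLift_dia S.regular _ _ X Y) m

theorem diaHead_dia (X Y : L) (m : M) :
    S.diaHead CM X (S.dia CM Y m) = S.dia₃ CM X Y m :=
  S.diaLift_dia CM _ _ Y m

/-- The map `L ⊗ M → L ⋄_B L ⋄_B M`, `X ⊗ m ↦ D X ⊗ m`. -/
def comulLeft (D : L →ₗ[k] S.Takeuchi S.regular) : L ⊗[k] M →ₗ[k] S.Diamond₃ CM :=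
  TensorProduct.lift (S.diaTail CM ∘ₗ (S.Takeuchi S.regular).subtype ∘ₗ D)

/-- The map `L ⊗ M → L ⋄_B L ⋄_B M`, `X ⊗ m ↦ X ⊗ δ m`. -/
def coactRight (δ : M →ₗ[k] S.Takeuchi CM) : L ⊗[k] M →ₗ[k] S.Diamond₃ CM :=
  TensorProduct.lift
    (LinearMap.mk₂ k (fun X m => S.diaHead CM X (δ m : S.Diamond CM))
      (by
        intro X X' m
        rw [← LinearMap.add_apply]
        congr 1
        apply S.dia_ext
        intro Y n
        simp only [LinearMap.add_apply, diaHead_dia, map_add])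
      (by
        intro c X m
        rw [← LinearMap.smul_apply]
        congr 1
        apply S.dia_ext
        intro Y n
        simp only [LinearMap.smul_apply, diaHead_dia, map_smul])
      (by intros; simp)
      (by intros; simp))

end Diamond

/-- The map `X ⊗ Y ↦ s a * X ⊗ t b * Y` on `L ⋄_B L`. -/
def diaMulLeft (a b : B) : S.Diamond S.regular →ₗ[k] S.Diamond S.regular :=
  BalTensor.map (LinearMap.mulLeft k (S.s a)) (LinearMap.mulLeft k (S.t (op b)))
    (by
      intro c m
      simp only [opposite_r, LinearMap.mulLeft_apply, ← mul_assoc, S.comm])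
    (by
      intro c m
      simp only [regular_l, LinearMap.mulLeft_apply, ← mul_assoc, S.comm])

@[simp] theorem diaMulLeft_dia (a b : B) (X Y : L) :
    S.diaMulLeft a b (S.dia S.regular X Y) = S.dia S.regular (S.s a * X) (S.t (op b) * Y) := rfl

/-- The map `X ⊗ Y ↦ X * Z ⊗ Y * W` on `L ⋄_B L`. -/
def diaMulRight₂ (Z W : L) : S.Diamond S.regular →ₗ[k] S.Diamond S.regular :=
  BalTensor.map (LinearMap.mulRight k Z) (LinearMap.mulRight k W)
    (by intros; simp [mul_assoc]) (by intros; simp [mul_assoc])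

@[simp] theorem diaMulRight₂_dia (Z W X Y : L) :
    S.diaMulRight₂ Z W (S.dia S.regular X Y) = S.dia S.regular (X * Z) (Y * W) := rfl

/-- The componentwise product `(X ⊗ Y)(Z ⊗ W) = X * Z ⊗ Y * W` of an element of `L ×_B L` with an
element of `L ⋄_B L`. -/
def takeuchiMul (z : S.Takeuchi S.regular) : S.Diamond S.regular →ₗ[k] S.Diamond S.regular :=
  S.diaLift S.regular (LinearMap.mk₂ k (fun Z W => S.diaMulRight₂ Z W (z : S.Diamond S.regular))
      (by
        intro Z Z' W
        rw [← LinearMap.add_apply]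
        congr 1
        apply S.dia_ext
        simp [mul_add])
      (by
        intro c Z W
        rw [← LinearMap.smul_apply]
        congr 1
        apply S.dia_ext
        simp)
      (by
        intro Z W W'
        rw [← LinearMap.add_apply]
        congr 1
        apply S.dia_ext
        simp [mul_add])
      (by
        intro c Z W
        rw [← LinearMap.smul_apply]
        congr 1
        apply S.dia_ext
        simp))
    (by
      intro b Z W
      have h1 : S.diaMulRight₂ (S.t (op b) * Z) W
          = S.diaMulRight₂ Z W ∘ₗ S.diaMulRight S.regular (S.t (op b)) := by
        apply S.dia_ext
        simp [mul_assoc]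
      have h2 : S.diaMulRight₂ Z (S.s b * W)
          = S.diaMulRight₂ Z W ∘ₗ S.diaActRight S.regular b := by
        apply S.dia_ext
        simp [mul_assoc]
      have h3 := z.2 b
      simp only [LinearMap.mk₂_apply, regular_l, h1, h2, LinearMap.comp_apply, h3])

@[simp] theorem takeuchiMul_tmul (z : S.Takeuchi S.regular) (Z W : L) :
    S.takeuchiMul z (S.dia S.regular Z W) = S.diaMulRight₂ Z W z := by
  simp [takeuchiMul]

/-- The multiplication `X ⊗ Y ↦ X * Y` on `L ⊗_B L`. -/
def mulTensor : S.regular.Tensor S.regular →ₗ[k] L :=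
  S.regular.tensorLift S.regular (LinearMap.mul k L) (by intros; simp [mul_assoc])

/-- The map `Y ⊗ X ↦ X * Y` on the quotient of `L ⊗ L` by `t b * Y ⊗ X = Y ⊗ X * t b`. -/
def oppositeMul : S.opposite.Tensor S.opposite →ₗ[k] L :=
  S.opposite.tensorLift S.opposite (LinearMap.mul k L).flip (by intros; simp [mul_assoc])

end BeRing

end Be

/-! ### Left bialgebroids, left Hopf algebroids, left comodules -/

/-- A left `B`-bialgebroid structure on the algebra `L`. In the axioms of coassociativity and
counit, `z` is an arbitrary representative in `L ⊗ L` of `Δ X`. -/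
structure LeftBialgebroid (k : Type w) (B : Type u) (L : Type v) [Field k] [Ring B] [Algebra k B]
    [Ring L] [Algebra k L] extends BeRing k B L where
  Δ : L →ₗ[k] toBeRing.Takeuchi toBeRing.regular
  ε : L →ₗ[k] B
  Δ_bimod : ∀ (a b : B) (X : L), (Δ (s a * t (op b) * X) : toBeRing.Diamond toBeRing.regular)
    = toBeRing.diaMulLeft a b (Δ X)
  ε_bimod : ∀ (a b : B) (X : L), ε (s a * t (op b) * X) = a * ε X * b
  coassoc : ∀ (X : L) (z : L ⊗[k] L), Submodule.Quotient.mk z = (Δ X : toBeRing.Diamond toBeRing.regular) →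
    toBeRing.comulLeft toBeRing.regular Δ z = toBeRing.coactRight toBeRing.regular Δ z
  counit_left : ∀ (X : L) (z : L ⊗[k] L), Submodule.Quotient.mk z = (Δ X : toBeRing.Diamond toBeRing.regular) →
    TensorProduct.lift ((LinearMap.mul k L).comp (s.toLinearMap ∘ₗ ε)) z = X
  counit_right : ∀ (X : L) (z : L ⊗[k] L), Submodule.Quotient.mk z = (Δ X : toBeRing.Diamond toBeRing.regular) →
    TensorProduct.lift ((LinearMap.mul k L).comp
      (t.toLinearMap ∘ₗ (opLinearEquiv k).toLinearMap ∘ₗ ε)).flip z = X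
  Δ_one : (Δ 1 : toBeRing.Diamond toBeRing.regular) = toBeRing.dia toBeRing.regular 1 1
  Δ_mul : ∀ X Y : L, (Δ (X * Y) : toBeRing.Diamond toBeRing.regular)
    = toBeRing.takeuchiMul (Δ X) (Δ Y)
  ε_one : ε 1 = 1
  ε_mul_s : ∀ X Y : L, ε (X * Y) = ε (X * s (ε Y))
  ε_mul_t : ∀ X Y : L, ε (X * Y) = ε (X * t (op (ε Y)))

section Bialg

variable {k : Type w} {B : Type u} {L : Type v} [Field k] [Ring B] [Algebra k B]
  [Ring L] [Algebra k L]

/-- A left comodule structure on `M` over the left `B`-bialgebroid `L`. In the axioms of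
coassociativity and counit, `z` is an arbitrary representative in `L ⊗ M` of `δ m`. -/
structure LeftComodule (H : LeftBialgebroid k B L) (M : Type v') [AddCommGroup M] [Module k M]
    extends Bimod k B M where
  δ : M →ₗ[k] H.Takeuchi toBimod
  δ_bimod : ∀ (a b : B) (m : M), (δ (l a (r (op b) m)) : H.Diamond toBimod)
    = H.diaBimod toBimod a b (δ m)
  coassoc : ∀ (m : M) (z : L ⊗[k] M), Submodule.Quotient.mk z = (δ m : H.Diamond toBimod) →
    H.comulLeft toBimod H.Δ z = H.coactRight toBimod δ z
  counit : ∀ (m : M) (z : L ⊗[k] M), Submodule.Quotient.mk z = (δ m : H.Diamond toBimod) →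
    TensorProduct.lift (l.toLinearMap ∘ₗ H.ε) z = m

namespace LeftBialgebroid

variable (H : LeftBialgebroid k B L)

theorem Δ_t (b : B) (X : L) : (H.Δ (H.t (op b) * X) : H.Diamond H.regular)
    = H.diaMulLeft 1 b (H.Δ X) := by
  simpa using H.Δ_bimod 1 b X

theorem Δ_s (a : B) (X : L) : (H.Δ (H.s a * X) : H.Diamond H.regular)
    = H.diaMulLeft a 1 (H.Δ X) := by
  simpa using H.Δ_bimod a 1 X

theorem Δ_t' (b : B) :
    (H.Δ (H.t (op b)) : H.Diamond H.regular) = H.dia H.regular 1 (H.t (op b)) := by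
  have := H.Δ_t b 1
  rw [mul_one, H.Δ_one] at this
  rw [this]
  simp

theorem Δ_s' (b : B) :
    (H.Δ (H.s b) : H.Diamond H.regular) = H.dia H.regular (H.s b) 1 := by
  have := H.Δ_s b 1
  rw [mul_one, H.Δ_one] at this
  rw [this]
  simp

/-- The canonical map `λ : L ⊗_{B̄} L → L ⋄_B L`, `X ⊗ Y ↦ X₁ ⊗ X₂ * Y`. -/
def lam : H.TensorBar →ₗ[k] H.Diamond H.regular :=
  H.tbarLift (LinearMap.mk₂ k (fun X Y => H.diaMulRight₂ 1 Y (H.Δ X : H.Diamond H.regular))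
      (by intros; simp) (by intros; simp)
      (by
        intro X Y Y'
        rw [← LinearMap.add_apply]
        congr 1
        apply H.dia_ext
        simp [mul_add])
      (by
        intro c X Y
        rw [← LinearMap.smul_apply]
        congr 1
        apply H.dia_ext
        simp))
    (by
      intro b X Y
      simp only [LinearMap.mk₂_apply, H.Δ_mul, Δ_t', BeRing.takeuchiMul_tmul]
      rw [← LinearMap.comp_apply]
      congr 1
      apply H.dia_ext
      simp [mul_assoc])

@[simp] theorem lam_tbar (X Y : L) :
    H.lam (H.tbar X Y) = H.diaMulRight₂ 1 Y (H.Δ X : H.Diamond H.regular) :=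
  H.tbarLift_tbar _ _ X Y

theorem lam_mulRight (Z : L) (z : H.TensorBar) :
    H.lam (H.tbarMulRight Z z) = H.diaMulRight₂ 1 Z (H.lam z) := by
  have h : H.lam ∘ₗ H.tbarMulRight Z = H.diaMulRight₂ 1 Z ∘ₗ H.lam := by
    apply H.tbar_ext
    intro X Y
    have : H.diaMulRight₂ 1 (Y * Z) = H.diaMulRight₂ 1 Z ∘ₗ H.diaMulRight₂ 1 Y := by
      apply H.dia_ext
      simp [mul_assoc]
    simp [this]
  exact LinearMap.congr_fun h z

theorem lam_mulLeft_t (b : B) (z : H.TensorBar) :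
    H.lam (H.tbarMulLeft (H.t (op b)) z) = H.diaMulLeft 1 b (H.lam z) := by
  have h : H.lam ∘ₗ H.tbarMulLeft (H.t (op b)) = H.diaMulLeft 1 b ∘ₗ H.lam := by
    apply H.tbar_ext
    intro X Y
    have : H.diaMulRight₂ 1 Y ∘ₗ H.diaMulLeft 1 b = H.diaMulLeft 1 b ∘ₗ H.diaMulRight₂ 1 Y := by
      apply H.dia_ext
      simp [mul_assoc]
    simpa [Δ_t] using LinearMap.congr_fun this _
  exact LinearMap.congr_fun h z

theorem lam_mulLeft_s (b : B) (z : H.TensorBar) :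
    H.lam (H.tbarMulLeft (H.s b) z) = H.diaMulLeft b 1 (H.lam z) := by
  have h : H.lam ∘ₗ H.tbarMulLeft (H.s b) = H.diaMulLeft b 1 ∘ₗ H.lam := by
    apply H.tbar_ext
    intro X Y
    have : H.diaMulRight₂ 1 Y ∘ₗ H.diaMulLeft b 1 = H.diaMulLeft b 1 ∘ₗ H.diaMulRight₂ 1 Y := by
      apply H.dia_ext
      simp
    simpa [Δ_s] using LinearMap.congr_fun this _
  exact LinearMap.congr_fun h z

theorem lam_mulMid (b : B) (z : H.TensorBar) :
    H.lam (H.tbarMulMid b z) = H.diaMulRight₂ (H.s b) 1 (H.lam z) := by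
  have h : H.lam ∘ₗ H.tbarMulMid b = H.diaMulRight₂ (H.s b) 1 ∘ₗ H.lam := by
    apply H.tbar_ext
    intro X Y
    have : H.diaMulRight₂ 1 Y ∘ₗ H.diaMulRight₂ (H.s b) 1
        = H.diaMulRight₂ (H.s b) 1 ∘ₗ H.diaMulRight₂ 1 Y := by
      apply H.dia_ext
      simp
    simpa [H.Δ_mul, Δ_s'] using LinearMap.congr_fun this _
  exact LinearMap.congr_fun h z

end LeftBialgebroid

end Bialg

/-- A left Hopf algebroid: a left bialgebroid whose canonical map `λ` is invertible. -/
structure LeftHopfAlgebroid (k : Type w) (B : Type u) (L : Type v) [Field k] [Ring B] [Algebra k B]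
    [Ring L] [Algebra k L] extends LeftBialgebroid k B L where
  lam_bijective : Function.Bijective toLeftBialgebroid.lam

/-! ### The maps `X ↦ X₊ ⊗ X₋` -/

section Hopf

variable {k : Type w} {B : Type u} {L : Type v} [Field k] [Ring B] [Algebra k B]
  [Ring L] [Algebra k L]

namespace LeftHopfAlgebroid

variable (H : LeftHopfAlgebroid k B L)

/-- `X₊ ⊗ X₋ = λ⁻¹(X ⋄ 1)` in `L ⊗_{B̄} L`. -/
noncomputable def plusMinus : L →ₗ[k] H.TensorBar :=
  (LinearEquiv.ofBijective H.lam H.lam_bijective).symm.toLinearMap ∘ₗ (H.dia H.regular).flip 1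

theorem lam_plusMinus (X : L) : H.lam (H.plusMinus X) = H.dia H.regular X 1 :=
  (LinearEquiv.ofBijective H.lam H.lam_bijective).apply_symm_apply _

theorem eq_plusMinus {z : H.TensorBar} {X : L} (h : H.lam z = H.dia H.regular X 1) :
    z = H.plusMinus X :=
  H.lam_bijective.1 (h.trans (H.lam_plusMinus X).symm)

theorem plusMinus_s_mul (b : B) (X : L) :
    H.plusMinus (H.s b * X) = H.tbarMulLeft (H.s b) (H.plusMinus X) := by
  symm
  apply H.eq_plusMinus
  rw [H.lam_mulLeft_s, lam_plusMinus]
  simp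

theorem plusMinus_mul_s (b : B) (X : L) :
    H.plusMinus (X * H.s b) = H.tbarMulMid b (H.plusMinus X) := by
  symm
  apply H.eq_plusMinus
  rw [H.lam_mulMid, lam_plusMinus]
  simp

theorem plusMinus_comm_t (b : B) (X : L) :
    H.tbarMulRight (H.t (op b)) (H.plusMinus X) = H.tbarMulLeft (H.t (op b)) (H.plusMinus X) := by
  apply H.lam_bijective.1
  rw [H.lam_mulRight, H.lam_mulLeft_t, lam_plusMinus]
  simp

/-- The flip `L ⊗_{B̄} L → L ⋄_B L`, `X ⊗ Y ↦ Y ⊗ X`, where `B` acts on the second factor of the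
target by `b . X . b' = t b' * X * t b`. -/
def flipBar : H.TensorBar →ₗ[k] H.Diamond H.opposite :=
  H.tbarLift (H.dia H.opposite).flip (by
    intro b X Y
    exact (H.dia_balanced H.opposite b Y X).symm)

@[simp] theorem flipBar_tbar (X Y : L) : H.flipBar (H.tbar X Y) = H.dia H.opposite Y X :=
  H.tbarLift_tbar _ _ X Y

theorem flip_mem (X : L) : H.flipBar (H.plusMinus X) ∈ H.Takeuchi H.opposite := by
  intro b
  have hf : H.diaMulRight H.opposite (H.t (op b)) ∘ₗ H.flipBar
      = H.flipBar ∘ₗ H.tbarMulRight (H.t (op b)) := by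
    apply H.tbar_ext
    simp
  have hg : H.diaActRight H.opposite b ∘ₗ H.flipBar
      = H.flipBar ∘ₗ H.tbarMulLeft (H.t (op b)) := by
    apply H.tbar_ext
    simp
  have h1 := LinearMap.congr_fun hf (H.plusMinus X)
  have h2 := LinearMap.congr_fun hg (H.plusMinus X)
  simp only [LinearMap.comp_apply] at h1 h2
  rw [h1, h2, plusMinus_comm_t]

/-- The map `X ↦ X₋ ⊗ X₊`. It is a left coaction of `L` on `L` with the `B`-bimodule structure
`b . X . b' = t b' * X * t b`. -/
noncomputable def minusPlus : L →ₗ[k] H.Takeuchi H.opposite :=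
  (H.flipBar ∘ₗ H.plusMinus).codRestrict _ H.flip_mem

@[simp] theorem coe_minusPlus (X : L) :
    (H.minusPlus X : H.Diamond H.opposite) = H.flipBar (H.plusMinus X) := rfl

end LeftHopfAlgebroid

end Hopf

/-! ### Left 2-cocycles -/

section Cocycle

variable {k : Type w} {B : Type u} {L : Type v} [Field k] [Ring B] [Algebra k B]
  [Ring L] [Algebra k L]

/-- A left `B̄`-linear map `L ⊗_{B̄} L → B`; here `b̄` acts on `B` by right multiplication
with `b`. -/
structure BarHom (S : BeRing k B L) where
  toLin : S.TensorBar →ₗ[k] B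
  map_bar : ∀ (b : B) (X Y : L), toLin (S.tbar (S.t (op b) * X) Y) = toLin (S.tbar X Y) * b

namespace BarHom

variable {S : BeRing k B L} (Γ : BarHom S)

/-- The bilinear map `(X, Y) ↦ Γ(X, Y)`. -/
def app : L →ₗ[k] L →ₗ[k] B := S.tbar.compr₂ Γ.toLin

theorem app_t_mul (b : B) (X Y : L) : Γ.app (S.t (op b) * X) Y = Γ.app X Y * b :=
  Γ.map_bar b X Y

theorem app_balanced (b : B) (X Y : L) :
    Γ.app (X * S.t (op b)) Y = Γ.app X (S.t (op b) * Y) :=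
  congrArg Γ.toLin (S.tbar_balanced b X Y)

section

variable {M N : Type*} [AddCommGroup M] [Module k M] [AddCommGroup N] [Module k N]
  (CM : Bimod k B M) (CN : Bimod k B N)

/-- For fixed `Y` and `n`, the map `X ⊗ m ↦ Γ(X, Y) . m ⊗ n` from `L ⋄_B M` to `M ⊗_B N`. -/
def pairAux (Y : L) (n : N) : S.Diamond CM →ₗ[k] CM.Tensor CN :=
  S.diaLift CM (LinearMap.mk₂ k (fun X m => CM.tmul CN (CM.l (Γ.app X Y) m) n)
      (by intros; simp) (by intros; simp) (by intros; simp) (by intros; simp))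
    (by
      intro b X m
      simp [app_t_mul])

theorem pairAux_dia (Y : L) (n : N) (X : L) (m : M) :
    Γ.pairAux CM CN Y n (S.dia CM X m) = CM.tmul CN (CM.l (Γ.app X Y) m) n :=
  S.diaLift_dia CM _ _ X m

/-- For `x = ∑ X ⊗ m` in `L ×_B M` and `y = ∑ Y ⊗ n` in `L ⋄_B N`, the element
`∑ Γ(X, Y) . m ⊗ n` of `M ⊗_B N`, for fixed `x`. -/
def pairFix (x : S.Takeuchi CM) : S.Diamond CN →ₗ[k] CM.Tensor CN :=
  S.diaLift CN (LinearMap.mk₂ k (fun Y n => Γ.pairAux CM CN Y n (x : S.Diamond CM))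
      (by
        intro Y Y' n
        rw [← LinearMap.add_apply]
        congr 1
        apply S.dia_ext
        simp [pairAux_dia])
      (by
        intro c Y n
        rw [← LinearMap.smul_apply]
        congr 1
        apply S.dia_ext
        simp [pairAux_dia])
      (by
        intro Y n n'
        rw [← LinearMap.add_apply]
        congr 1
        apply S.dia_ext
        simp [pairAux_dia])
      (by
        intro c Y n
        rw [← LinearMap.smul_apply]
        congr 1
        apply S.dia_ext
        simp [pairAux_dia]))
    (by
      intro b Y n
      have h1 : Γ.pairAux CM CN (S.t (op b) * Y) n
          = Γ.pairAux CM CN Y n ∘ₗ S.diaMulRight CM (S.t (op b)) := by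
        apply S.dia_ext
        simp [pairAux_dia, app_balanced]
      have h2 : Γ.pairAux CM CN Y (CN.l b n)
          = Γ.pairAux CM CN Y n ∘ₗ S.diaActRight CM b := by
        apply S.dia_ext
        simp [pairAux_dia, CM.comm, Bimod.tmul_balanced]
      simp only [LinearMap.mk₂_apply, h1, h2, LinearMap.comp_apply, x.2 b])

theorem pairFix_dia (x : S.Takeuchi CM) (Y : L) (n : N) :
    Γ.pairFix CM CN x (S.dia CN Y n) = Γ.pairAux CM CN Y n (x : S.Diamond CM) :=
  S.diaLift_dia CN _ _ Y n

/-- The bilinear map `L ×_B M × L ⋄_B N → M ⊗_B N` with value `∑ Γ(X, Y) . m ⊗ n` at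
`∑ X ⊗ m` and `∑ Y ⊗ n`. -/
def pair : S.Takeuchi CM →ₗ[k] S.Diamond CN →ₗ[k] CM.Tensor CN where
  toFun := Γ.pairFix CM CN
  map_add' := by
    intro x x'
    apply S.dia_ext
    simp [pairFix_dia]
  map_smul' := by
    intro c x
    apply S.dia_ext
    simp [pairFix_dia]

@[simp] theorem pair_dia (x : S.Takeuchi CM) (Y : L) (n : N) :
    Γ.pair CM CN x (S.dia CN Y n) = Γ.pairAux CM CN Y n (x : S.Diamond CM) :=
  Γ.pairFix_dia CM CN x Y n

end

end BarHom

variable (H : LeftBialgebroid k B L)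

/-- The element `Γ(X₁, Y₁) X₂ Y₂` of `L`. -/
def BarHom.leftTwist {H : LeftBialgebroid k B L} (Γ : BarHom H.toBeRing) (X Y : L) : L :=
  H.mulTensor (Γ.pair H.regular H.regular (H.Δ X) (H.Δ Y : H.Diamond H.regular))

/-- A left 2-cocycle on the left bialgebroid `L`. -/
structure LeftTwoCocycle extends BarHom H.toBeRing where
  cocycle : ∀ X Y Z : L, toBarHom.app X (toBarHom.leftTwist Y Z)
    = toBarHom.app (toBarHom.leftTwist X Y) Z
  unit_left : ∀ X : L, toBarHom.app 1 X = H.ε X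
  unit_right : ∀ X : L, toBarHom.app X 1 = H.ε X

namespace LeftTwoCocycle

variable {H} (Γ : LeftTwoCocycle H)

section

variable {M : Type*} [AddCommGroup M] [Module k M] (CM : LeftComodule H M)

/-- The left action `a ·_Γ m = Γ(s a, m₍₋₁₎) . m₍₀₎` on a left comodule. -/
def actLeft (a : B) : M →ₗ[k] M :=
  H.diaLift CM.toBimod (CM.l.toLinearMap ∘ₗ Γ.app (H.s a)) (by
      intro b X m
      have : Γ.app (H.s a) (H.t (op b) * X) = Γ.app (H.s a) X * b := by
        rw [← Γ.app_balanced, H.comm, Γ.app_t_mul]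
      simp [this])
    ∘ₗ (H.Takeuchi CM.toBimod).subtype ∘ₗ CM.δ

/-- The right action `m ·_Γ a = Γ(m₍₋₁₎, s a) . m₍₀₎` on a left comodule. -/
def actRight (a : B) : M →ₗ[k] M :=
  H.diaLift CM.toBimod (CM.l.toLinearMap ∘ₗ Γ.app.flip (H.s a)) (by
      intro b X m
      simp [Γ.app_t_mul])
    ∘ₗ (H.Takeuchi CM.toBimod).subtype ∘ₗ CM.δ

end

/-- The 2-cocycle `Γ` is invertible if, for all left comodules `M` and `N`, the map
`Γ^# : M ⊗_{B^Γ} N → M ⊗_B N`, `m ⊗ n ↦ Γ(m₍₋₁₎, n₍₋₁₎) . m₍₀₎ ⊗ n₍₀₎`, is bijective. -/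
def IsInvertible : Prop :=
  ∀ (M N : Type v) [AddCommGroup M] [AddCommGroup N] [Module k M] [Module k N]
    (CM : LeftComodule H M) (CN : LeftComodule H N),
    ∃ e : BalTensor (Γ.actRight CM) (Γ.actLeft CN) ≃ₗ[k] CM.Tensor CN.toBimod,
      ∀ (m : M) (n : N), e (BalTensor.tmul (Γ.actRight CM) (Γ.actLeft CN) m n)
        = Γ.pair CM.toBimod CN.toBimod (CM.δ m) (CN.δ n : H.Diamond CN.toBimod)

end LeftTwoCocycle

/-! ### The cotwisted operations -/

namespace LeftTwoCocycle

variable {H : LeftHopfAlgebroid k B L} (Γ : LeftTwoCocycle H.toLeftBialgebroid)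

/-- The product `a ·_Γ b = Γ(s a, s b)` on `B`. -/
def baseMul (a b : B) : B := Γ.app (H.s a) (H.s b)

/-- The bilinear map `(X, Y) ↦ X₊ * Y₊ * t (Γ(Y₋, X₋))`. -/
noncomputable def rightTwist : L →ₗ[k] L →ₗ[k] L :=
  (((Γ.pair H.opposite H.opposite).compl₁₂ H.minusPlus
    ((H.Takeuchi H.opposite).subtype ∘ₗ H.minusPlus)).compr₂ H.oppositeMul).flip

theorem rightTwist_apply (X Y : L) : Γ.rightTwist X Y = H.oppositeMul
    (Γ.pair H.opposite H.opposite (H.minusPlus Y) (H.minusPlus X : H.Diamond H.opposite)) := rfl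

theorem rightTwist_balanced (b : B) (X Y : L) :
    Γ.rightTwist (X * H.s b) Y = Γ.rightTwist X (H.s b * Y) := by
  let F (Y : L) : H.TensorBar →ₗ[k] L :=
    H.oppositeMul ∘ₗ Γ.pair H.opposite H.opposite (H.minusPlus Y) ∘ₗ H.flipBar
  have hF : ∀ X Y, Γ.rightTwist X Y = F Y (H.plusMinus X) := fun _ _ => rfl
  have key : F Y ∘ₗ H.tbarMulMid b = F (H.s b * Y) := by
    apply H.tbar_ext
    intro X' X''
    let G (X' : L) : H.TensorBar →ₗ[k] L :=
      H.oppositeMul ∘ₗ Γ.pairAux H.opposite H.opposite X'' X' ∘ₗ H.flipBar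
    have hG : ∀ X' Y, F Y (H.tbar X' X'') = G X' (H.plusMinus Y) := by
      intro X' Y
      simp [F, G]
    have hG' : G (X' * H.s b) = G X' ∘ₗ H.tbarMulLeft (H.s b) := by
      apply H.tbar_ext
      intro Y' Y''
      simp only [G, LinearMap.comp_apply, BeRing.tbarMulLeft_tbar, LeftHopfAlgebroid.flipBar_tbar,
        BarHom.pairAux_dia, BeRing.oppositeMul, Bimod.tensorLift_tmul, BeRing.opposite_l,
        LinearMap.flip_apply, LinearMap.mul_apply', mul_assoc]
    simp only [LinearMap.comp_apply, BeRing.tbarMulMid_tbar, hG, hG',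
      LeftHopfAlgebroid.plusMinus_s_mul]
  rw [hF, hF, H.plusMinus_mul_s, ← key]
  rfl

/-- The product `X ·_Γ Y = Γ(X₁, Y₁) X₂₊ Y₂₊ t (Γ(Y₂₋, X₂₋))` on `L`. -/
noncomputable def twistMul (X Y : L) : L :=
  (H.regular.tensorLift H.regular Γ.rightTwist Γ.rightTwist_balanced :
      H.regular.Tensor H.regular →ₗ[k] L)
    (Γ.pair H.regular H.regular (H.Δ X) (H.Δ Y : H.Diamond H.regular))

/-- The counit `ε^Γ(X) = Γ(X₊, X₋)`. -/
noncomputable def twistCounit (X : L) : B := Γ.toLin (H.plusMinus X)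

/-- The element `Γ^#(X ⊗ Y) = X₊ t (Γ(X₋, Y₁)) ⊗ Y₂` of `L ⋄_B L`. -/
noncomputable def sharp (X Y : L) : H.Diamond H.regular :=
  Γ.pair H.opposite H.regular (H.minusPlus X) (H.Δ Y : H.Diamond H.regular)

end LeftTwoCocycle

end Cocycle

end Cotwist

/-!
The proof rests on two devices.

*The product* `X ∗ Y = Γ(X₁, Y₁) X₂ Y₂` on `L`. The cocycle condition makes it associative with
unit `1` (`star_assoc`), and `L ⊗_{B̄} L` becomes a left `(L, ∗)`-module through the first factor
and a right `(L, ∗)`-module through the second. Since `X ↦ X₊ ⊗ X₋` is injective, the cotwisted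
operations can be studied through their images in `L ⊗_{B̄} L`, where they are given by `∗` alone:
* `(X · Y)₊ ⊗ (X · Y)₋ = X₊ ∗ Y₊ ⊗ Y₋ ∗ X₋` for the cotwisted product (`plusMinus_twistMul`), from
  which its associativity is immediate;
* `s (ε^Γ(X)) = X₊ ∗ X₋` (`BarHom.mulStar_plusMinus`), from which the axioms for `ε^Γ` follow;
* `Γ^#(X ⊗ Y) = λ(X₊ ⊗ X₋ ∗ Y)` (`sharp_eq`), so that `Δ^Γ(X)` is the unique element `∑ u ⊗ v` with
  `∑ u₊ ⊗ u₋ ∗ v = X ⊗ 1`. The map `Γ^#` is bijective by the invertibility of `Γ` for the comodules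
  `(L, X ↦ X₋ ⊗ X₊)` and `(L, Δ)`.

*The translation formula* `translation_apply`: if `∑ u₊ ⊗ u₋ ∗ v = X ⊗ 1`, then
`∑ u₊ ⊗ u₋ ∗ v₊ ⊗ v₋ = X₊ ⊗ 1 ⊗ X₋`. Applied to suitable balanced maps, it yields the
multiplicativity of `Δ^Γ` (`Realization.comul_mul`), one of the two counit axioms
(`translation_counit`) and coassociativity (`Realization.coassoc`). It also computes the canonical
map of the cotwisted bialgebroid: up to `λ⁻¹ ∘ Γ^#` it is `X ⊗ Y ↦ X₊ ⊗ Y₊ t (Γ(Y₋, X₋))`, and this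
is bijective by the invertibility of `Γ` for the comodule `(L, X ↦ X₋ ⊗ X₊)` in both places
(`Realization.exists_galois`).

An identity between Sweedler sums in a multiple balanced tensor product is stated as an equality of
values under balanced multilinear maps, and such a map is given by its partial maps; see
`LeftComodule.coassoc_apply`, `LeftHopfAlgebroid.comul_plus_apply` and
`LeftHopfAlgebroid.comul_minus_apply`.
-/

namespace Cotwist

/-! ### Finite sums of pure tensors -/

section Sums

variable {k : Type*} {B : Type*} {M N : Type*} [Field k]
  [AddCommGroup M] [Module k M] [AddCommGroup N] [Module k N]

theorem exists_sum_tmul (z : M ⊗[k] N) :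
    ∃ (n : ℕ) (a : Fin n → M) (c : Fin n → N), z = ∑ i, a i ⊗ₜ[k] c i := by
  induction z with
  | zero => exact ⟨0, Fin.elim0, Fin.elim0, by simp⟩
  | tmul m n => exact ⟨1, fun _ => m, fun _ => n, by simp⟩
  | add x y hx hy =>
    obtain ⟨n, a, c, rfl⟩ := hx
    obtain ⟨n', a', c', rfl⟩ := hy
    exact ⟨n + n', Fin.append a a', Fin.append c c', by simp [Fin.sum_univ_add]⟩

theorem BalTensor.exists_sum {r : B → M →ₗ[k] M} {l : B → N →ₗ[k] N} (z : BalTensor r l) :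
    ∃ (n : ℕ) (a : Fin n → M) (c : Fin n → N), z = ∑ i, BalTensor.tmul r l (a i) (c i) := by
  obtain ⟨z, rfl⟩ := Submodule.Quotient.mk_surjective _ z
  obtain ⟨n, a, c, rfl⟩ := exists_sum_tmul z
  exact ⟨n, a, c, map_sum (balRel r l).mkQ _ _⟩

end Sums

/-! ### Coassociativity and counits under linear maps -/

section Bialg

variable {k : Type w} {B : Type u} {L : Type v} [Field k] [Ring B] [Algebra k B]
  [Ring L] [Algebra k L]

namespace BeRing

variable (S : BeRing k B L) {M : Type*} [AddCommGroup M] [Module k M] (CM : Bimod k B M)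

theorem exists_dia (z : S.Diamond CM) :
    ∃ (n : ℕ) (a : Fin n → L) (c : Fin n → M), z = ∑ i, S.dia CM (a i) (c i) :=
  BalTensor.exists_sum z

theorem exists_tbar (z : S.TensorBar) :
    ∃ (n : ℕ) (a c : Fin n → L), z = ∑ i, S.tbar (a i) (c i) :=
  BalTensor.exists_sum z

end BeRing

namespace LeftComodule

variable {H : LeftBialgebroid k B L} {M : Type*} [AddCommGroup M] [Module k M]
  {Q : Type*} [AddCommGroup Q] [Module k Q]

/-- Coassociativity, applied to a trilinear map `F`: the sums of `F (x₁, x₂, m)` over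
`Δ m₍₋₁₎ ⊗ m₍₀₎` and of `F (x, y, n)` over `m₍₋₁₎ ⊗ δ m₍₀₎` agree. The map `F` is given by its
partial maps `f m` and `g x`; that both exist says that `F` is balanced. -/
theorem coassoc_apply (CM : LeftComodule H M) (G K : H.Diamond CM.toBimod →ₗ[k] Q)
    (f : M → H.Diamond H.regular →ₗ[k] Q) (g : L → H.Diamond CM.toBimod →ₗ[k] Q)
    (hG : ∀ x m, G (H.dia CM.toBimod x m) = f m (H.Δ x))
    (hK : ∀ x m, K (H.dia CM.toBimod x m) = g x (CM.δ m))
    (hfg : ∀ x y m, f m (H.dia H.regular x y) = g x (H.dia CM.toBimod y m)) (m : M) :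
    G (CM.δ m) = K (CM.δ m) := by
  let T : L →ₗ[k] L ⊗[k] M →ₗ[k] Q :=
    { toFun := fun x => g x ∘ₗ (balRel _ _).mkQ
      map_add' := by
        intro x x'
        apply TensorProduct.ext'
        intro y m
        change g (x + x') (H.dia CM.toBimod y m)
          = g x (H.dia CM.toBimod y m) + g x' (H.dia CM.toBimod y m)
        simp only [← hfg, map_add, LinearMap.add_apply]
      map_smul' := by
        intro c x
        apply TensorProduct.ext'
        intro y m
        change g (c • x) (H.dia CM.toBimod y m) = c • g x (H.dia CM.toBimod y m)
        simp only [← hfg, map_smul, LinearMap.smul_apply] }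
  have hT : ∀ x y m, T x (y ⊗ₜ m) = g x (H.dia CM.toBimod y m) := fun _ _ _ => rfl
  let Φ : H.Diamond₃ CM.toBimod →ₗ[k] Q := (H.diamond₃Rel CM.toBimod).liftQ
    (TensorProduct.lift T) (by
      refine Submodule.span_le.2 ?_
      rintro _ (⟨b, x, y, m, rfl⟩ | ⟨b, x, y, m, rfl⟩)
      · simp only [SetLike.mem_coe, LinearMap.mem_ker, map_sub, TensorProduct.lift.tmul, hT,
          ← hfg, H.dia_balanced, BeRing.regular_l, sub_self]
      · simp only [SetLike.mem_coe, LinearMap.mem_ker, map_sub, TensorProduct.lift.tmul, hT,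
          H.dia_balanced, sub_self])
  have hΦ : ∀ x y m, Φ (H.dia₃ CM.toBimod x y m) = g x (H.dia CM.toBimod y m) := by
    intro x y m
    exact (TensorProduct.lift.tmul x (y ⊗ₜ[k] m) : TensorProduct.lift T _ = _)
  obtain ⟨z, hz⟩ := Submodule.Quotient.mk_surjective _ (CM.δ m : H.Diamond CM.toBimod)
  have h := congrArg Φ (CM.coassoc m z hz)
  have h1 : Φ ∘ₗ H.comulLeft CM.toBimod H.Δ = G ∘ₗ (balRel _ _).mkQ := by
    apply TensorProduct.ext'
    intro x m
    have : Φ ∘ₗ (H.diaTail CM.toBimod).flip m = f m := by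
      apply H.dia_ext
      intro x y
      simp [H.diaTail_dia, hΦ, hfg]
    have h2 := LinearMap.congr_fun this (H.Δ x)
    exact h2.trans (hG x m).symm
  have h2 : Φ ∘ₗ H.coactRight CM.toBimod CM.δ = K ∘ₗ (balRel _ _).mkQ := by
    apply TensorProduct.ext'
    intro x m
    have : Φ ∘ₗ H.diaHead CM.toBimod x = g x := by
      apply H.dia_ext
      intro y m
      simp [H.diaHead_dia, hΦ]
    have h2 := LinearMap.congr_fun this (CM.δ m)
    exact h2.trans (hK x m).symm
  have e1 := LinearMap.congr_fun h1 z
  have e2 := LinearMap.congr_fun h2 z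
  rw [← hz]
  exact e1.symm.trans (h.trans e2)

end LeftComodule

namespace LeftBialgebroid

variable (H : LeftBialgebroid k B L) {Q : Type*} [AddCommGroup Q] [Module k Q]

theorem Δ_mul_s (X : L) (b : B) : (H.Δ (X * H.s b) : H.Diamond H.regular)
    = H.diaMulRight₂ (H.s b) 1 (H.Δ X : H.Diamond H.regular) := by
  simp [H.Δ_mul, Δ_s']

theorem Δ_mul_t (X : L) (b : B) : (H.Δ (X * H.t (op b)) : H.Diamond H.regular)
    = H.diaMulRight₂ 1 (H.t (op b)) (H.Δ X : H.Diamond H.regular) := by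
  simp [H.Δ_mul, Δ_t']

/-- The algebra `L` as a left comodule over itself. -/
def regularComodule : LeftComodule H L where
  toBimod := H.regular
  δ := H.Δ
  δ_bimod := by
    intro a b X
    rw [BeRing.regular_r, BeRing.regular_l, Δ_s, Δ_mul_s, ← LinearMap.comp_apply]
    congr 1
    apply H.dia_ext
    intro Y Z
    simp only [LinearMap.comp_apply, BeRing.diaMulRight₂_dia, BeRing.diaMulLeft_dia, mul_one,
      op_one, map_one, one_mul, ← mul_assoc]
    simp [BeRing.diaBimod, BeRing.dia]
  coassoc := H.coassoc
  counit := H.counit_left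

/-- Coassociativity of `Δ`, applied to a balanced trilinear map that is given by its partial maps
`f z` and `g x`. -/
theorem coassoc_apply (G K : H.Diamond H.regular →ₗ[k] Q)
    (f g : L → H.Diamond H.regular →ₗ[k] Q)
    (hG : ∀ x z, G (H.dia H.regular x z) = f z (H.Δ x))
    (hK : ∀ x y, K (H.dia H.regular x y) = g x (H.Δ y))
    (hfg : ∀ x y z, f z (H.dia H.regular x y) = g x (H.dia H.regular y z)) (X : L) :
    G (H.Δ X) = K (H.Δ X) :=
  H.regularComodule.coassoc_apply G K f g hG hK hfg X

/-- A linear map on `L ⋄_B L` that sends `x ⊗ y` to `s (ε x) * y` sends `Δ X` to `X`. -/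
theorem counit_left_apply (G : H.Diamond H.regular →ₗ[k] L)
    (hG : ∀ x y, G (H.dia H.regular x y) = H.s (H.ε x) * y) (X : L) : G (H.Δ X) = X := by
  obtain ⟨z, hz⟩ := Submodule.Quotient.mk_surjective _ (H.Δ X : H.Diamond H.regular)
  have h1 : G ∘ₗ (balRel _ _).mkQ
      = TensorProduct.lift ((LinearMap.mul k L).comp (H.s.toLinearMap ∘ₗ H.ε)) := by
    apply TensorProduct.ext'
    intro x y
    exact hG x y
  rw [← hz]
  exact (LinearMap.congr_fun h1 z).trans (H.counit_left X z hz)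

theorem counit_right_apply (G : H.Diamond H.regular →ₗ[k] L)
    (hG : ∀ x y, G (H.dia H.regular x y) = H.t (op (H.ε y)) * x) (X : L) : G (H.Δ X) = X := by
  obtain ⟨z, hz⟩ := Submodule.Quotient.mk_surjective _ (H.Δ X : H.Diamond H.regular)
  have h1 : G ∘ₗ (balRel _ _).mkQ
      = TensorProduct.lift ((LinearMap.mul k L).comp
      (H.t.toLinearMap ∘ₗ (opLinearEquiv k).toLinearMap ∘ₗ H.ε)).flip := by
    apply TensorProduct.ext'
    intro x y
    exact hG x y
  rw [← hz]
  exact (LinearMap.congr_fun h1 z).trans (H.counit_right X z hz)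

theorem ε_s_mul (b : B) (X : L) : H.ε (H.s b * X) = b * H.ε X := by
  simpa using H.ε_bimod b 1 X

theorem ε_t_mul (b : B) (X : L) : H.ε (H.t (op b) * X) = H.ε X * b := by
  simpa using H.ε_bimod 1 b X

theorem ε_s (b : B) : H.ε (H.s b) = b := by
  simpa [H.ε_one] using H.ε_s_mul b 1

/-- The Takeuchi condition for `Δ X`. -/
theorem Δ_takeuchi (b : B) (X : L) :
    H.diaMulRight₂ (H.t (op b)) 1 (H.Δ X : H.Diamond H.regular)
      = H.diaMulRight₂ 1 (H.s b) (H.Δ X : H.Diamond H.regular) := by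
  have h1 : H.diaMulRight₂ (H.t (op b)) 1 = H.diaMulRight H.regular (H.t (op b)) := by
    apply H.dia_ext
    simp
  have h2 : H.diaMulRight₂ 1 (H.s b) = H.diaActRight H.regular b := by
    apply H.dia_ext
    simp
  rw [h1, h2]
  exact (H.Δ X).2 b

end LeftBialgebroid

end Bialg

/-! ### Identities for `X₊ ⊗ X₋` -/

section Hopf

variable {k : Type w} {B : Type u} {L : Type v} [Field k] [Ring B] [Algebra k B]
  [Ring L] [Algebra k L]

namespace BeRing

variable (S : BeRing k B L)

/-- `X ⊗ Y ↦ X ⊗ s b * Y` on `L ⊗_{B̄} L`. -/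
def tbarMulMid' (b : B) : S.TensorBar →ₗ[k] S.TensorBar :=
  BalTensor.map LinearMap.id (LinearMap.mulLeft k (S.s b))
    (by intros; rfl) (by intros; simp [← mul_assoc, S.comm])

@[simp] theorem tbarMulMid'_tbar (b : B) (X Y : L) :
    S.tbarMulMid' b (S.tbar X Y) = S.tbar X (S.s b * Y) := rfl

theorem tbarMulLeft_mulRight (Z W : L) (z : S.TensorBar) :
    S.tbarMulLeft Z (S.tbarMulRight W z) = S.tbarMulRight W (S.tbarMulLeft Z z) := by
  have : S.tbarMulLeft Z ∘ₗ S.tbarMulRight W = S.tbarMulRight W ∘ₗ S.tbarMulLeft Z := by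
    apply S.tbar_ext
    simp
  exact LinearMap.congr_fun this z

theorem tbarMulRight_mulRight (Z W : L) (z : S.TensorBar) :
    S.tbarMulRight Z (S.tbarMulRight W z) = S.tbarMulRight (W * Z) z := by
  have : S.tbarMulRight Z ∘ₗ S.tbarMulRight W = S.tbarMulRight (W * Z) := by
    apply S.tbar_ext
    simp [mul_assoc]
  exact LinearMap.congr_fun this z

theorem tbarMulLeft_mulLeft (Z W : L) (z : S.TensorBar) :
    S.tbarMulLeft Z (S.tbarMulLeft W z) = S.tbarMulLeft (Z * W) z := by
  have : S.tbarMulLeft Z ∘ₗ S.tbarMulLeft W = S.tbarMulLeft (Z * W) := by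
    apply S.tbar_ext
    simp [mul_assoc]
  exact LinearMap.congr_fun this z

theorem tbarMulRight_add (Z W : L) :
    S.tbarMulRight (Z + W) = S.tbarMulRight Z + S.tbarMulRight W := by
  apply S.tbar_ext
  simp [mul_add]

theorem tbarMulRight_smul (c : k) (W : L) : S.tbarMulRight (c • W) = c • S.tbarMulRight W := by
  apply S.tbar_ext
  simp

theorem tbarMulLeft_add (Z W : L) :
    S.tbarMulLeft (Z + W) = S.tbarMulLeft Z + S.tbarMulLeft W := by
  apply S.tbar_ext
  simp [add_mul]

theorem tbarMulLeft_smul (c : k) (W : L) : S.tbarMulLeft (c • W) = c • S.tbarMulLeft W := by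
  apply S.tbar_ext
  simp

theorem tbarMulRight_one (z : S.TensorBar) : S.tbarMulRight 1 z = z := by
  have : S.tbarMulRight 1 = LinearMap.id := by
    apply S.tbar_ext
    simp
  exact LinearMap.congr_fun this z

end BeRing

namespace LeftHopfAlgebroid

variable (H : LeftHopfAlgebroid k B L) {Q : Type*} [AddCommGroup Q] [Module k Q]

/-- The inverse of `λ`. -/
noncomputable def lamInv : H.Diamond H.regular →ₗ[k] H.TensorBar :=
  (LinearEquiv.ofBijective H.lam H.lam_bijective).symm.toLinearMap

theorem lam_lamInv (z : H.Diamond H.regular) : H.lam (H.lamInv z) = z :=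
  (LinearEquiv.ofBijective H.lam H.lam_bijective).apply_symm_apply z

@[simp] theorem lamInv_lam (z : H.TensorBar) : H.lamInv (H.lam z) = z :=
  (LinearEquiv.ofBijective H.lam H.lam_bijective).symm_apply_apply z

theorem lamInv_dia (X Y : L) :
    H.lamInv (H.dia H.regular X Y) = H.tbarMulRight Y (H.plusMinus X) := by
  apply H.lam_bijective.1
  rw [lam_lamInv, H.lam_mulRight, lam_plusMinus]
  simp

theorem plusMinus_t_mul (b : B) (X : L) :
    H.plusMinus (H.t (op b) * X) = H.tbarMulRight (H.s b) (H.plusMinus X) := by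
  symm
  apply H.eq_plusMinus
  rw [H.lam_mulRight, lam_plusMinus, H.dia_balanced]
  simp

theorem plusMinus_mul_t (b : B) (X : L) :
    H.plusMinus (X * H.t (op b)) = H.tbarMulMid' b (H.plusMinus X) := by
  symm
  apply H.eq_plusMinus
  have h : H.lam ∘ₗ H.tbarMulMid' b = H.diaMulRight₂ (H.t (op b)) 1 ∘ₗ H.lam := by
    apply H.tbar_ext
    intro X Y
    have h1 : H.diaMulRight₂ 1 (H.s b * Y) = H.diaMulRight₂ 1 Y ∘ₗ H.diaMulRight₂ 1 (H.s b) := by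
      apply H.dia_ext
      simp [mul_assoc]
    have h2 : H.diaMulRight₂ 1 Y ∘ₗ H.diaMulRight₂ (H.t (op b)) 1
        = H.diaMulRight₂ (H.t (op b)) 1 ∘ₗ H.diaMulRight₂ 1 Y := by
      apply H.dia_ext
      simp
    simp only [LinearMap.comp_apply, BeRing.tbarMulMid'_tbar, LeftBialgebroid.lam_tbar, h1,
      ← H.Δ_takeuchi]
    exact LinearMap.congr_fun h2 _
  have h' := LinearMap.congr_fun h (H.plusMinus X)
  simpa [lam_plusMinus] using h'

theorem plusMinus_one : H.plusMinus 1 = H.tbar 1 1 := by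
  symm
  apply H.eq_plusMinus
  simp [H.Δ_one]

theorem plusMinus_s (b : B) : H.plusMinus (H.s b) = H.tbar (H.s b) 1 := by
  have := H.plusMinus_s_mul b 1
  rwa [mul_one, plusMinus_one, BeRing.tbarMulLeft_tbar, mul_one] at this

theorem plusMinus_t (b : B) : H.plusMinus (H.t (op b)) = H.tbar 1 (H.s b) := by
  have := H.plusMinus_t_mul b 1
  rwa [mul_one, plusMinus_one, BeRing.tbarMulRight_tbar, one_mul] at this

/-- The identity `X₊₁ ⊗ X₊₂ ⊗ X₋ = X₁ ⊗ X₂₊ ⊗ X₂₋`, applied to a balanced trilinear map that is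
given by its partial maps `f z` and `g x`. -/
theorem comul_plus_apply (G : H.TensorBar →ₗ[k] Q) (K : H.Diamond H.regular →ₗ[k] Q)
    (f : L → H.Diamond H.regular →ₗ[k] Q) (g : L → H.TensorBar →ₗ[k] Q)
    (hG : ∀ x z, G (H.tbar x z) = f z (H.Δ x))
    (hK : ∀ x y, K (H.dia H.regular x y) = g x (H.plusMinus y))
    (hfg : ∀ x y z, f z (H.dia H.regular x y) = g x (H.tbar y z)) (X : L) :
    G (H.plusMinus X) = K (H.Δ X) := by
  have g_add : ∀ x x', g (x + x') = g x + g x' := by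
    intro x x'
    apply H.tbar_ext
    simp [← hfg]
  have g_smul : ∀ (c : k) x, g (c • x) = c • g x := by
    intro c x
    apply H.tbar_ext
    simp [← hfg]
  have g_t : ∀ b x, g (H.t (op b) * x) = g x ∘ₗ H.tbarMulLeft (H.s b) := by
    intro b x
    apply H.tbar_ext
    simp [← hfg, H.dia_balanced]
  -- `h z (x ⊗ y) = g x (λ⁻¹ (y ⊗ z))`
  obtain ⟨h, h_dia⟩ : ∃ h : L → H.Diamond H.regular →ₗ[k] Q, ∀ x y z,
      h z (H.dia H.regular x y) = g x (H.tbarMulRight z (H.plusMinus y)) :=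
    ⟨fun z => H.diaLift H.regular
      (LinearMap.mk₂ k (fun x y => g x (H.tbarMulRight z (H.plusMinus y)))
        (by intros; simp [g_add]) (by intros; simp [g_smul]) (by intros; simp) (by intros; simp))
      (by
        intro b x y
        simp [g_t, BeRing.tbarMulLeft_mulRight, plusMinus_s_mul]),
      fun x y z => H.diaLift_dia H.regular _ _ x y⟩
  have h_add : ∀ z z', h (z + z') = h z + h z' := by
    intro z z'
    apply H.dia_ext
    simp [h_dia, BeRing.tbarMulRight_add]
  have h_smul : ∀ (c : k) z, h (c • z) = c • h z := by
    intro c z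
    apply H.dia_ext
    simp [h_dia, BeRing.tbarMulRight_smul]
  have h_t : ∀ b z, h z ∘ₗ H.diaMulLeft 1 b = h (H.s b * z) := by
    intro b z
    apply H.dia_ext
    simp [h_dia, plusMinus_t_mul, BeRing.tbarMulRight_mulRight]
  -- `K' (x ⊗ z) = h z (Δ x)`, so that `G = K' ∘ λ`
  obtain ⟨K', K'_dia⟩ : ∃ K' : H.Diamond H.regular →ₗ[k] Q, ∀ x z,
      K' (H.dia H.regular x z) = h z (H.Δ x) :=
    ⟨H.diaLift H.regular
      (LinearMap.mk₂ k (fun x z => h z (H.Δ x))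
        (by intros; simp) (by intros; simp) (by intros; simp [h_add]) (by intros; simp [h_smul]))
      (by
        intro b x z
        have := LinearMap.congr_fun (h_t b z) (H.Δ x)
        simpa [LeftBialgebroid.Δ_t] using this), fun x z => H.diaLift_dia H.regular _ _ x z⟩
  have hGK : G = K' ∘ₗ H.lam := by
    apply H.tbar_ext
    intro x z
    rw [hG, LinearMap.comp_apply, LeftBialgebroid.lam_tbar]
    refine (H.coassoc_apply (K' ∘ₗ H.diaMulRight₂ 1 z) (f z)
      (fun y => h (y * z)) (fun x => g x ∘ₗ H.lamInv ∘ₗ H.diaMulRight₂ 1 z) ?_ ?_ ?_ x).symm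
    · intro x y
      simp [K'_dia]
    · intro x y
      rw [LinearMap.comp_apply, LinearMap.comp_apply, ← LeftBialgebroid.lam_tbar, lamInv_lam]
      exact hfg x y z
    · intro x y y'
      rw [h_dia, LinearMap.comp_apply, LinearMap.comp_apply, BeRing.diaMulRight₂_dia,
        lamInv_dia, mul_one]
  have hK1 : h 1 = K := by
    apply H.dia_ext
    intro x y
    rw [h_dia, hK, BeRing.tbarMulRight_one]
  rw [hGK, LinearMap.comp_apply, lam_plusMinus, ← hK1]
  simp [K'_dia]

/-- The identity `X₊ ⊗ X₋₁ ⊗ X₋₂ = X₊₊ ⊗ X₋ ⊗ X₊₋`, applied to a balanced trilinear map that is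
given by its partial maps `f x` and `g y`. -/
theorem comul_minus_apply (G K : H.TensorBar →ₗ[k] Q)
    (f : L → H.Diamond H.regular →ₗ[k] Q) (g : L → H.TensorBar →ₗ[k] Q)
    (hG : ∀ x y, G (H.tbar x y) = f x (H.Δ y))
    (hK : ∀ x y, K (H.tbar x y) = g y (H.plusMinus x))
    (hfg : ∀ x y z, f x (H.dia H.regular y z) = g y (H.tbar x z)) (X : L) :
    G (H.plusMinus X) = K (H.plusMinus X) := by
  have g_add : ∀ x x', g (x + x') = g x + g x' := by
    intro x x'
    apply H.tbar_ext
    simp [← hfg]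
  have g_smul : ∀ (c : k) x, g (c • x) = c • g x := by
    intro c x
    apply H.tbar_ext
    simp [← hfg]
  have g_t : ∀ b y, g (H.t (op b) * y) = g y ∘ₗ H.tbarMulMid' b := by
    intro b x
    apply H.tbar_ext
    simp [← hfg, H.dia_balanced]
  have mid : ∀ (b : B) (z : L) (w : H.TensorBar), H.tbarMulMid' b (H.tbarMulRight z w)
      = H.tbarMulRight z (H.tbarMulMid' b w) := by
    intro b z w
    have : H.tbarMulMid' b ∘ₗ H.tbarMulRight z = H.tbarMulRight z ∘ₗ H.tbarMulMid' b := by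
      apply H.tbar_ext
      simp [mul_assoc]
    exact LinearMap.congr_fun this w
  -- `m z (x ⊗ y) = g y (λ⁻¹ (x ⊗ z))`
  obtain ⟨m, m_tbar⟩ : ∃ m : L → H.TensorBar →ₗ[k] Q, ∀ x y z, m z (H.tbar x y)
      = g y (H.tbarMulRight z (H.plusMinus x)) :=
    ⟨fun z => H.tbarLift
      (LinearMap.mk₂ k (fun x y => g y (H.tbarMulRight z (H.plusMinus x)))
        (by intros; simp) (by intros; simp) (by intros; simp [g_add]) (by intros; simp [g_smul]))
      (by
        intro b x y
        simp [g_t, plusMinus_mul_t, mid]), fun x y z => H.tbarLift_tbar _ _ x y⟩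
  have m_add : ∀ z z', m (z + z') = m z + m z' := by
    intro z z'
    apply H.tbar_ext
    simp [m_tbar, BeRing.tbarMulRight_add]
  have m_smul : ∀ (c : k) z, m (c • z) = c • m z := by
    intro c z
    apply H.tbar_ext
    simp [m_tbar, BeRing.tbarMulRight_smul]
  have m_t : ∀ b z, m z ∘ₗ H.tbarMulLeft (H.t (op b)) = m (H.s b * z) := by
    intro b z
    apply H.tbar_ext
    simp [m_tbar, plusMinus_t_mul, BeRing.tbarMulRight_mulRight]
  -- `l x (y ⊗ z) = m z (λ⁻¹ (x ⊗ y))`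
  obtain ⟨l, l_dia⟩ : ∃ l : L → H.Diamond H.regular →ₗ[k] Q, ∀ x y z,
      l x (H.dia H.regular y z) = m z (H.tbarMulRight y (H.plusMinus x)) :=
    ⟨fun x => H.diaLift H.regular
      (LinearMap.mk₂ k (fun y z => m z (H.tbarMulRight y (H.plusMinus x)))
        (by intros; simp [BeRing.tbarMulRight_add]) (by intros; simp [BeRing.tbarMulRight_smul])
        (by intros; simp [m_add]) (by intros; simp [m_smul]))
      (by
        intro b y z
        simp only [LinearMap.mk₂_apply, ← BeRing.tbarMulRight_mulRight, plusMinus_comm_t]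
        rw [← BeRing.tbarMulLeft_mulRight, ← LinearMap.comp_apply, m_t, BeRing.regular_l]),
      fun x y z => H.diaLift_dia H.regular _ _ y z⟩
  have l_add : ∀ x x', l (x + x') = l x + l x' := by
    intro x x'
    apply H.dia_ext
    simp [l_dia]
  have l_smul : ∀ (c : k) x, l (c • x) = c • l x := by
    intro c x
    apply H.dia_ext
    simp [l_dia]
  have l_t : ∀ b x, l (H.t (op b) * x) = l x ∘ₗ H.diaMulLeft b 1 := by
    intro b x
    apply H.dia_ext
    simp [l_dia, plusMinus_t_mul, BeRing.tbarMulRight_mulRight]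
  -- `M (x ⊗ y) = l x (Δ y)`, so that `G = M ∘ λ`
  obtain ⟨M, M_dia⟩ : ∃ M : H.Diamond H.regular →ₗ[k] Q, ∀ x y,
      M (H.dia H.regular x y) = l x (H.Δ y) :=
    ⟨H.diaLift H.regular
      (LinearMap.mk₂ k (fun x y => l x (H.Δ y))
        (by intros; simp [l_add]) (by intros; simp [l_smul]) (by intros; simp) (by intros; simp))
      (by
        intro b x y
        simp [l_t, LeftBialgebroid.Δ_s]), fun x y => H.diaLift_dia H.regular _ _ x y⟩
  have hGM : G = M ∘ₗ H.lam := by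
    apply H.tbar_ext
    intro x y
    rw [hG, LinearMap.comp_apply, LeftBialgebroid.lam_tbar]
    obtain ⟨n, a, c, hac⟩ := H.exists_dia H.regular (H.Δ y : H.Diamond H.regular)
    have h := H.coassoc_apply
      (∑ i, g (a i) ∘ₗ H.lamInv ∘ₗ H.diaMulRight₂ 1 (c i)) (M ∘ₗ H.diaMulRight₂ 1 y)
      (fun x' => ∑ i, m (x' * c i) ∘ₗ H.lamInv ∘ₗ H.diaMulRight₂ 1 (a i))
      (fun x => ∑ i, l x ∘ₗ H.diaMulRight₂ (a i) (c i)) ?_ ?_ ?_ x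
    · refine Eq.trans ?_ h
      simp only [LinearMap.sum_apply, LinearMap.comp_apply, hac, map_sum, hfg]
      simp only [← LeftBialgebroid.lam_tbar, lamInv_lam]
    · intro x x'
      simp only [LinearMap.sum_apply, LinearMap.comp_apply]
      simp only [← LeftBialgebroid.lam_tbar, lamInv_lam, m_tbar, BeRing.diaMulRight₂_dia,
        lamInv_dia, mul_one]
    · intro x x'
      simp [M_dia, H.Δ_mul, hac]
    · intro x1 x2 x'
      simp [l_dia, lamInv_dia]
  have hKm : K = m 1 := by
    apply H.tbar_ext
    intro x y
    rw [hK, m_tbar, BeRing.tbarMulRight_one]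
  rw [hGM, hKm, LinearMap.comp_apply, lam_plusMinus]
  simp [M_dia, l_dia, LeftBialgebroid.Δ_one, BeRing.tbarMulRight_one]

/-- The map `X ⊗ Z ↦ X * Y₊ ⊗ Y₋ * Z`. -/
noncomputable def insertMul (Y : L) : H.TensorBar →ₗ[k] H.TensorBar :=
  H.tbarLift (LinearMap.mk₂ k (fun X Z => H.tbarMulLeft X (H.tbarMulRight Z (H.plusMinus Y)))
      (by intros; simp [BeRing.tbarMulLeft_add]) (by intros; simp [BeRing.tbarMulLeft_smul])
      (by intros; simp [BeRing.tbarMulRight_add]) (by intros; simp [BeRing.tbarMulRight_smul]))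
    (by
      intro b X Z
      simp only [LinearMap.mk₂_apply, ← BeRing.tbarMulRight_mulRight, plusMinus_comm_t,
        ← BeRing.tbarMulLeft_mulRight, BeRing.tbarMulLeft_mulLeft])

theorem insertMul_tbar (X Y Z : L) : H.insertMul Y (H.tbar X Z)
    = H.tbarMulLeft X (H.tbarMulRight Z (H.plusMinus Y)) := by
  exact H.tbarLift_tbar _ _ X Z

/-- The identity `(XY)₊ ⊗ (XY)₋ = X₊ Y₊ ⊗ Y₋ X₋`. -/
theorem plusMinus_mul (X Y : L) : H.plusMinus (X * Y) = H.insertMul Y (H.plusMinus X) := by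
  symm
  apply H.eq_plusMinus
  have h : H.lam ∘ₗ H.insertMul Y = H.diaMulRight₂ Y 1 ∘ₗ H.lam := by
    apply H.tbar_ext
    intro X Z
    have h1 : ∀ w, H.lam (H.tbarMulLeft X w) = H.takeuchiMul (H.Δ X) (H.lam w) := by
      intro w
      have : H.lam ∘ₗ H.tbarMulLeft X = H.takeuchiMul (H.Δ X) ∘ₗ H.lam := by
        apply H.tbar_ext
        intro X' Z
        have h2 : H.diaMulRight₂ 1 Z ∘ₗ H.takeuchiMul (H.Δ X)
            = H.takeuchiMul (H.Δ X) ∘ₗ H.diaMulRight₂ 1 Z := by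
          apply H.dia_ext
          intro Y Y'
          have h3 : H.diaMulRight₂ 1 Z ∘ₗ H.diaMulRight₂ Y Y' = H.diaMulRight₂ Y (Y' * Z) := by
            apply H.dia_ext
            simp [mul_assoc]
          simpa using LinearMap.congr_fun h3 _
        simpa [H.Δ_mul] using LinearMap.congr_fun h2 _
      exact LinearMap.congr_fun this w
    have h2 : H.diaMulRight₂ Y Z = H.diaMulRight₂ Y 1 ∘ₗ H.diaMulRight₂ 1 Z := by
      apply H.dia_ext
      simp
    simp [insertMul_tbar, h1, H.lam_mulRight, lam_plusMinus, h2]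
  have h' := LinearMap.congr_fun h (H.plusMinus X)
  simpa [lam_plusMinus] using h'

/-- A linear map on `L ⊗_{B̄} L` that sends `x ⊗ y` to `x * t (ε y)` sends `X₊ ⊗ X₋` to `X`. -/
theorem counit_plusMinus (G : H.TensorBar →ₗ[k] L)
    (hG : ∀ x y, G (H.tbar x y) = x * H.t (op (H.ε y))) (X : L) : G (H.plusMinus X) = X := by
  let K : H.Diamond H.regular →ₗ[k] L := H.diaLift H.regular
    (LinearMap.mk₂ k (fun x y => H.t (op (H.ε y)) * x)
      (by intros; simp [mul_add]) (by intros; simp)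
      (by intros; simp [add_mul]) (by intros; simp))
    (by
      intro b x y
      simp [LeftBialgebroid.ε_s_mul, mul_assoc])
  have hK : ∀ x y, K (H.dia H.regular x y) = H.t (op (H.ε y)) * x := by
    intro x y
    exact H.diaLift_dia H.regular _ _ x y
  have h : G = K ∘ₗ H.lam := by
    apply H.tbar_ext
    intro x y
    have h1 : K ∘ₗ H.diaMulRight₂ 1 y = K ∘ₗ H.diaMulRight₂ 1 (H.t (op (H.ε y))) := by
      apply H.dia_ext
      intro x' y'
      simp [hK, ← H.ε_mul_t]
    rw [hG, LinearMap.comp_apply, LeftBialgebroid.lam_tbar, ← LinearMap.comp_apply, h1,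
      LinearMap.comp_apply, ← H.Δ_mul_t, H.counit_right_apply K hK]
  rw [h, LinearMap.comp_apply, lam_plusMinus, hK]
  simp [H.ε_one]

theorem plusMinus_injective : Function.Injective H.plusMinus := by
  let G : H.TensorBar →ₗ[k] L := H.tbarLift ((LinearMap.mul k L).compl₂
    (H.t.toLinearMap ∘ₗ (opLinearEquiv k).toLinearMap ∘ₗ H.ε)) (by
      intro b x y
      simp [LeftBialgebroid.ε_t_mul, mul_assoc])
  refine Function.LeftInverse.injective (g := G) fun X => H.counit_plusMinus G ?_ X
  intro x y
  exact H.tbarLift_tbar _ _ x y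

/-- The algebra `L` with the coaction `X ↦ X₋ ⊗ X₊`, as a left comodule. -/
noncomputable def oppositeComodule : LeftComodule H.toLeftBialgebroid L where
  toBimod := H.opposite
  δ := H.minusPlus
  δ_bimod := by
    intro a b X
    rw [BeRing.opposite_r, BeRing.opposite_l, coe_minusPlus, plusMinus_mul_t, plusMinus_t_mul,
      coe_minusPlus]
    have h : H.flipBar ∘ₗ H.tbarMulMid' a ∘ₗ H.tbarMulRight (H.s b)
        = H.diaBimod H.opposite a b ∘ₗ H.flipBar := by
      apply H.tbar_ext
      intro x y
      simp [BeRing.diaBimod, BeRing.dia, mul_assoc]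
    exact LinearMap.congr_fun h _
  coassoc := by
    intro X z hz
    let G : H.TensorBar →ₗ[k] H.Diamond₃ H.opposite := H.tbarLift
      (LinearMap.mk₂ k (fun x y => H.diaTail H.opposite (H.Δ y) x)
        (by intros; simp) (by intros; simp) (by intros; simp) (by intros; simp))
      (by
        intro b x y
        have h : (H.diaTail H.opposite).flip (x * H.t (op b))
            = (H.diaTail H.opposite).flip x ∘ₗ H.diaMulLeft 1 b := by
          apply H.dia_ext
          intro y z
          simp only [LinearMap.comp_apply, LinearMap.flip_apply, BeRing.diaMulLeft_dia,
            H.diaTail_dia, map_one, one_mul, ← H.diaHead_dia, H.dia_balanced, BeRing.opposite_l]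
        simpa [LeftBialgebroid.Δ_t] using LinearMap.congr_fun h (H.Δ y))
    have hG : ∀ x y, G (H.tbar x y) = (H.diaTail H.opposite).flip x (H.Δ y) := by
      intro x y
      exact H.tbarLift_tbar _ _ x y
    have head_add : ∀ y y', H.diaHead H.opposite (y + y')
        = H.diaHead H.opposite y + H.diaHead H.opposite y' := by
      intro y y'
      apply H.dia_ext
      simp [H.diaHead_dia]
    have head_smul : ∀ (c : k) y, H.diaHead H.opposite (c • y) = c • H.diaHead H.opposite y := by
      intro c y
      apply H.dia_ext
      simp [H.diaHead_dia]
    let K : H.TensorBar →ₗ[k] H.Diamond₃ H.opposite := H.tbarLift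
      (LinearMap.mk₂ k (fun x y => H.diaHead H.opposite y (H.flipBar (H.plusMinus x)))
        (by intros; simp) (by intros; simp)
        (by intros; simp [head_add]) (by intros; simp [head_smul]))
      (by
        intro b x y
        have h : H.diaHead H.opposite (H.t (op b) * y) ∘ₗ H.flipBar
            = H.diaHead H.opposite y ∘ₗ H.flipBar ∘ₗ H.tbarMulMid' b := by
          apply H.tbar_ext
          intro x z
          simp only [LinearMap.comp_apply, flipBar_tbar, BeRing.tbarMulMid'_tbar, H.diaHead_dia,
            ← H.diaTail_dia, H.dia_balanced, BeRing.regular_l]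
        simpa [plusMinus_mul_t] using (LinearMap.congr_fun h (H.plusMinus x)).symm)
    have hK : ∀ x y, K (H.tbar x y) = (H.diaHead H.opposite y ∘ₗ H.flipBar) (H.plusMinus x) := by
      intro x y
      exact H.tbarLift_tbar _ _ x y
    have main := H.comul_minus_apply G K _ _ hG hK (by
      intro x y z
      rw [LinearMap.flip_apply, H.diaTail_dia, LinearMap.comp_apply, flipBar_tbar,
        H.diaHead_dia]) X
    obtain ⟨n, a, c, hac⟩ := exists_sum_tmul z
    -- both sides of the claim are the values at `X₊ ⊗ X₋` of maps on `L ⊗_{B̄} L`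
    have hP : H.plusMinus X = ∑ i, H.tbar (c i) (a i) := by
      let F : H.Diamond H.opposite →ₗ[k] H.TensorBar := H.diaLift H.opposite H.tbar.flip (by
        intro b x y
        exact (H.tbar_balanced b y x).symm)
      have hF : F ∘ₗ H.flipBar = LinearMap.id := by
        apply H.tbar_ext
        intro x y
        rw [LinearMap.comp_apply, flipBar_tbar]
        exact H.diaLift_dia H.opposite _ _ y x
      have h := congrArg F hz
      rw [coe_minusPlus, ← LinearMap.comp_apply, hF, LinearMap.id_apply] at h
      rw [← h, hac]
      refine (map_sum (F ∘ₗ (balRel _ _).mkQ) _ _).trans (Finset.sum_congr rfl fun i _ => ?_)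
      exact (H.diaLift_dia H.opposite _ _ (a i) (c i) : F (H.dia H.opposite (a i) (c i)) = _)
    rw [hP, map_sum, map_sum] at main
    rw [hac, map_sum, map_sum]
    refine Eq.trans (Finset.sum_congr rfl fun i _ => ?_)
      (main.trans (Finset.sum_congr rfl fun i _ => ?_))
    · rw [hG]
      rfl
    · rw [hK]
      rfl
  counit := by
    intro X z hz
    let G : H.Diamond H.opposite →ₗ[k] L := H.diaLift H.opposite (H.opposite.l.toLinearMap ∘ₗ H.ε)
      (by
        intro b x y
        simp [LeftBialgebroid.ε_t_mul, mul_assoc])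
    have hG : ∀ x y, G (H.dia H.opposite x y) = y * H.t (op (H.ε x)) := by
      intro x y
      exact H.diaLift_dia H.opposite _ _ x y
    have h : TensorProduct.lift (H.opposite.l.toLinearMap ∘ₗ H.ε) = G ∘ₗ (balRel _ _).mkQ := by
      apply TensorProduct.ext'
      intro x y
      exact (hG x y).symm
    rw [h, LinearMap.comp_apply]
    refine (congrArg G hz).trans (H.counit_plusMinus (G ∘ₗ H.flipBar) ?_ X)
    intro x y
    simp [hG]

end LeftHopfAlgebroid
end Hopf

/-! ### Contracting a coaction with `Γ` -/

section Cocycle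

variable {k : Type w} {B : Type u} {L : Type v} [Field k] [Ring B] [Algebra k B]
  [Ring L] [Algebra k L]

namespace BarHom

section Contract

variable {S : BeRing k B L} (Γ : BarHom S) {M : Type*} [AddCommGroup M] [Module k M]
  (CM : Bimod k B M)

/-- The map `X ⊗ m ↦ Γ(X, y) . m` on `L ⋄_B M`. -/
def contractAux (y : L) : S.Diamond CM →ₗ[k] M :=
  S.diaLift CM (CM.l.toLinearMap ∘ₗ Γ.app.flip y) (by
    intro b X m
    simp [Γ.app_t_mul])

theorem contractAux_dia (y X : L) (m : M) :
    Γ.contractAux CM y (S.dia CM X m) = CM.l (Γ.app X y) m :=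
  S.diaLift_dia CM _ _ X m

/-- The map `X ⊗ m ↦ Γ(X, y) . m` on `L ⋄_B M`, as a linear function of `y`. -/
def contract : L →ₗ[k] S.Diamond CM →ₗ[k] M where
  toFun := Γ.contractAux CM
  map_add' := by
    intro y y'
    apply S.dia_ext
    simp [contractAux_dia]
  map_smul' := by
    intro c y
    apply S.dia_ext
    simp [contractAux_dia]

theorem contract_dia (y X : L) (m : M) :
    Γ.contract CM y (S.dia CM X m) = CM.l (Γ.app X y) m :=
  Γ.contractAux_dia CM y X m

theorem contract_regular (y X Y : L) :
    Γ.contract S.regular y (S.dia S.regular X Y) = S.s (Γ.app X y) * Y :=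
  Γ.contract_dia S.regular y X Y

end Contract

section Bialgebroid

variable {H : LeftBialgebroid k B L} (Γ : BarHom H.toBeRing)

/-- The operator `X ↦ Γ(X₁, y) X₂` on `L`, as a linear function of `y`. -/
def shift : L →ₗ[k] L →ₗ[k] L :=
  (Γ.contract H.regular).compl₂ ((H.Takeuchi H.regular).subtype ∘ₗ H.Δ)

theorem shift_apply (y X : L) : Γ.shift y X = Γ.contract H.regular y (H.Δ X) := rfl

theorem contract_comp_mulRight (y Z : L) (w : H.Diamond H.regular) :
    Γ.contract H.regular y (H.diaMulRight₂ 1 Z w) = Γ.contract H.regular y w * Z := by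
  have : Γ.contract H.regular y ∘ₗ H.diaMulRight₂ 1 Z
      = LinearMap.mulRight k Z ∘ₗ Γ.contract H.regular y := by
    apply H.dia_ext
    simp [contract_regular, mul_assoc]
  exact LinearMap.congr_fun this w

theorem shift_t_mul (y : L) (b : B) (X : L) :
    Γ.shift y (H.t (op b) * X) = H.t (op b) * Γ.shift y X := by
  have : Γ.contract H.regular y ∘ₗ H.diaMulLeft 1 b
      = LinearMap.mulLeft k (H.t (op b)) ∘ₗ Γ.contract H.regular y := by
    apply H.dia_ext
    simp [contract_regular, ← mul_assoc, H.comm]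
  rw [shift_apply, LeftBialgebroid.Δ_t]
  exact LinearMap.congr_fun this _

theorem shift_mul_t (y : L) (b : B) (X : L) :
    Γ.shift y (X * H.t (op b)) = Γ.shift y X * H.t (op b) := by
  rw [shift_apply, LeftBialgebroid.Δ_mul_t, contract_comp_mulRight, shift_apply]

theorem shift_t (y : L) (b : B) (X : L) :
    Γ.shift (H.t (op b) * y) X = Γ.shift y X * H.s b := by
  have : Γ.contract H.regular (H.t (op b) * y)
      = Γ.contract H.regular y ∘ₗ H.diaMulRight₂ (H.t (op b)) 1 := by
    apply H.dia_ext
    simp [contract_regular, app_balanced]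
  rw [shift_apply, this, LinearMap.comp_apply, H.Δ_takeuchi, contract_comp_mulRight, shift_apply]

theorem shift_s (y : L) (b : B) : Γ.shift y (H.s b) = H.s (Γ.app (H.s b) y) := by
  rw [shift_apply, LeftBialgebroid.Δ_s', contract_regular, mul_one]

/-- The operator `X ⊗ Y ↦ Γ(X₁, y) X₂ ⊗ Y` on `L ⋄_B L`. -/
def shiftDia (y : L) : H.Diamond H.regular →ₗ[k] H.Diamond H.regular :=
  BalTensor.map (Γ.shift y) LinearMap.id (fun b X => Γ.shift_t_mul y b X) (fun _ _ => rfl)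

@[simp] theorem shiftDia_dia (y X Y : L) : Γ.shiftDia y (H.dia H.regular X Y)
    = H.dia H.regular (Γ.shift y X) Y := rfl

theorem Δ_shift (y X : L) : (H.Δ (Γ.shift y X) : H.Diamond H.regular)
    = Γ.shiftDia y (H.Δ X) := by
  symm
  refine H.coassoc_apply (Γ.shiftDia y)
    ((H.Takeuchi H.regular).subtype ∘ₗ H.Δ ∘ₗ Γ.contract H.regular y)
    (fun z => (H.dia H.regular).flip z ∘ₗ Γ.contract H.regular y)
    (fun x => H.diaMulLeft (Γ.app x y) 1) ?_ ?_ ?_ X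
  · intro x z
    rfl
  · intro x z
    simp [contract_regular, LeftBialgebroid.Δ_s]
  · intro x z z'
    simp [contract_regular]

/-- The map `Y ⊗ Z ↦ Γ(X₁, Y) X₂ Z` on `L ⋄_B L`. -/
def starMapAux (X : L) : H.Diamond H.regular →ₗ[k] L :=
  H.diaLift H.regular ((LinearMap.mul k L) ∘ₗ Γ.shift.flip X) (by
    intro b Y Z
    simp [shift_t, mul_assoc])

theorem starMapAux_dia (X Y Z : L) :
    Γ.starMapAux X (H.dia H.regular Y Z) = Γ.shift Y X * Z :=
  H.diaLift_dia H.regular _ _ Y Z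

/-- The map `Y ⊗ Z ↦ Γ(X₁, Y) X₂ Z` on `L ⋄_B L`, as a linear function of `X`. -/
def starMap : L →ₗ[k] H.Diamond H.regular →ₗ[k] L where
  toFun := Γ.starMapAux
  map_add' := by
    intro X X'
    apply H.dia_ext
    simp [starMapAux_dia, add_mul]
  map_smul' := by
    intro c X
    apply H.dia_ext
    simp [starMapAux_dia]

theorem starMap_dia (X Y Z : L) : Γ.starMap X (H.dia H.regular Y Z) = Γ.shift Y X * Z :=
  Γ.starMapAux_dia X Y Z

/-- The product `X ∗ Y = Γ(X₁, Y₁) X₂ Y₂` on `L`, as a bilinear map. -/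
def star : L →ₗ[k] L →ₗ[k] L :=
  Γ.starMap.compl₂ ((H.Takeuchi H.regular).subtype ∘ₗ H.Δ)

theorem star_apply (X Y : L) : Γ.star X Y = Γ.starMap X (H.Δ Y) := rfl

theorem leftTwist_eq_star (X Y : L) : Γ.leftTwist X Y = Γ.star X Y := by
  have : H.mulTensor ∘ₗ Γ.pair H.regular H.regular (H.Δ X) = Γ.starMap X := by
    apply H.dia_ext
    intro Y Z
    have h : H.mulTensor ∘ₗ Γ.pairAux H.regular H.regular Y Z
        = LinearMap.mulRight k Z ∘ₗ Γ.contract H.regular Y := by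
      apply H.dia_ext
      intro X X'
      rw [LinearMap.comp_apply, pairAux_dia, LinearMap.comp_apply, contract_regular]
      exact H.regular.tensorLift_tmul H.regular _ _ _ _
    rw [LinearMap.comp_apply, pair_dia, starMap_dia]
    exact LinearMap.congr_fun h (H.Δ X)
  exact LinearMap.congr_fun this (H.Δ Y)

theorem star_mul_t (X Y : L) (b : B) :
    Γ.star X (Y * H.t (op b)) = Γ.star X Y * H.t (op b) := by
  have : Γ.starMap X ∘ₗ H.diaMulRight₂ 1 (H.t (op b))
      = LinearMap.mulRight k (H.t (op b)) ∘ₗ Γ.starMap X := by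
    apply H.dia_ext
    simp [starMap_dia, mul_assoc]
  rw [star_apply, LeftBialgebroid.Δ_mul_t]
  exact LinearMap.congr_fun this _

theorem t_mul_star (X Y : L) (b : B) :
    Γ.star (H.t (op b) * X) Y = H.t (op b) * Γ.star X Y := by
  have : Γ.starMap (H.t (op b) * X) = LinearMap.mulLeft k (H.t (op b)) ∘ₗ Γ.starMap X := by
    apply H.dia_ext
    simp [starMap_dia, mul_assoc, shift_t_mul]
  rw [star_apply, this]
  rfl

theorem star_balanced (X Y : L) (b : B) :
    Γ.star (X * H.t (op b)) Y = Γ.star X (H.t (op b) * Y) := by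
  have : Γ.starMap (X * H.t (op b)) = Γ.starMap X ∘ₗ H.diaMulLeft 1 b := by
    apply H.dia_ext
    simp [starMap_dia, mul_assoc, shift_mul_t]
  rw [star_apply, this, star_apply, LeftBialgebroid.Δ_t]
  rfl

/-- The identity `Δ (X ∗ Y) = X₁ ∗ Y₁ ⊗ X₂ Y₂`. -/
theorem Δ_star {X Y : L} {m n : ℕ} {a c : Fin m → L} {d e : Fin n → L}
    (hX : (H.Δ X : H.Diamond H.regular) = ∑ i, H.dia H.regular (a i) (c i))
    (hY : (H.Δ Y : H.Diamond H.regular) = ∑ j, H.dia H.regular (d j) (e j)) :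
    (H.Δ (Γ.star X Y) : H.Diamond H.regular)
      = ∑ j, ∑ i, H.dia H.regular (Γ.star (a i) (d j)) (c i * e j) := by
  obtain ⟨G, hG⟩ : ∃ G : H.Diamond H.regular →ₗ[k] H.Diamond H.regular, ∀ y z,
      G (H.dia H.regular y z) = ∑ i, H.dia H.regular (Γ.star (a i) y) (c i * z) := by
    refine ⟨H.diaLift H.regular (∑ i, (H.dia H.regular).compl₁₂ (Γ.star (a i))
      (LinearMap.mulLeft k (c i))) ?_, ?_⟩
    · intro b y z
      -- the map `x ⊗ x' ↦ x ∗ y ⊗ x' * z`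
      let F : H.Diamond H.regular →ₗ[k] H.Diamond H.regular :=
        BalTensor.map (Γ.star.flip y) (LinearMap.mulRight k z)
          (fun b x => Γ.t_mul_star x y b) (fun b x => mul_assoc _ _ _)
      have hF : ∀ x x', F (H.dia H.regular x x')
          = H.dia H.regular (Γ.star x y) (x' * z) := fun _ _ => rfl
      have h := congrArg F (H.Δ_takeuchi b X)
      simpa [hX, hF, star_balanced, mul_assoc] using h
    · intro y z
      refine (H.diaLift_dia H.regular _ _ y z).trans ?_
      simp
  have h := H.coassoc_apply G ((H.Takeuchi H.regular).subtype ∘ₗ H.Δ ∘ₗ Γ.starMap X)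
    (fun z => ∑ i, (H.dia H.regular).flip (c i * z) ∘ₗ Γ.starMap (a i))
    (fun y => H.takeuchiMul (H.Δ (Γ.shift y X))) ?_ ?_ ?_ Y
  · refine h.symm.trans ?_
    simp [hY, hG]
  · intro y z
    simp [hG, star_apply]
  · intro y z
    simp [starMap_dia, H.Δ_mul]
  · intro y y' z
    simp [starMap_dia, Δ_shift, hX]

/-- The map `X ⊗ Y ↦ Z ∗ X ⊗ Y` on `L ⊗_{B̄} L`. -/
def starLeft (Z : L) : H.TensorBar →ₗ[k] H.TensorBar :=
  BalTensor.map (Γ.star Z) LinearMap.id (fun b X => Γ.star_mul_t Z X b) (fun _ _ => rfl)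

@[simp] theorem starLeft_tbar (Z X Y : L) :
    Γ.starLeft Z (H.tbar X Y) = H.tbar (Γ.star Z X) Y := rfl

/-- The map `X ⊗ Y ↦ X ⊗ Y ∗ Z` on `L ⊗_{B̄} L`. -/
def starRight (Z : L) : H.TensorBar →ₗ[k] H.TensorBar :=
  BalTensor.map LinearMap.id (Γ.star.flip Z) (fun _ _ => rfl) (fun b Y => Γ.t_mul_star Y Z b)

@[simp] theorem starRight_tbar (Z X Y : L) :
    Γ.starRight Z (H.tbar X Y) = H.tbar X (Γ.star Y Z) := rfl

theorem starLeft_add (Z W : L) : Γ.starLeft (Z + W) = Γ.starLeft Z + Γ.starLeft W := by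
  apply H.tbar_ext
  simp

theorem starLeft_smul (c : k) (W : L) : Γ.starLeft (c • W) = c • Γ.starLeft W := by
  apply H.tbar_ext
  simp

theorem starRight_add (Z W : L) : Γ.starRight (Z + W) = Γ.starRight Z + Γ.starRight W := by
  apply H.tbar_ext
  simp

theorem starRight_smul (c : k) (W : L) : Γ.starRight (c • W) = c • Γ.starRight W := by
  apply H.tbar_ext
  simp

theorem starLeft_mulRight (Z W : L) (z : H.TensorBar) :
    Γ.starLeft Z (H.tbarMulRight W z) = H.tbarMulRight W (Γ.starLeft Z z) := by
  have : Γ.starLeft Z ∘ₗ H.tbarMulRight W = H.tbarMulRight W ∘ₗ Γ.starLeft Z := by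
    apply H.tbar_ext
    simp
  exact LinearMap.congr_fun this z

theorem starLeft_starRight (Z W : L) (z : H.TensorBar) :
    Γ.starLeft Z (Γ.starRight W z) = Γ.starRight W (Γ.starLeft Z z) := by
  have : Γ.starLeft Z ∘ₗ Γ.starRight W = Γ.starRight W ∘ₗ Γ.starLeft Z := by
    apply H.tbar_ext
    simp
  exact LinearMap.congr_fun this z

theorem starLeft_mul_t (Z : L) (b : B) (z : H.TensorBar) :
    Γ.starLeft (Z * H.t (op b)) z = Γ.starLeft Z (H.tbarMulLeft (H.t (op b)) z) := by
  have : Γ.starLeft (Z * H.t (op b)) = Γ.starLeft Z ∘ₗ H.tbarMulLeft (H.t (op b)) := by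
    apply H.tbar_ext
    simp [star_balanced]
  exact LinearMap.congr_fun this z

theorem starRight_t_mul (Z : L) (b : B) (z : H.TensorBar) :
    Γ.starRight (H.t (op b) * Z) z = Γ.starRight Z (H.tbarMulRight (H.t (op b)) z) := by
  have : Γ.starRight (H.t (op b) * Z) = Γ.starRight Z ∘ₗ H.tbarMulRight (H.t (op b)) := by
    apply H.tbar_ext
    simp [star_balanced]
  exact LinearMap.congr_fun this z

theorem starRight_mulLeft_t (Z : L) (b : B) (z : H.TensorBar) :
    Γ.starRight Z (H.tbarMulLeft (H.t (op b)) z)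
      = H.tbarMulLeft (H.t (op b)) (Γ.starRight Z z) := by
  have : Γ.starRight Z ∘ₗ H.tbarMulLeft (H.t (op b))
      = H.tbarMulLeft (H.t (op b)) ∘ₗ Γ.starRight Z := by
    apply H.tbar_ext
    simp
  exact LinearMap.congr_fun this z

end Bialgebroid

section HopfAlgebroid

variable {H : LeftHopfAlgebroid k B L} (Γ : BarHom H.toBeRing)

/-- The map `X ⊗ Y ↦ X * t (Γ(Y, c))` on `L ⊗_{B̄} L`, as a linear function of `c`. -/
def contractBar : L →ₗ[k] H.TensorBar →ₗ[k] L :=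
  (Γ.contract H.opposite).compl₂ H.flipBar

theorem contractBar_tbar (c X Y : L) :
    Γ.contractBar c (H.tbar X Y) = X * H.t (op (Γ.app Y c)) := by
  rw [contractBar, LinearMap.compl₂_apply, LeftHopfAlgebroid.flipBar_tbar, contract_dia]
  rfl

/-- The operator `X ↦ X₊ t (Γ(X₋, c))` on `L`, as a linear function of `c`. -/
noncomputable def coshift : L →ₗ[k] L →ₗ[k] L := Γ.contractBar.compl₂ H.plusMinus

theorem coshift_apply (c X : L) : Γ.coshift c X = Γ.contractBar c (H.plusMinus X) := rfl

/-- The operator `X ⊗ Y ↦ Γ(X₁, y) X₂ ⊗ Y` on `L ⊗_{B̄} L`. -/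
def shiftBar (y : L) : H.TensorBar →ₗ[k] H.TensorBar :=
  BalTensor.map (Γ.shift y) LinearMap.id (fun b X => Γ.shift_mul_t y b X) (fun _ _ => rfl)

@[simp] theorem shiftBar_tbar (y X Y : L) :
    Γ.shiftBar y (H.tbar X Y) = H.tbar (Γ.shift y X) Y := rfl

/-- The operator `X ⊗ Y ↦ X ⊗ Γ(Y₁, y) Y₂` on `L ⊗_{B̄} L`. -/
def shiftBar' (y : L) : H.TensorBar →ₗ[k] H.TensorBar :=
  BalTensor.map LinearMap.id (Γ.shift y) (fun _ _ => rfl) (fun b X => Γ.shift_t_mul y b X)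

@[simp] theorem shiftBar'_tbar (y X Y : L) :
    Γ.shiftBar' y (H.tbar X Y) = H.tbar X (Γ.shift y Y) := rfl

theorem plusMinus_shift (y X : L) :
    H.plusMinus (Γ.shift y X) = Γ.shiftBar y (H.plusMinus X) := by
  symm
  refine H.comul_plus_apply (Γ.shiftBar y) (H.plusMinus ∘ₗ Γ.contract H.regular y)
    (fun z => H.tbar.flip z ∘ₗ Γ.contract H.regular y)
    (fun x => H.tbarMulLeft (H.s (Γ.app x y))) ?_ ?_ ?_ X
  · intro x z
    rfl
  · intro x z
    simp [contract_regular, LeftHopfAlgebroid.plusMinus_s_mul]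
  · intro x z z'
    simp [contract_regular]

theorem plusMinus_coshift (c X : L) :
    H.plusMinus (Γ.coshift c X) = Γ.shiftBar' c (H.plusMinus X) := by
  symm
  refine H.comul_minus_apply (Γ.shiftBar' c) (H.plusMinus ∘ₗ Γ.contractBar c)
    (fun x => H.tbar x ∘ₗ Γ.contract H.regular c)
    (fun y => H.tbarMulMid' (Γ.app y c)) ?_ ?_ ?_ X
  · intro x z
    rfl
  · intro x z
    simp [contractBar_tbar, LeftHopfAlgebroid.plusMinus_mul_t]
  · intro x z z'
    simp [contract_regular]

theorem coshift_s_mul (c : L) (b : B) (X : L) :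
    Γ.coshift c (H.s b * X) = H.s b * Γ.coshift c X := by
  have : Γ.contractBar c ∘ₗ H.tbarMulLeft (H.s b)
      = LinearMap.mulLeft k (H.s b) ∘ₗ Γ.contractBar c := by
    apply H.tbar_ext
    simp [contractBar_tbar, mul_assoc]
  rw [coshift_apply, LeftHopfAlgebroid.plusMinus_s_mul]
  exact LinearMap.congr_fun this _

theorem coshift_t (c : L) (b : B) (X : L) :
    Γ.coshift (H.t (op b) * c) X = H.t (op b) * Γ.coshift c X := by
  have h1 : Γ.contractBar (H.t (op b) * c) = Γ.contractBar c ∘ₗ H.tbarMulRight (H.t (op b)) := by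
    apply H.tbar_ext
    simp [contractBar_tbar, app_balanced]
  have h2 : Γ.contractBar c ∘ₗ H.tbarMulLeft (H.t (op b))
      = LinearMap.mulLeft k (H.t (op b)) ∘ₗ Γ.contractBar c := by
    apply H.tbar_ext
    simp [contractBar_tbar, mul_assoc]
  rw [coshift_apply, h1, LinearMap.comp_apply, LeftHopfAlgebroid.plusMinus_comm_t]
  exact LinearMap.congr_fun h2 _

/-- The operator `X ⊗ Y ↦ X ⊗ Y₊ t (Γ(Y₋, c))` on `L ⋄_B L`. -/
noncomputable def coshiftDia (c : L) : H.Diamond H.regular →ₗ[k] H.Diamond H.regular :=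
  BalTensor.map LinearMap.id (Γ.coshift c) (fun _ _ => rfl) (fun b X => Γ.coshift_s_mul c b X)

@[simp] theorem coshiftDia_dia (c X Y : L) : Γ.coshiftDia c (H.dia H.regular X Y)
    = H.dia H.regular X (Γ.coshift c Y) := rfl

theorem Δ_coshift (c X : L) : (H.Δ (Γ.coshift c X) : H.Diamond H.regular)
    = Γ.coshiftDia c (H.Δ X) := by
  refine H.comul_plus_apply ((H.Takeuchi H.regular).subtype ∘ₗ H.Δ ∘ₗ Γ.contractBar c)
    (Γ.coshiftDia c) (fun z => H.diaMulRight₂ 1 (H.t (op (Γ.app z c))))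
    (fun x => H.dia H.regular x ∘ₗ Γ.contractBar c) ?_ ?_ ?_ X
  · intro x z
    simp [contractBar_tbar, LeftBialgebroid.Δ_mul_t]
  · intro x z
    rfl
  · intro x z z'
    simp [contractBar_tbar]

/-- The map `X ⊗ Z ↦ X ∗ Y₊ ⊗ Y₋ Z`. -/
noncomputable def insertStarMul (Y : L) : H.TensorBar →ₗ[k] H.TensorBar :=
  H.tbarLift (LinearMap.mk₂ k (fun X Z => Γ.starLeft X (H.tbarMulRight Z (H.plusMinus Y)))
      (by intros; simp [starLeft_add]) (by intros; simp [starLeft_smul])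
      (by intros; simp [BeRing.tbarMulRight_add]) (by intros; simp [BeRing.tbarMulRight_smul]))
    (by
      intro b X Z
      simp only [LinearMap.mk₂_apply, ← BeRing.tbarMulRight_mulRight,
        LeftHopfAlgebroid.plusMinus_comm_t, ← BeRing.tbarMulLeft_mulRight, starLeft_mul_t])

theorem insertStarMul_tbar (X Y Z : L) : Γ.insertStarMul Y (H.tbar X Z)
    = Γ.starLeft X (H.tbarMulRight Z (H.plusMinus Y)) :=
  H.tbarLift_tbar _ _ X Z

/-- The identity `(X ∗ Y)₊ ⊗ (X ∗ Y)₋ = X₊ ∗ Y₊ ⊗ Y₋ X₋`. -/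
theorem plusMinus_star (X Y : L) :
    H.plusMinus (Γ.star X Y) = Γ.insertStarMul Y (H.plusMinus X) := by
  obtain ⟨n, a, c, hac⟩ := H.exists_tbar (H.plusMinus X)
  have h := H.comul_plus_apply (∑ i, H.tbarMulRight (c i) ∘ₗ Γ.starLeft (a i))
    (H.plusMinus ∘ₗ Γ.starMap X)
    (fun z => ∑ i, H.tbar.flip (z * c i) ∘ₗ Γ.starMap (a i))
    (fun y => ∑ i, H.tbarMulLeft (Γ.shift y (a i)) ∘ₗ H.tbarMulRight (c i)) ?_ ?_ ?_ Y
  · refine h.symm.trans ?_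
    simp [hac, insertStarMul_tbar, starLeft_mulRight]
  · intro x z
    simp [star_apply]
  · intro x y
    simp [starMap_dia, LeftHopfAlgebroid.plusMinus_mul, plusMinus_shift, hac,
      LeftHopfAlgebroid.insertMul_tbar]
  · intro x y z
    simp [starMap_dia]

/-- The map `X ⊗ Z ↦ X ∗ Y₊ ⊗ Y₋ ∗ Z`. -/
noncomputable def insertStar (Y : L) : H.TensorBar →ₗ[k] H.TensorBar :=
  H.tbarLift (LinearMap.mk₂ k (fun X Z => Γ.starLeft X (Γ.starRight Z (H.plusMinus Y)))
      (by intros; simp [starLeft_add]) (by intros; simp [starLeft_smul])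
      (by intros; simp [starRight_add]) (by intros; simp [starRight_smul]))
    (by
      intro b X Z
      simp only [LinearMap.mk₂_apply, starRight_t_mul, starLeft_mul_t,
        LeftHopfAlgebroid.plusMinus_comm_t, starRight_mulLeft_t])

theorem insertStar_tbar (X Y Z : L) : Γ.insertStar Y (H.tbar X Z)
    = Γ.starLeft X (Γ.starRight Z (H.plusMinus Y)) :=
  H.tbarLift_tbar _ _ X Z

/-- The map `X ⊗ Z ↦ X ∗ (Y₊ t (Γ(Y₋, Z)))`. -/
noncomputable def starCoshift (Y : L) : H.TensorBar →ₗ[k] L :=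
  H.tbarLift (Γ.star.compl₂ (Γ.coshift.flip Y)) (by
    intro b X Z
    simp [star_balanced, coshift_t])

theorem starCoshift_tbar (X Y Z : L) : Γ.starCoshift Y (H.tbar X Z)
    = Γ.star X (Γ.coshift Z Y) :=
  H.tbarLift_tbar _ _ X Z

/-- The identity `(X · Y)₊ ⊗ (X · Y)₋ = X₊ ∗ Y₊ ⊗ Y₋ ∗ X₋` for the product
`X · Y = X₊ ∗ (Y₊ t (Γ(Y₋, X₋)))`. -/
theorem plusMinus_starCoshift (X Y : L) :
    H.plusMinus (Γ.starCoshift Y (H.plusMinus X)) = Γ.insertStar Y (H.plusMinus X) := by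
  obtain ⟨n, d, e, hde⟩ := H.exists_tbar (H.plusMinus Y)
  symm
  refine H.comul_minus_apply (Γ.insertStar Y) (H.plusMinus ∘ₗ Γ.starCoshift Y)
    (fun x => ∑ j, H.tbar (Γ.star x (d j)) ∘ₗ Γ.starMap (e j))
    (fun c => Γ.insertStarMul (Γ.coshift c Y)) ?_ ?_ ?_ X
  · intro x y
    simp [insertStar_tbar, hde, star_apply]
  · intro x y
    simp [starCoshift_tbar, plusMinus_star]
  · intro x y z
    simp [starMap_dia, insertStarMul_tbar, plusMinus_coshift, hde]

/-- The map `Y ⊗ Z ↦ X₊ t (Γ(X₋, Y)) ⊗ Z` on `L ⋄_B L`. -/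
noncomputable def coshiftMap (X : L) : H.Diamond H.regular →ₗ[k] H.Diamond H.regular :=
  BalTensor.map (Γ.coshift.flip X) LinearMap.id (fun b Y => Γ.coshift_t Y b X) (fun _ _ => rfl)

@[simp] theorem coshiftMap_dia (X Y Z : L) : Γ.coshiftMap X (H.dia H.regular Y Z)
    = H.dia H.regular (Γ.coshift Y X) Z := rfl

/-- `λ (X₊ ⊗ X₋ ∗ Y) = X₊ t (Γ(X₋, Y₁)) ⊗ Y₂`. -/
theorem lam_starRight_plusMinus (X Y : L) :
    H.lam (Γ.starRight Y (H.plusMinus X)) = Γ.coshiftMap X (H.Δ Y) := by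
  obtain ⟨n, d, e, hde⟩ := H.exists_dia H.regular (H.Δ Y : H.Diamond H.regular)
  have h : Γ.starRight Y = ∑ j, H.tbarMulRight (e j) ∘ₗ Γ.shiftBar' (d j) := by
    apply H.tbar_ext
    intro x y
    simp [star_apply, hde, starMap_dia]
  simp [h, hde, ← plusMinus_coshift, H.lam_mulRight, LeftHopfAlgebroid.lam_plusMinus]

/-- The product `X ⊗ Y ↦ X ∗ Y`. -/
def mulStar : H.TensorBar →ₗ[k] L := H.tbarLift Γ.star fun b X Y => Γ.star_balanced X Y b

@[simp] theorem mulStar_tbar (X Y : L) : Γ.mulStar (H.tbar X Y) = Γ.star X Y :=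
  H.tbarLift_tbar _ _ X Y

/-- The identity `X₊ ∗ X₋ = s (Γ(X₊, X₋))`. -/
theorem mulStar_plusMinus (X : L) :
    Γ.mulStar (H.plusMinus X) = H.s (Γ.toLin (H.plusMinus X)) := by
  obtain ⟨g, hg⟩ : ∃ g : L → H.TensorBar →ₗ[k] L, ∀ y x z,
      g y (H.tbar x z) = Γ.shift y x * z :=
    ⟨fun y => H.tbarLift (LinearMap.mul k L ∘ₗ Γ.shift y) (by
      intro b x z
      simp [shift_mul_t, mul_assoc]), fun y x z => H.tbarLift_tbar _ _ x z⟩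
  refine H.comul_minus_apply Γ.mulStar (H.s.toLinearMap ∘ₗ Γ.toLin) Γ.starMap g ?_ ?_ ?_ X
  · intro x y
    rw [mulStar_tbar, star_apply]
  · intro x y
    have h : g y = Γ.contract H.regular y ∘ₗ H.lam := by
      apply H.tbar_ext
      intro x z
      rw [hg, LinearMap.comp_apply, LeftBialgebroid.lam_tbar, contract_comp_mulRight, shift_apply]
    rw [h, LinearMap.comp_apply (Γ.contract H.regular y), LeftHopfAlgebroid.lam_plusMinus,
      contract_regular, mul_one]
    rfl
  · intro x y z
    rw [starMap_dia, hg]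

end HopfAlgebroid

end BarHom
end Cocycle

/-! ### The associative product `X ∗ Y = Γ(X₁, Y₁) X₂ Y₂` -/

section Cocycle

variable {k : Type w} {B : Type u} {L : Type v} [Field k] [Ring B] [Algebra k B]
  [Ring L] [Algebra k L]

namespace LeftTwoCocycle

section Bialgebroid

variable {H : LeftBialgebroid k B L} (Γ : LeftTwoCocycle H)

@[simp] theorem shift_one (X : L) : Γ.shift 1 X = X := by
  refine H.counit_left_apply (Γ.contract H.regular 1) ?_ X
  intro x y
  rw [BarHom.contract_regular, Γ.unit_right]

theorem shift_of_one (y : L) : Γ.shift y 1 = H.s (H.ε y) := by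
  have := Γ.shift_s y 1
  rwa [map_one, Γ.unit_left] at this

@[simp] theorem star_one (X : L) : Γ.star X 1 = X := by
  rw [BarHom.star_apply, H.Δ_one, BarHom.starMap_dia, shift_one, mul_one]

@[simp] theorem one_star (X : L) : Γ.star 1 X = X := by
  refine H.counit_left_apply (Γ.starMap 1) ?_ X
  intro x y
  rw [BarHom.starMap_dia, shift_of_one]

@[simp] theorem star_t (X : L) (b : B) : Γ.star X (H.t (op b)) = X * H.t (op b) := by
  have := Γ.star_mul_t X 1 b
  rwa [one_mul, star_one] at this

@[simp] theorem star_t_mul (X Y : L) (b : B) :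
    Γ.star X (H.t (op b) * Y) = Γ.star (X * H.t (op b)) Y :=
  (Γ.star_balanced X Y b).symm

theorem star_s_s (a b : B) : Γ.star (H.s a) (H.s b) = H.s (Γ.app (H.s a) (H.s b)) := by
  rw [BarHom.star_apply, LeftBialgebroid.Δ_s', BarHom.starMap_dia, BarHom.shift_s, mul_one]

theorem app_star (X Y Z : L) : Γ.app X (Γ.star Y Z) = Γ.app (Γ.star X Y) Z := by
  rw [← BarHom.leftTwist_eq_star, ← BarHom.leftTwist_eq_star, Γ.cocycle]

/-- `Γ((X ∗ Y)₁, z) (X ∗ Y)₂ = Γ(X₁, Y₁ ∗ z) X₂ Y₂`. -/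
theorem shift_star {X Y : L} (z : L) {n : ℕ} {d e : Fin n → L}
    (hY : (H.Δ Y : H.Diamond H.regular) = ∑ j, H.dia H.regular (d j) (e j)) :
    Γ.shift z (Γ.star X Y) = ∑ j, Γ.shift (Γ.star (d j) z) X * e j := by
  obtain ⟨m, a, c, hX⟩ := H.exists_dia H.regular (H.Δ X : H.Diamond H.regular)
  simp only [BarHom.shift_apply, Γ.Δ_star hX hY, hX, map_sum, BarHom.contract_regular, app_star,
    Finset.sum_mul, mul_assoc]

theorem star_assoc (X Y Z : L) : Γ.star (Γ.star X Y) Z = Γ.star X (Γ.star Y Z) := by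
  obtain ⟨m, d, e, hY⟩ := H.exists_dia H.regular (H.Δ Y : H.Diamond H.regular)
  obtain ⟨n, p, q, hZ⟩ := H.exists_dia H.regular (H.Δ Z : H.Diamond H.regular)
  rw [BarHom.star_apply _ (Γ.star X Y), hZ, BarHom.star_apply _ X (Γ.star Y Z), Γ.Δ_star hY hZ]
  simp only [map_sum, BarHom.starMap_dia, Γ.shift_star _ hY, Finset.sum_mul, mul_assoc]

theorem starRight_starRight (Z W : L) (z : H.TensorBar) :
    Γ.starRight Z (Γ.starRight W z) = Γ.starRight (Γ.star W Z) z := by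
  have : Γ.starRight Z ∘ₗ Γ.starRight W = Γ.starRight (Γ.star W Z) := by
    apply H.tbar_ext
    simp [star_assoc]
  exact LinearMap.congr_fun this z

theorem starLeft_starLeft (Z W : L) (z : H.TensorBar) :
    Γ.starLeft Z (Γ.starLeft W z) = Γ.starLeft (Γ.star Z W) z := by
  have : Γ.starLeft Z ∘ₗ Γ.starLeft W = Γ.starLeft (Γ.star Z W) := by
    apply H.tbar_ext
    simp [star_assoc]
  exact LinearMap.congr_fun this z

end Bialgebroid

/-! ### The cotwisted product -/

section HopfAlgebroid

variable {H : LeftHopfAlgebroid k B L} (Γ : LeftTwoCocycle H.toLeftBialgebroid)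

theorem rightTwist_eq_sum {X : L} (Y : L) {n : ℕ} {a c : Fin n → L}
    (hX : H.plusMinus X = ∑ i, H.tbar (a i) (c i)) :
    Γ.rightTwist X Y = ∑ i, a i * Γ.coshift (c i) Y := by
  have h : ∀ a c, H.oppositeMul ∘ₗ Γ.pairAux H.opposite H.opposite c a
      = LinearMap.mulLeft k a ∘ₗ Γ.contract H.opposite c := by
    intro a c
    apply H.dia_ext
    intro x y
    rw [LinearMap.comp_apply, BarHom.pairAux_dia, LinearMap.comp_apply, BarHom.contract_dia]
    exact H.opposite.tensorLift_tmul H.opposite _ _ _ _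
  rw [rightTwist_apply, LeftHopfAlgebroid.coe_minusPlus, hX]
  simp only [map_sum, LeftHopfAlgebroid.flipBar_tbar, BarHom.pair_dia]
  exact Finset.sum_congr rfl fun i _ => LinearMap.congr_fun (h (a i) (c i)) (H.minusPlus Y)

/-- The cotwisted product is `X · Y = X₊ ∗ (Y₊ t (Γ(Y₋, X₋)))`. -/
theorem twistMul_eq (X Y : L) : Γ.twistMul X Y = Γ.starCoshift Y (H.plusMinus X) := by
  obtain ⟨m, a, c, hX⟩ := H.exists_tbar (H.plusMinus X)
  obtain ⟨n, d, e, hY⟩ := H.exists_dia H.regular (H.Δ Y : H.Diamond H.regular)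
  have h : ∀ y z, (H.regular.tensorLift H.regular Γ.rightTwist Γ.rightTwist_balanced :
      H.regular.Tensor H.regular →ₗ[k] L) ∘ₗ Γ.pairAux H.regular H.regular y z
      = Γ.rightTwist.flip z ∘ₗ Γ.contract H.regular y := by
    intro y z
    apply H.dia_ext
    intro x x'
    rw [LinearMap.comp_apply, BarHom.pairAux_dia, LinearMap.comp_apply, BarHom.contract_dia]
    exact H.regular.tensorLift_tmul H.regular _ _ _ _
  have h1 : ∀ y, H.plusMinus (Γ.shift y X) = ∑ i, H.tbar (Γ.shift y (a i)) (c i) := by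
    intro y
    simp [BarHom.plusMinus_shift, hX]
  have h2 : Γ.twistMul X Y = ∑ j, Γ.rightTwist (Γ.shift (d j) X) (e j) := by
    rw [twistMul, hY]
    simp only [map_sum, BarHom.pair_dia]
    exact Finset.sum_congr rfl fun j _ => LinearMap.congr_fun (h (d j) (e j)) (H.Δ X)
  rw [h2, hX, map_sum, Finset.sum_congr rfl fun j _ => Γ.rightTwist_eq_sum (e j) (h1 (d j)),
    Finset.sum_comm]
  refine Finset.sum_congr rfl fun i _ => ?_
  rw [BarHom.starCoshift_tbar, BarHom.star_apply, BarHom.Δ_coshift, hY]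
  simp [BarHom.starMap_dia]

theorem plusMinus_twistMul (X Y : L) :
    H.plusMinus (Γ.twistMul X Y) = Γ.insertStar Y (H.plusMinus X) := by
  rw [twistMul_eq, BarHom.plusMinus_starCoshift]

@[simp] theorem coshift_one (X : L) : Γ.coshift 1 X = X := by
  refine H.counit_plusMinus (Γ.contractBar 1) ?_ X
  intro x y
  rw [BarHom.contractBar_tbar, Γ.unit_right]

theorem coshift_s (c : L) (b : B) : Γ.coshift c (H.s b) = H.s b * H.t (op (H.ε c)) := by
  rw [BarHom.coshift_apply, LeftHopfAlgebroid.plusMinus_s, BarHom.contractBar_tbar, Γ.unit_left]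

theorem coshift_of_t (c : L) (b : B) : Γ.coshift c (H.t (op b)) = H.t (op (Γ.app (H.s b) c)) := by
  rw [BarHom.coshift_apply, LeftHopfAlgebroid.plusMinus_t, BarHom.contractBar_tbar, one_mul]

theorem coshift_of_one (c : L) : Γ.coshift c 1 = H.t (op (H.ε c)) := by
  have := Γ.coshift_s c 1
  rwa [map_one, one_mul] at this

@[simp] theorem twistMul_one (X : L) : Γ.twistMul X 1 = X := by
  rw [twistMul_eq]
  refine H.counit_plusMinus (Γ.starCoshift 1) ?_ X
  intro x y
  rw [BarHom.starCoshift_tbar, coshift_of_one, star_t]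

@[simp] theorem one_twistMul (X : L) : Γ.twistMul 1 X = X := by
  rw [twistMul_eq, LeftHopfAlgebroid.plusMinus_one, BarHom.starCoshift_tbar, coshift_one,
    one_star]

theorem twistMul_s (X : L) (b : B) : Γ.twistMul X (H.s b) = Γ.star X (H.s b) := by
  have h : Γ.starCoshift (H.s b) = Γ.star.flip (H.s b) ∘ₗ Γ.starCoshift 1 := by
    apply H.tbar_ext
    intro x y
    simp [BarHom.starCoshift_tbar, coshift_s, coshift_of_one, H.comm]
  rw [twistMul_eq, h, LinearMap.comp_apply, ← twistMul_eq, twistMul_one, LinearMap.flip_apply]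

theorem s_twistMul (b : B) (X : L) : Γ.twistMul (H.s b) X = Γ.star (H.s b) X := by
  rw [twistMul_eq, LeftHopfAlgebroid.plusMinus_s, BarHom.starCoshift_tbar, coshift_one]

theorem t_twistMul (b : B) (X : L) : Γ.twistMul (H.t (op b)) X = Γ.coshift (H.s b) X := by
  rw [twistMul_eq, LeftHopfAlgebroid.plusMinus_t, BarHom.starCoshift_tbar, one_star]

theorem twistMul_t {X : L} (b : B) {n : ℕ} {a c : Fin n → L}
    (hX : H.plusMinus X = ∑ i, H.tbar (a i) (c i)) :
    Γ.twistMul X (H.t (op b)) = ∑ i, a i * H.t (op (Γ.app (H.s b) (c i))) := by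
  simp [twistMul_eq, hX, BarHom.starCoshift_tbar, coshift_of_t]

theorem starLeft_insertStar (Z Y : L) (w : H.TensorBar) :
    Γ.insertStar Y (Γ.starLeft Z w) = Γ.starLeft Z (Γ.insertStar Y w) := by
  have : Γ.insertStar Y ∘ₗ Γ.starLeft Z = Γ.starLeft Z ∘ₗ Γ.insertStar Y := by
    apply H.tbar_ext
    simp [BarHom.insertStar_tbar, starLeft_starLeft]
  exact LinearMap.congr_fun this w

theorem starRight_insertStar (Z Y : L) (w : H.TensorBar) :
    Γ.insertStar Y (Γ.starRight Z w) = Γ.starRight Z (Γ.insertStar Y w) := by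
  have : Γ.insertStar Y ∘ₗ Γ.starRight Z = Γ.starRight Z ∘ₗ Γ.insertStar Y := by
    apply H.tbar_ext
    simp [BarHom.insertStar_tbar, ← starRight_starRight, BarHom.starLeft_starRight]
  exact LinearMap.congr_fun this w

theorem twistMul_assoc (X Y Z : L) :
    Γ.twistMul (Γ.twistMul X Y) Z = Γ.twistMul X (Γ.twistMul Y Z) := by
  apply H.plusMinus_injective
  have : Γ.insertStar Z ∘ₗ Γ.insertStar Y = Γ.insertStar (Γ.twistMul Y Z) := by
    apply H.tbar_ext
    intro x z
    simp only [LinearMap.comp_apply, BarHom.insertStar_tbar, starLeft_insertStar,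
      starRight_insertStar, plusMinus_twistMul]
  simp only [plusMinus_twistMul]
  exact LinearMap.congr_fun this _

theorem toLin_insertStar (Y x z : L) : Γ.toLin (Γ.insertStar Y (H.tbar x z))
    = Γ.app x (Γ.star (Γ.mulStar (H.plusMinus Y)) z) := by
  have : Γ.toLin ∘ₗ Γ.starLeft x ∘ₗ Γ.starRight z
      = Γ.app x ∘ₗ Γ.star.flip z ∘ₗ Γ.mulStar := by
    apply H.tbar_ext
    intro y y'
    simp only [LinearMap.comp_apply, BarHom.starLeft_tbar, BarHom.starRight_tbar,
      BarHom.mulStar_tbar, LinearMap.flip_apply, star_assoc]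
    exact (Γ.app_star x y (Γ.star y' z)).symm
  rw [BarHom.insertStar_tbar]
  exact LinearMap.congr_fun this _

theorem mulStar_plusMinus_s (b : B) : Γ.mulStar (H.plusMinus (H.s b)) = H.s b := by
  rw [LeftHopfAlgebroid.plusMinus_s, BarHom.mulStar_tbar, star_one]

theorem mulStar_plusMinus_t (b : B) : Γ.mulStar (H.plusMinus (H.t (op b))) = H.s b := by
  rw [LeftHopfAlgebroid.plusMinus_t, BarHom.mulStar_tbar, one_star]

/-- The counit `Γ((X · Y)₊, (X · Y)₋)` of a product depends on `Y` only through `Y₊ ∗ Y₋`. -/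
theorem twistCounit_twistMul_congr (X : L) {Y Y' : L}
    (h : Γ.mulStar (H.plusMinus Y) = Γ.mulStar (H.plusMinus Y')) :
    Γ.twistCounit (Γ.twistMul X Y) = Γ.twistCounit (Γ.twistMul X Y') := by
  have : Γ.toLin ∘ₗ Γ.insertStar Y = Γ.toLin ∘ₗ Γ.insertStar Y' := by
    apply H.tbar_ext
    intro x z
    simp only [LinearMap.comp_apply, toLin_insertStar, h]
  simp only [twistCounit, plusMinus_twistMul]
  exact LinearMap.congr_fun this _

theorem twistCounit_twistMul_s (X Y : L) : Γ.twistCounit (Γ.twistMul X Y)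
    = Γ.twistCounit (Γ.twistMul X (H.s (Γ.twistCounit Y))) := by
  apply twistCounit_twistMul_congr
  rw [mulStar_plusMinus_s, BarHom.mulStar_plusMinus, twistCounit]

theorem twistCounit_twistMul_t (X Y : L) : Γ.twistCounit (Γ.twistMul X Y)
    = Γ.twistCounit (Γ.twistMul X (H.t (op (Γ.twistCounit Y)))) := by
  apply twistCounit_twistMul_congr
  rw [mulStar_plusMinus_t, BarHom.mulStar_plusMinus, twistCounit]

theorem twistCounit_s_twistMul (a : B) (X : L) :
    Γ.twistCounit (Γ.twistMul (H.s a) X) = Γ.baseMul a (Γ.twistCounit X) := by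
  rw [twistCounit, plusMinus_twistMul, LeftHopfAlgebroid.plusMinus_s, toLin_insertStar, star_one,
    BarHom.mulStar_plusMinus]
  rfl

theorem twistCounit_t_twistMul (b : B) (X : L) :
    Γ.twistCounit (Γ.twistMul (H.t (op b)) X) = Γ.baseMul (Γ.twistCounit X) b := by
  rw [twistCounit, plusMinus_twistMul, LeftHopfAlgebroid.plusMinus_t, toLin_insertStar,
    BarHom.mulStar_plusMinus, star_s_s, Γ.unit_left, LeftBialgebroid.ε_s]
  rfl

theorem twistCounit_one : Γ.twistCounit 1 = 1 := by
  rw [twistCounit, LeftHopfAlgebroid.plusMinus_one]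
  exact (Γ.unit_left 1).trans H.ε_one

theorem baseMul_assoc (a b c : B) :
    Γ.baseMul (Γ.baseMul a b) c = Γ.baseMul a (Γ.baseMul b c) := by
  simp only [baseMul, ← star_s_s, app_star]

theorem baseMul_one (a : B) : Γ.baseMul a 1 = a := by
  rw [baseMul, map_one, Γ.unit_right, LeftBialgebroid.ε_s]

theorem one_baseMul (a : B) : Γ.baseMul 1 a = a := by
  rw [baseMul, map_one, Γ.unit_left, LeftBialgebroid.ε_s]

theorem sharp_eq (X Y : L) : Γ.sharp X Y = H.lam (Γ.starRight Y (H.plusMinus X)) := by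
  have : Γ.pair H.opposite H.regular (H.minusPlus X) = Γ.coshiftMap X := by
    apply H.dia_ext
    intro y z
    have h : Γ.pairAux H.opposite H.regular y z
        = (H.dia H.regular).flip z ∘ₗ Γ.contract H.opposite y := by
      apply H.dia_ext
      intro x x'
      rw [BarHom.pairAux_dia, LinearMap.comp_apply, BarHom.contract_dia]
      rfl
    rw [BarHom.pair_dia, h]
    rfl
  rw [BarHom.lam_starRight_plusMinus, ← this]
  rfl

theorem lam_tbar_one (X : L) : H.lam (H.tbar X 1) = H.Δ X := by
  have : H.diaMulRight₂ 1 1 = LinearMap.id := by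
    apply H.dia_ext
    simp
  rw [LeftBialgebroid.lam_tbar, this, LinearMap.id_apply]

theorem starRight_mul_t (Y : L) (b : B) (w : H.TensorBar) :
    Γ.starRight (Y * H.t (op b)) w = H.tbarMulRight (H.t (op b)) (Γ.starRight Y w) := by
  have : Γ.starRight (Y * H.t (op b)) = H.tbarMulRight (H.t (op b)) ∘ₗ Γ.starRight Y := by
    apply H.tbar_ext
    simp [BarHom.star_mul_t]
  exact LinearMap.congr_fun this w

theorem starRight_one (w : H.TensorBar) : Γ.starRight 1 w = w := by
  have : Γ.starRight 1 = LinearMap.id := by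
    apply H.tbar_ext
    simp
  exact LinearMap.congr_fun this w

/-- If the sum of all `u₊ ⊗ u₋ ∗ v` is `X ⊗ 1`, then the sum of all `u₊ ⊗ u₋ ∗ v₊ ⊗ v₋` is
`X₊ ⊗ 1 ⊗ X₋`. This is stated for the values of a balanced trilinear map, given by its partial
maps `f z`; the pairs `(a i, c i)` represent `X₊ ⊗ X₋`. -/
theorem translation_apply {Q : Type*} [AddCommGroup Q] [Module k Q] {X : L} {m n : ℕ}
    {u v : Fin n → L} (huv : ∑ i, Γ.starRight (v i) (H.plusMinus (u i)) = H.tbar X 1)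
    {a c : Fin m → L} (hX : H.plusMinus X = ∑ i, H.tbar (a i) (c i))
    (f : L →ₗ[k] H.TensorBar →ₗ[k] Q)
    (hf : ∀ b z w, f (H.t (op b) * z) w = f z (H.tbarMulRight (H.t (op b)) w))
    (h : L → H.TensorBar →ₗ[k] Q)
    (hh : ∀ u y z, h u (H.tbar y z) = f z (Γ.starRight y (H.plusMinus u))) :
    ∑ i, h (u i) (H.plusMinus (v i)) = ∑ i, f (c i) (H.tbar (a i) 1) := by
  obtain ⟨K, hK⟩ : ∃ K : H.TensorBar →ₗ[k] Q, ∀ x z, K (H.tbar x z) = f z (H.tbar x 1) :=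
    ⟨H.tbarLift (f.flip ∘ₗ H.tbar.flip 1) (by
      intro b x z
      simp [hf, BeRing.tbar_balanced]), fun x z => H.tbarLift_tbar _ _ x z⟩
  obtain ⟨m, hm⟩ : ∃ m : L → H.TensorBar →ₗ[k] Q, ∀ x y z,
      m x (H.tbar y z) = f z (H.lamInv (H.dia H.regular x y)) :=
    ⟨fun x => H.tbarLift (f.flip.compl₁₂ (H.lamInv ∘ₗ H.dia H.regular x) LinearMap.id) (by
      intro b y z
      simp [hf, LeftHopfAlgebroid.lamInv_dia, BeRing.tbarMulRight_mulRight]),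
      fun x y z => H.tbarLift_tbar _ _ y z⟩
  have m_add : ∀ x x', m (x + x') = m x + m x' := by
    intro x x'
    apply H.tbar_ext
    simp [hm]
  have m_smul : ∀ (c : k) x, m (c • x) = c • m x := by
    intro c x
    apply H.tbar_ext
    simp [hm]
  have m_t : ∀ b x, m (H.t (op b) * x) = m x ∘ₗ H.tbarMulLeft (H.s b) := by
    intro b x
    apply H.tbar_ext
    simp [hm, H.dia_balanced]
  obtain ⟨N, hN⟩ : ∃ N : H.Diamond H.regular →ₗ[k] Q, ∀ x y,
      N (H.dia H.regular x y) = m x (H.plusMinus y) :=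
    ⟨H.diaLift H.regular (LinearMap.mk₂ k (fun x y => m x (H.plusMinus y))
      (by intros; simp [m_add]) (by intros; simp [m_smul]) (by intros; simp) (by intros; simp))
      (by
        intro b x y
        simp [m_t, LeftHopfAlgebroid.plusMinus_s_mul]),
      fun x y => H.diaLift_dia H.regular _ _ x y⟩
  have h1 : ∀ u v, h u (H.plusMinus v) = N (H.lam (Γ.starRight v (H.plusMinus u))) := by
    intro u v
    rw [BarHom.lam_starRight_plusMinus]
    refine H.comul_plus_apply (h u) (N ∘ₗ Γ.coshiftMap u)
      (fun z => f z ∘ₗ H.lamInv ∘ₗ Γ.coshiftMap u) (fun x => m (Γ.coshift x u)) ?_ ?_ ?_ v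
    · intro x z
      rw [hh, LinearMap.comp_apply, LinearMap.comp_apply, ← BarHom.lam_starRight_plusMinus,
        LeftHopfAlgebroid.lamInv_lam]
    · intro x y
      simp [hN]
    · intro x y z
      simp [hm]
  have h2 : K (H.plusMinus X) = N (H.Δ X) := by
    refine H.comul_plus_apply K N (fun z => f z ∘ₗ H.lamInv) m ?_ hN ?_ X
    · intro x z
      rw [hK, LinearMap.comp_apply, ← lam_tbar_one, LeftHopfAlgebroid.lamInv_lam]
    · intro x y z
      rw [hm, LinearMap.comp_apply]
  have h3 : ∑ i, h (u i) (H.plusMinus (v i)) = K (H.plusMinus X) := by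
    rw [h2, ← lam_tbar_one, ← huv, map_sum, map_sum]
    exact Finset.sum_congr rfl fun i _ => h1 (u i) (v i)
  simp only [h3, hX, map_sum, hK]

end HopfAlgebroid

end LeftTwoCocycle
end Cocycle

/-! ### Isomorphisms of balanced tensor products -/

section Equiv

variable {k : Type*} {B B' : Type*} {M N M' N' : Type*} [Field k]
  [AddCommGroup M] [Module k M] [AddCommGroup N] [Module k N]
  [AddCommGroup M'] [Module k M'] [AddCommGroup N'] [Module k N']
  {r : B → M →ₗ[k] M} {l : B → N →ₗ[k] N} {r' : B' → M' →ₗ[k] M'} {l' : B' → N' →ₗ[k] N'}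

theorem BalTensor.exists_equiv (σ : B ≃ B') (f : M ≃ₗ[k] M') (g : N ≃ₗ[k] N')
    (hf : ∀ b m, f (r b m) = r' (σ b) (f m)) (hg : ∀ b n, g (l b n) = l' (σ b) (g n)) :
    ∃ e : BalTensor r l ≃ₗ[k] BalTensor r' l',
      ∀ m n, e (BalTensor.tmul r l m n) = BalTensor.tmul r' l' (f m) (g n) := by
  have hf' : ∀ b m, f.symm (r' b m) = r (σ.symm b) (f.symm m) := by
    intro b m
    rw [LinearEquiv.symm_apply_eq, hf]
    simp
  have hg' : ∀ b n, g.symm (l' b n) = l (σ.symm b) (g.symm n) := by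
    intro b n
    rw [LinearEquiv.symm_apply_eq, hg]
    simp
  refine ⟨LinearEquiv.ofLinearMap
    (BalTensor.lift ((BalTensor.tmul r' l').compl₁₂ f.toLinearMap g.toLinearMap) ?_)
    (BalTensor.lift ((BalTensor.tmul r l).compl₁₂ f.symm.toLinearMap g.symm.toLinearMap) ?_)
    ?_ ?_, ?_⟩
  · intro b m n
    simp [hf, hg, BalTensor.tmul_balanced]
  · intro b m n
    simp [hf', hg', BalTensor.tmul_balanced]
  · apply BalTensor.ext_lin
    simp
  · apply BalTensor.ext_lin
    simp
  · intro m n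
    simp

theorem BalTensor.exists_flip (σ : B ≃ B') (f : M ≃ₗ[k] N') (g : N ≃ₗ[k] M')
    (hf : ∀ b m, f (r b m) = l' (σ b) (f m)) (hg : ∀ b n, g (l b n) = r' (σ b) (g n)) :
    ∃ e : BalTensor r l ≃ₗ[k] BalTensor r' l',
      ∀ m n, e (BalTensor.tmul r l m n) = BalTensor.tmul r' l' (g n) (f m) := by
  have hf' : ∀ b m, f.symm (l' b m) = r (σ.symm b) (f.symm m) := by
    intro b m
    rw [LinearEquiv.symm_apply_eq, hf]
    simp
  have hg' : ∀ b n, g.symm (r' b n) = l (σ.symm b) (g.symm n) := by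
    intro b n
    rw [LinearEquiv.symm_apply_eq, hg]
    simp
  refine ⟨LinearEquiv.ofLinearMap
    (BalTensor.lift ((BalTensor.tmul r' l').flip.compl₁₂ f.toLinearMap g.toLinearMap) ?_)
    (BalTensor.lift ((BalTensor.tmul r l).flip.compl₁₂ g.symm.toLinearMap f.symm.toLinearMap) ?_)
    ?_ ?_, ?_⟩
  · intro b m n
    simp [hf, hg, BalTensor.tmul_balanced]
  · intro b m n
    simp [hf', hg', BalTensor.tmul_balanced]
  · apply BalTensor.ext_lin
    simp
  · apply BalTensor.ext_lin
    simp
  · intro m n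
    simp

end Equiv

/-! ### Algebras with the cotwisted products -/

section Cotwisted

variable {k : Type w} {B : Type u} {L : Type v} [Field k] [Ring B] [Algebra k B]
  [Ring L] [Algebra k L] {H : LeftHopfAlgebroid k B L}

/-- Algebras `C` and `R` with identifications `β : B ≃ C` and `ι : L ≃ R` of the underlying vector
spaces that carry the products `a ·_Γ b` and `X ·_Γ Y` to the products of `C` and `R`, and the
units of `B` and `L` to those of `C` and `R`. -/
structure Realization (Γ : LeftTwoCocycle H.toLeftBialgebroid) (C R : Type*) [Ring C]
    [Algebra k C] [Ring R] [Algebra k R] where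
  β : B ≃ₗ[k] C
  ι : L ≃ₗ[k] R
  β_one : β 1 = 1
  β_mul : ∀ a b, β (Γ.baseMul a b) = β a * β b
  ι_one : ι 1 = 1
  ι_mul : ∀ X Y, ι (Γ.twistMul X Y) = ι X * ι Y

namespace Realization

variable {Γ : LeftTwoCocycle H.toLeftBialgebroid} {C R : Type*} [Ring C] [Algebra k C] [Ring R]
  [Algebra k R] (E : Realization Γ C R)

/-- The maps `s` and `t`, as maps between the cotwisted algebras. -/
noncomputable def beRing : BeRing k C R where
  s := AlgHom.ofLinearMap (E.ι.toLinearMap ∘ₗ H.s.toLinearMap ∘ₗ E.β.symm.toLinearMap)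
    (by simp [← E.β_one, E.ι_one])
    (by
      intro a b
      obtain ⟨a, rfl⟩ := E.β.surjective a
      obtain ⟨b, rfl⟩ := E.β.surjective b
      simp [← E.β_mul, ← E.ι_mul, Γ.s_twistMul, Γ.star_s_s, LeftTwoCocycle.baseMul])
  t := AlgHom.ofLinearMap (E.ι.toLinearMap ∘ₗ H.t.toLinearMap ∘ₗ
      (opLinearEquiv k).toLinearMap ∘ₗ E.β.symm.toLinearMap ∘ₗ (opLinearEquiv k).symm.toLinearMap)
    (by simp [← E.β_one, E.ι_one])
    (by
      intro a b
      obtain ⟨a, rfl⟩ := op_surjective a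
      obtain ⟨b, rfl⟩ := op_surjective b
      obtain ⟨a, rfl⟩ := E.β.surjective a
      obtain ⟨b, rfl⟩ := E.β.surjective b
      simp [← op_mul, ← E.β_mul, ← E.ι_mul, Γ.t_twistMul, Γ.coshift_of_t,
        LeftTwoCocycle.baseMul])
  comm := by
    intro a b
    obtain ⟨a, rfl⟩ := E.β.surjective a
    obtain ⟨b, rfl⟩ := E.β.surjective b
    simp [← E.ι_mul, Γ.t_twistMul, Γ.s_twistMul, Γ.coshift_s, LeftBialgebroid.ε_s]

@[simp] theorem s_β (b : B) : E.beRing.s (E.β b) = E.ι (H.s b) := by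
  simp [beRing]

@[simp] theorem t_β (b : B) : E.beRing.t (op (E.β b)) = E.ι (H.t (op b)) := by
  simp [beRing]

/-- The space `R ⋄_C R` for the cotwisted algebras. -/
abbrev Dia : Type _ := E.beRing.Diamond E.beRing.regular

/-- The class of `ι X ⊗ ι Y` in `R ⋄_C R`. -/
noncomputable def dia : L →ₗ[k] L →ₗ[k] E.Dia :=
  (E.beRing.dia E.beRing.regular).compl₁₂ E.ι.toLinearMap E.ι.toLinearMap

theorem dia_apply (X Y : L) : E.dia X Y = E.beRing.dia E.beRing.regular (E.ι X) (E.ι Y) := rfl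

theorem dia_ext {P : Type*} [AddCommGroup P] [Module k P] {f g : E.Dia →ₗ[k] P}
    (h : ∀ X Y, f (E.dia X Y) = g (E.dia X Y)) : f = g := by
  apply E.beRing.dia_ext
  intro x y
  obtain ⟨X, rfl⟩ := E.ι.surjective x
  obtain ⟨Y, rfl⟩ := E.ι.surjective y
  exact h X Y

theorem exists_dia (z : E.Dia) :
    ∃ (n : ℕ) (a c : Fin n → L), z = ∑ i, E.dia (a i) (c i) := by
  obtain ⟨n, a, c, rfl⟩ := E.beRing.exists_dia E.beRing.regular z
  exact ⟨n, fun i => E.ι.symm (a i), fun i => E.ι.symm (c i), by simp [dia_apply]⟩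

end Realization

namespace LeftTwoCocycle

variable (Γ : LeftTwoCocycle H.toLeftBialgebroid)

theorem app_s_t_mul (a b : B) (X : L) :
    Γ.app (H.s a) (H.t (op b) * X) = Γ.app (H.s a) X * b := by
  rw [← Γ.app_balanced, H.comm, Γ.app_t_mul]

theorem actRight_opposite (b : B) (X : L) :
    Γ.actRight H.oppositeComodule b X = Γ.twistMul (H.t (op b)) X := by
  rw [t_twistMul]
  rfl

theorem actLeft_regular (b : B) (X : L) :
    Γ.actLeft H.regularComodule b X = Γ.twistMul (H.s b) X := by
  obtain ⟨n, d, e, hde⟩ := H.exists_dia H.regular (H.Δ X : H.Diamond H.regular)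
  have h : ∀ (c : B) (X m : L), (H.regular.l.toLinearMap ∘ₗ Γ.app (H.s b)) (H.t (op c) * X) m
      = (H.regular.l.toLinearMap ∘ₗ Γ.app (H.s b)) X (H.regular.l c m) := by
    intro c X m
    simp [app_s_t_mul]
  have h' : Γ.actLeft H.regularComodule b X
      = H.diaLift H.regular (H.regular.l.toLinearMap ∘ₗ Γ.app (H.s b)) h
        (H.Δ X : H.Diamond H.regular) := rfl
  rw [h', s_twistMul, BarHom.star_apply, hde]
  simp [BarHom.starMap_dia, BarHom.shift_s]

theorem actLeft_opposite (b : B) (X : L) :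
    Γ.actLeft H.oppositeComodule b X = Γ.twistMul X (H.t (op b)) := by
  obtain ⟨n, a, c, hac⟩ := H.exists_tbar (H.plusMinus X)
  have h : ∀ (c : B) (X m : L), (H.opposite.l.toLinearMap ∘ₗ Γ.app (H.s b)) (H.t (op c) * X) m
      = (H.opposite.l.toLinearMap ∘ₗ Γ.app (H.s b)) X (H.opposite.l c m) := by
    intro c X m
    simp [app_s_t_mul, mul_assoc]
  have h' : Γ.actLeft H.oppositeComodule b X
      = H.diaLift H.opposite (H.opposite.l.toLinearMap ∘ₗ Γ.app (H.s b)) h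
        (H.flipBar (H.plusMinus X)) := rfl
  rw [h', Γ.twistMul_t b hac, hac]
  simp

end LeftTwoCocycle

namespace Realization

variable {Γ : LeftTwoCocycle H.toLeftBialgebroid} {C : Type u} {R : Type v} [Ring C]
  [Algebra k C] [Ring R] [Algebra k R] (E : Realization Γ C R)

theorem exists_sharp (hΓ : Γ.IsInvertible) :
    ∃ e : E.Dia ≃ₗ[k] H.Diamond H.regular, ∀ X Y, e (E.dia X Y) = Γ.sharp X Y := by
  obtain ⟨e, he⟩ : ∃ e : BalTensor (Γ.actRight H.oppositeComodule)
      (Γ.actLeft H.regularComodule) ≃ₗ[k] H.Diamond H.regular,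
      ∀ X Y, e (BalTensor.tmul _ _ X Y) = Γ.sharp X Y :=
    hΓ L L H.oppositeComodule H.regularComodule
  obtain ⟨e', he'⟩ : ∃ e' : E.Dia ≃ₗ[k] BalTensor (Γ.actRight H.oppositeComodule)
      (Γ.actLeft H.regularComodule), ∀ x y, e' (E.beRing.dia E.beRing.regular x y)
        = BalTensor.tmul _ _ (E.ι.symm x) (E.ι.symm y) := by
    refine BalTensor.exists_equiv E.β.symm.toEquiv E.ι.symm E.ι.symm ?_ ?_
    · intro b x
      obtain ⟨b, rfl⟩ := E.β.surjective b
      obtain ⟨X, rfl⟩ := E.ι.surjective x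
      simp [LeftTwoCocycle.actRight_opposite, ← E.ι_mul]
    · intro b x
      obtain ⟨b, rfl⟩ := E.β.surjective b
      obtain ⟨X, rfl⟩ := E.ι.surjective x
      simp [LeftTwoCocycle.actLeft_regular, ← E.ι_mul]
  refine ⟨e'.trans e, fun X Y => ?_⟩
  rw [LinearEquiv.trans_apply, dia_apply, he', LinearEquiv.symm_apply_apply,
    LinearEquiv.symm_apply_apply, he]

/-- The bijection `R ⊗_{C̄} R ≃ L ⊗_{B̄} L`, `X ⊗ Y ↦ X₊ ⊗ Y₊ t (Γ(Y₋, X₋))`. -/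
theorem exists_galois (hΓ : Γ.IsInvertible) :
    ∃ e : E.beRing.TensorBar ≃ₗ[k] H.TensorBar, ∀ (X Y : L) (n : ℕ) (a c : Fin n → L),
      H.plusMinus X = ∑ i, H.tbar (a i) (c i) →
        e (E.beRing.tbar (E.ι X) (E.ι Y)) = ∑ i, H.tbar (a i) (Γ.coshift (c i) Y) := by
  obtain ⟨e, he⟩ : ∃ e : BalTensor (Γ.actRight H.oppositeComodule)
      (Γ.actLeft H.oppositeComodule) ≃ₗ[k] H.opposite.Tensor H.opposite,
      ∀ X Y, e (BalTensor.tmul _ _ X Y)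
        = Γ.pair H.opposite H.opposite (H.minusPlus X) (H.flipBar (H.plusMinus Y)) :=
    hΓ L L H.oppositeComodule H.oppositeComodule
  obtain ⟨e', he'⟩ : ∃ e' : E.beRing.TensorBar ≃ₗ[k] BalTensor (Γ.actRight H.oppositeComodule)
      (Γ.actLeft H.oppositeComodule), ∀ x y, e' (E.beRing.tbar x y)
        = BalTensor.tmul _ _ (E.ι.symm y) (E.ι.symm x) := by
    refine BalTensor.exists_flip E.β.symm.toEquiv E.ι.symm E.ι.symm ?_ ?_
    · intro b x
      obtain ⟨b, rfl⟩ := E.β.surjective b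
      obtain ⟨X, rfl⟩ := E.ι.surjective x
      simp [LeftTwoCocycle.actLeft_opposite, ← E.ι_mul]
    · intro b x
      obtain ⟨b, rfl⟩ := E.β.surjective b
      obtain ⟨X, rfl⟩ := E.ι.surjective x
      simp [LeftTwoCocycle.actRight_opposite, ← E.ι_mul]
  obtain ⟨e'', he''⟩ : ∃ e'' : H.opposite.Tensor H.opposite ≃ₗ[k] H.TensorBar,
      ∀ x y, e'' (H.opposite.tmul H.opposite x y) = H.tbar y x :=
    BalTensor.exists_flip (Equiv.refl B) (LinearEquiv.refl k L) (LinearEquiv.refl k L)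
      (fun _ _ => rfl) (fun _ _ => rfl)
  refine ⟨e'.trans (e.trans e''), fun X Y n a c hac => ?_⟩
  have h : ∀ a c, Γ.pairAux H.opposite H.opposite c a
      = (H.opposite.tmul H.opposite).flip a ∘ₗ Γ.contract H.opposite c := by
    intro a c
    apply H.dia_ext
    intro x y
    rw [BarHom.pairAux_dia, LinearMap.comp_apply, BarHom.contract_dia]
    rfl
  rw [LinearEquiv.trans_apply, he', LinearEquiv.symm_apply_apply, LinearEquiv.symm_apply_apply,
    LinearEquiv.trans_apply, he, hac]
  simp only [map_sum, LeftHopfAlgebroid.flipBar_tbar, BarHom.pair_dia, h, LinearMap.comp_apply,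
    LinearMap.flip_apply, he'']
  rfl

end Realization

end Cotwisted

/-! ### The cotwisted coproduct -/

section Cocycle

variable {k : Type w} {B : Type u} {L : Type v} [Field k] [Ring B] [Algebra k B]
  [Ring L] [Algebra k L] {H : LeftHopfAlgebroid k B L}

namespace LeftTwoCocycle

variable (Γ : LeftTwoCocycle H.toLeftBialgebroid)

/-- The map `Y ↦ z ∗ (1 ⊗ Y)`, for a fixed `z` in `L ⊗_{B̄} L`. -/
def starRightHom (z : H.TensorBar) : L →ₗ[k] H.TensorBar where
  toFun Y := Γ.starRight Y z
  map_add' := by simp [BarHom.starRight_add]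
  map_smul' := by simp [BarHom.starRight_smul]

@[simp] theorem starRightHom_apply (z : H.TensorBar) (Y : L) :
    Γ.starRightHom z Y = Γ.starRight Y z := rfl

theorem mulRight_t_eq_starRight (b : B) :
    H.tbarMulRight (H.t (op b)) = Γ.starRight (H.t (op b)) := by
  apply H.tbar_ext
  simp

theorem t_star (b : B) (X : L) : Γ.star (H.t (op b)) X = H.t (op b) * X := by
  have := Γ.t_mul_star 1 X b
  rwa [mul_one, one_star] at this

/-- If the sum of all `u₊ ⊗ u₋ ∗ v` is `X ⊗ 1`, then the sum of all
`(u · W)₊ ⊗ (u · W)₋ ∗ (v · Z)` is `X₊ ∗ W₊ ⊗ W₋ ∗ (Z₊ t (Γ(Z₋, X₋)))`. -/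
theorem translation_twistMul {X : L} {m n : ℕ}
    {u v : Fin n → L} (huv : ∑ i, Γ.starRight (v i) (H.plusMinus (u i)) = H.tbar X 1)
    {a c : Fin m → L} (hX : H.plusMinus X = ∑ i, H.tbar (a i) (c i)) (W Z : L) :
    ∑ j, Γ.starRight (Γ.twistMul (v j) Z) (H.plusMinus (Γ.twistMul (u j) W))
      = ∑ i, Γ.starLeft (a i) (Γ.starRight (Γ.coshift (c i) Z) (H.plusMinus W)) := by
  obtain ⟨f, hf⟩ : ∃ f : L →ₗ[k] H.TensorBar →ₗ[k] H.TensorBar, ∀ z w,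
      f z w = Γ.starRight (Γ.coshift z Z) (Γ.insertStar W w) :=
    ⟨LinearMap.mk₂ k (fun z w => Γ.starRight (Γ.coshift z Z) (Γ.insertStar W w))
      (by intros; simp [BarHom.starRight_add]) (by intros; simp [BarHom.starRight_smul])
      (by intros; simp) (by intros; simp), fun _ _ => rfl⟩
  have h := Γ.translation_apply huv hX f ?_
    (fun u => Γ.starRightHom (H.plusMinus (Γ.twistMul u W)) ∘ₗ Γ.starCoshift Z) ?_
  · simp only [LinearMap.comp_apply, starRightHom_apply, ← twistMul_eq] at h
    rw [h]
    refine Finset.sum_congr rfl fun i _ => ?_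
    rw [hf, BarHom.insertStar_tbar, starRight_one, BarHom.starLeft_starRight]
  · intro b z w
    simp only [hf, Γ.mulRight_t_eq_starRight, starRight_insertStar, starRight_starRight,
      BarHom.coshift_t, t_star]
  · intro u y z
    simp only [hf, LinearMap.comp_apply, BarHom.starCoshift_tbar, starRightHom_apply,
      starRight_insertStar, starRight_starRight, plusMinus_twistMul]

/-- If the sum of all `u₊ ⊗ u₋ ∗ v` is `X ⊗ 1`, then the sum of all
`u₊ ⊗ u₋ ∗ (v₊ t (Γ(v₋, c)))` is `X₊ t (Γ(X₋, c)) ⊗ 1`. -/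
theorem translation_coshift {X : L} {n : ℕ} {u v : Fin n → L}
    (huv : ∑ i, Γ.starRight (v i) (H.plusMinus (u i)) = H.tbar X 1) (c : L) :
    ∑ i, Γ.starRight (Γ.coshift c (v i)) (H.plusMinus (u i)) = H.tbar (Γ.coshift c X) 1 := by
  obtain ⟨m, a, d, hX⟩ := H.exists_tbar (H.plusMinus X)
  obtain ⟨f, hf⟩ : ∃ f : L →ₗ[k] H.TensorBar →ₗ[k] H.TensorBar, ∀ z w,
      f z w = Γ.starRight (H.t (op (Γ.app z c))) w :=
    ⟨LinearMap.mk₂ k (fun z w => Γ.starRight (H.t (op (Γ.app z c))) w)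
      (by intros; simp [BarHom.starRight_add]) (by intros; simp [BarHom.starRight_smul])
      (by intros; simp) (by intros; simp), fun _ _ => rfl⟩
  have h := Γ.translation_apply huv hX f ?_
    (fun u => Γ.starRightHom (H.plusMinus u) ∘ₗ Γ.contractBar c) ?_
  · simp only [LinearMap.comp_apply, starRightHom_apply, ← BarHom.coshift_apply] at h
    rw [h, BarHom.coshift_apply, hX]
    simp [hf, BarHom.contractBar_tbar, BeRing.tbar_balanced]
  · intro b z w
    simp [hf, Γ.mulRight_t_eq_starRight, starRight_starRight, Γ.app_t_mul]
  · intro u y z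
    simp [hf, BarHom.contractBar_tbar, starRight_starRight]

theorem contractBar_starRight (y z : L) (w : H.TensorBar) :
    Γ.contractBar z (Γ.starRight y w) = Γ.contractBar (Γ.star y z) w := by
  have : Γ.contractBar z ∘ₗ Γ.starRight y = Γ.contractBar (Γ.star y z) := by
    apply H.tbar_ext
    simp [BarHom.contractBar_tbar, Γ.app_star]
  exact LinearMap.congr_fun this w

/-- If the sum of all `u₊ ⊗ u₋ ∗ v` is `X ⊗ 1`, then the sum of all `t (ε^Γ(v)) · u`
is `X`. -/
theorem translation_counit {X : L} {n : ℕ} {u v : Fin n → L}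
    (huv : ∑ i, Γ.starRight (v i) (H.plusMinus (u i)) = H.tbar X 1) :
    ∑ i, Γ.twistMul (H.t (op (Γ.twistCounit (v i)))) (u i) = X := by
  obtain ⟨m, a, c, hX⟩ := H.exists_tbar (H.plusMinus X)
  have h := Γ.translation_apply huv hX Γ.contractBar ?_ (fun u => Γ.coshift.flip u ∘ₗ Γ.mulStar) ?_
  · simp only [LinearMap.comp_apply, BarHom.mulStar_plusMinus, LinearMap.flip_apply] at h
    simp only [Γ.t_twistMul]
    refine h.trans ?_
    have h1 := Γ.coshift_one X
    rw [BarHom.coshift_apply, hX, map_sum] at h1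
    simpa only [BarHom.contractBar_tbar, Γ.unit_left, Γ.unit_right] using h1
  · intro b z w
    have : Γ.contractBar (H.t (op b) * z)
        = Γ.contractBar z ∘ₗ H.tbarMulRight (H.t (op b)) := by
      apply H.tbar_ext
      simp [BarHom.contractBar_tbar, Γ.app_balanced]
    exact LinearMap.congr_fun this w
  · intro u y z
    simp [contractBar_starRight, BarHom.coshift_apply]

end LeftTwoCocycle

namespace Realization

variable {Γ : LeftTwoCocycle H.toLeftBialgebroid} {C : Type u} {R : Type v} [Ring C]
  [Algebra k C] [Ring R] [Algebra k R] (E : Realization Γ C R) (hΓ : Γ.IsInvertible)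

/-- The isomorphism `λ⁻¹ ∘ Γ^# : R ⋄_C R → L ⊗_{B̄} L`, `X ⊗ Y ↦ X₊ ⊗ X₋ ∗ Y`. -/
noncomputable def barEquiv : E.Dia ≃ₗ[k] H.TensorBar :=
  (E.exists_sharp hΓ).choose.trans (LinearEquiv.ofBijective H.lam H.lam_bijective).symm

theorem barEquiv_dia (X Y : L) :
    E.barEquiv hΓ (E.dia X Y) = Γ.starRight Y (H.plusMinus X) := by
  rw [barEquiv, LinearEquiv.trans_apply, (E.exists_sharp hΓ).choose_spec,
    LeftTwoCocycle.sharp_eq]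
  exact (LinearEquiv.ofBijective H.lam H.lam_bijective).symm_apply_apply _

/-- The element of `R ⋄_C R` that corresponds to `X ⊗ 1` lies in the Takeuchi product: both sides
correspond to `X ⊗ s b`. -/
theorem diaMulRight_t_eq_diaActRight (b : B) (X : L) (z : E.Dia)
    (hz : E.barEquiv hΓ z = H.tbar X 1) :
    E.beRing.diaMulRight E.beRing.regular (E.beRing.t (op (E.β b))) z
      = E.beRing.diaActRight E.beRing.regular (E.β b) z := by
  have h1 : (E.barEquiv hΓ).toLinearMap
        ∘ₗ E.beRing.diaMulRight E.beRing.regular (E.beRing.t (op (E.β b)))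
      = Γ.insertStar (H.t (op b)) ∘ₗ (E.barEquiv hΓ).toLinearMap := by
    apply E.dia_ext
    intro u v
    have : E.beRing.diaMulRight E.beRing.regular (E.beRing.t (op (E.β b))) (E.dia u v)
        = E.dia (Γ.twistMul u (H.t (op b))) v := by
      simp [dia_apply, E.ι_mul]
    simp only [LinearMap.comp_apply, this, LinearEquiv.coe_coe, barEquiv_dia,
      Γ.plusMinus_twistMul, Γ.starRight_insertStar]
  have h2 : (E.barEquiv hΓ).toLinearMap ∘ₗ E.beRing.diaActRight E.beRing.regular (E.β b)
      = Γ.starRight (H.s b) ∘ₗ (E.barEquiv hΓ).toLinearMap := by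
    apply E.dia_ext
    intro u v
    have : E.beRing.diaActRight E.beRing.regular (E.β b) (E.dia u v)
        = E.dia u (Γ.star v (H.s b)) := by
      simp [dia_apply, ← Γ.twistMul_s, E.ι_mul]
    simp only [LinearMap.comp_apply, this, LinearEquiv.coe_coe, barEquiv_dia,
      Γ.starRight_starRight]
  have h1' := LinearMap.congr_fun h1 z
  have h2' := LinearMap.congr_fun h2 z
  simp only [LinearMap.comp_apply, LinearEquiv.coe_coe, hz] at h1' h2'
  apply (E.barEquiv hΓ).injective
  rw [h1', h2']
  simp [BarHom.insertStar_tbar, LeftHopfAlgebroid.plusMinus_t]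

/-- The cotwisted coproduct: the coproduct of `X` is the preimage of `X ⊗ 1` under `barEquiv`. -/
noncomputable def comul : R →ₗ[k] E.beRing.Takeuchi E.beRing.regular :=
  ((E.barEquiv hΓ).symm.toLinearMap ∘ₗ H.tbar.flip 1 ∘ₗ E.ι.symm.toLinearMap).codRestrict _ (by
    intro x b
    obtain ⟨b, rfl⟩ := E.β.surjective b
    exact E.diaMulRight_t_eq_diaActRight hΓ b (E.ι.symm x) _ ((E.barEquiv hΓ).apply_symm_apply _))

theorem comul_ι (X : L) :
    (E.comul hΓ (E.ι X) : E.Dia) = (E.barEquiv hΓ).symm (H.tbar X 1) := by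
  change (E.barEquiv hΓ).symm (H.tbar (E.ι.symm (E.ι X)) 1) = _
  rw [LinearEquiv.symm_apply_apply]

theorem comul_eq_iff (X : L) (z : E.Dia) :
    (E.comul hΓ (E.ι X) : E.Dia) = z ↔ E.barEquiv hΓ z = H.tbar X 1 := by
  rw [comul_ι, LinearEquiv.symm_apply_eq, eq_comm]

theorem exists_comul (X : L) : ∃ (n : ℕ) (u v : Fin n → L),
    (E.comul hΓ (E.ι X) : E.Dia) = ∑ i, E.dia (u i) (v i) ∧
      ∑ i, Γ.starRight (v i) (H.plusMinus (u i)) = H.tbar X 1 := by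
  obtain ⟨n, u, v, huv⟩ := E.exists_dia (E.comul hΓ (E.ι X) : E.Dia)
  refine ⟨n, u, v, huv, ?_⟩
  rw [comul_eq_iff, map_sum] at huv
  simpa only [barEquiv_dia] using huv

theorem comul_s (b : B) : (E.comul hΓ (E.ι (H.s b)) : E.Dia) = E.dia (H.s b) 1 := by
  rw [comul_eq_iff, barEquiv_dia, Γ.starRight_one, LeftHopfAlgebroid.plusMinus_s]

theorem comul_t (b : B) : (E.comul hΓ (E.ι (H.t (op b))) : E.Dia) = E.dia 1 (H.t (op b)) := by
  rw [comul_eq_iff, barEquiv_dia, LeftHopfAlgebroid.plusMinus_one, BarHom.starRight_tbar,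
    Γ.one_star]
  simpa using (H.tbar_balanced b 1 1).symm

theorem comul_one : (E.comul hΓ 1 : E.Dia) = E.beRing.dia E.beRing.regular 1 1 := by
  have := E.comul_s hΓ 1
  rwa [map_one, E.ι_one, dia_apply, E.ι_one] at this

theorem diaMulRight₂_dia (u v W Z : L) :
    E.beRing.diaMulRight₂ (E.ι W) (E.ι Z) (E.dia u v)
      = E.dia (Γ.twistMul u W) (Γ.twistMul v Z) := by
  simp [dia_apply, E.ι_mul]

/-- For `z` the coproduct of `X`, `barEquiv` takes `z (W ⊗ Z)` to
`X₊ ∗ W₊ ⊗ W₋ ∗ (Z₊ t (Γ(Z₋, X₋)))`. -/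
theorem barEquiv_comul_mul {X : L} {m : ℕ} {a c : Fin m → L}
    (hX : H.plusMinus X = ∑ i, H.tbar (a i) (c i)) (W Z : L) :
    E.barEquiv hΓ (E.beRing.diaMulRight₂ (E.ι W) (E.ι Z) (E.comul hΓ (E.ι X)))
      = ∑ i, Γ.starLeft (a i) (Γ.starRight (Γ.coshift (c i) Z) (H.plusMinus W)) := by
  obtain ⟨n, u, v, huv, h⟩ := E.exists_comul hΓ X
  rw [huv, ← Γ.translation_twistMul h hX]
  simp only [map_sum, diaMulRight₂_dia, barEquiv_dia]

/-- Multiplicativity of the coproduct: the translation formula is applied to the left factor in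
`barEquiv_comul_mul` and to the right factor in `translation_coshift`. -/
theorem comul_mul (x y : R) : (E.comul hΓ (x * y) : E.Dia)
    = E.beRing.takeuchiMul (E.comul hΓ x) (E.comul hΓ y) := by
  obtain ⟨X, rfl⟩ := E.ι.surjective x
  obtain ⟨Y, rfl⟩ := E.ι.surjective y
  obtain ⟨m, a, c, hX⟩ := H.exists_tbar (H.plusMinus X)
  obtain ⟨n, W, Z, hWZ, h⟩ := E.exists_comul hΓ Y
  rw [← E.ι_mul, comul_eq_iff, hWZ, map_sum, map_sum]
  simp only [dia_apply, BeRing.takeuchiMul_tmul, E.barEquiv_comul_mul hΓ hX]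
  rw [Finset.sum_comm]
  simp only [← map_sum, Γ.translation_coshift h]
  simp [Γ.twistMul_eq, hX, BarHom.starCoshift_tbar]

theorem takeuchiMul_s_t (a b : B) (z : E.Dia) :
    E.beRing.takeuchiMul (E.comul hΓ (E.beRing.s (E.β a) * E.beRing.t (op (E.β b)))) z
      = E.beRing.diaMulLeft (E.β a) (E.β b) z := by
  have h : (E.comul hΓ (E.beRing.s (E.β a) * E.beRing.t (op (E.β b))) : E.Dia)
      = E.dia (H.s a) (H.t (op b)) := by
    rw [comul_mul, s_β, t_β, comul_t, dia_apply, BeRing.takeuchiMul_tmul, comul_s,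
      diaMulRight₂_dia, Γ.twistMul_one, Γ.one_twistMul]
  have : E.beRing.takeuchiMul
      (E.comul hΓ (E.beRing.s (E.β a) * E.beRing.t (op (E.β b))))
      = E.beRing.diaMulLeft (E.β a) (E.β b) := by
    apply E.dia_ext
    intro X Y
    rw [dia_apply, BeRing.takeuchiMul_tmul, h, diaMulRight₂_dia]
    simp [dia_apply, E.ι_mul]
  rw [this]

theorem comul_bimod (a b : C) (x : R) :
    (E.comul hΓ (E.beRing.s a * E.beRing.t (op b) * x) : E.Dia)
      = E.beRing.diaMulLeft a b (E.comul hΓ x) := by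
  obtain ⟨a, rfl⟩ := E.β.surjective a
  obtain ⟨b, rfl⟩ := E.β.surjective b
  rw [comul_mul, takeuchiMul_s_t]

/-! ### The cotwisted counit -/

/-- The cotwisted counit `ε^Γ(X) = Γ(X₊, X₋)`. -/
noncomputable def counit : R →ₗ[k] C :=
  E.β.toLinearMap ∘ₗ Γ.toLin ∘ₗ H.plusMinus ∘ₗ E.ι.symm.toLinearMap

@[simp] theorem counit_ι (X : L) : E.counit (E.ι X) = E.β (Γ.twistCounit X) := by
  simp [counit, LeftTwoCocycle.twistCounit]

theorem counit_one : E.counit 1 = 1 := by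
  rw [← E.ι_one, counit_ι, Γ.twistCounit_one, E.β_one]

theorem counit_bimod (a b : C) (x : R) :
    E.counit (E.beRing.s a * E.beRing.t (op b) * x) = a * E.counit x * b := by
  obtain ⟨a, rfl⟩ := E.β.surjective a
  obtain ⟨b, rfl⟩ := E.β.surjective b
  obtain ⟨X, rfl⟩ := E.ι.surjective x
  rw [s_β, t_β, mul_assoc, ← E.ι_mul, ← E.ι_mul, counit_ι, Γ.twistCounit_s_twistMul,
    Γ.twistCounit_t_twistMul, E.β_mul, E.β_mul, counit_ι, mul_assoc]

theorem counit_mul_s (x y : R) :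
    E.counit (x * y) = E.counit (x * E.beRing.s (E.counit y)) := by
  obtain ⟨X, rfl⟩ := E.ι.surjective x
  obtain ⟨Y, rfl⟩ := E.ι.surjective y
  rw [counit_ι, s_β, ← E.ι_mul, ← E.ι_mul, counit_ι, counit_ι, Γ.twistCounit_twistMul_s]

theorem counit_mul_t (x y : R) :
    E.counit (x * y) = E.counit (x * E.beRing.t (op (E.counit y))) := by
  obtain ⟨X, rfl⟩ := E.ι.surjective x
  obtain ⟨Y, rfl⟩ := E.ι.surjective y
  rw [counit_ι, t_β, ← E.ι_mul, ← E.ι_mul, counit_ι, counit_ι, Γ.twistCounit_twistMul_t]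

end Realization
end Cocycle

section Cocycle

variable {k : Type w} {B : Type u} {L : Type v} [Field k] [Ring B] [Algebra k B]
  [Ring L] [Algebra k L]

/-! ### The counit and coassociativity axioms -/

namespace BeRing

variable (S : BeRing k B L)

/-- The map `diaHead` for the regular bimodule, as a bilinear map. -/
def diaHeadHom : L →ₗ[k] S.Diamond S.regular →ₗ[k] S.Diamond₃ S.regular where
  toFun := S.diaHead S.regular
  map_add' X Y := by
    apply S.dia_ext
    simp [diaHead_dia]
  map_smul' c X := by
    apply S.dia_ext
    simp [diaHead_dia]

theorem diaHeadHom_dia (X Y Z : L) :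
    S.diaHeadHom X (S.dia S.regular Y Z) = S.dia₃ S.regular X Y Z :=
  S.diaHead_dia S.regular X Y Z

theorem diaHeadHom_t_mul (b : B) (X : L) (z : S.Diamond S.regular) :
    S.diaHeadHom (S.t (op b) * X) z = S.diaHeadHom X (S.diaMulLeft b 1 z) := by
  have : S.diaHeadHom (S.t (op b) * X) = S.diaHeadHom X ∘ₗ S.diaMulLeft b 1 := by
    apply S.dia_ext
    intro Y Z
    rw [LinearMap.comp_apply, diaMulLeft_dia, diaHeadHom_dia, diaHeadHom_dia, ← diaTail_dia,
      ← diaTail_dia, dia_balanced]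
    simp
  exact LinearMap.congr_fun this z

end BeRing

variable {H : LeftHopfAlgebroid k B L}

namespace Realization

variable {Γ : LeftTwoCocycle H.toLeftBialgebroid} {C : Type u} {R : Type v} [Ring C]
  [Algebra k C] [Ring R] [Algebra k R] (E : Realization Γ C R) (hΓ : Γ.IsInvertible)

/-- The axiom `ε(X₁) X₂ = X` holds because the map `u ⊗ v ↦ (u₊ ∗ u₋) ∗ v = s (ε(u)) ∗ v` sends
the preimage of `X ⊗ 1` to `X`. -/
theorem counit_left (x : R) (z : R ⊗[k] R)
    (hz : (Submodule.Quotient.mk z : E.Dia) = E.comul hΓ x) :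
    TensorProduct.lift ((LinearMap.mul k R).comp (E.beRing.s.toLinearMap ∘ₗ E.counit)) z = x := by
  obtain ⟨X, rfl⟩ := E.ι.surjective x
  have h : E.ι.toLinearMap ∘ₗ Γ.mulStar ∘ₗ (E.barEquiv hΓ).toLinearMap ∘ₗ (balRel _ _).mkQ
      = TensorProduct.lift ((LinearMap.mul k R).comp (E.beRing.s.toLinearMap ∘ₗ E.counit)) := by
    apply TensorProduct.ext'
    intro u v
    obtain ⟨u, rfl⟩ := E.ι.surjective u
    obtain ⟨v, rfl⟩ := E.ι.surjective v
    have h1 : Γ.mulStar ∘ₗ Γ.starRight v = Γ.star.flip v ∘ₗ Γ.mulStar := by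
      apply H.tbar_ext
      simp [Γ.star_assoc]
    have h2 : Γ.mulStar (Γ.starRight v (H.plusMinus u))
        = Γ.twistMul (H.s (Γ.twistCounit u)) v := by
      refine (LinearMap.congr_fun h1 _).trans ?_
      rw [LinearMap.comp_apply, LinearMap.flip_apply, BarHom.mulStar_plusMinus, Γ.s_twistMul,
        LeftTwoCocycle.twistCounit]
    have h3 : (E.ι.toLinearMap ∘ₗ Γ.mulStar ∘ₗ (E.barEquiv hΓ).toLinearMap) (E.dia u v)
        = E.ι (Γ.twistMul (H.s (Γ.twistCounit u)) v) := by
      simp only [LinearMap.comp_apply, LinearEquiv.coe_coe, barEquiv_dia, h2]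
    refine h3.trans ?_
    simp [E.ι_mul]
  rw [← h]
  have h4 : (E.barEquiv hΓ) (Submodule.Quotient.mk z) = H.tbar X 1 := by
    rw [hz, comul_ι, LinearEquiv.apply_symm_apply]
  simp [h4]

theorem counit_right (x : R) (z : R ⊗[k] R)
    (hz : (Submodule.Quotient.mk z : E.Dia) = E.comul hΓ x) :
    TensorProduct.lift ((LinearMap.mul k R).comp
      (E.beRing.t.toLinearMap ∘ₗ (opLinearEquiv k).toLinearMap ∘ₗ E.counit)).flip z = x := by
  obtain ⟨X, rfl⟩ := E.ι.surjective x
  obtain ⟨n, u, v, rfl⟩ := exists_sum_tmul z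
  have h : ∑ i, E.dia (E.ι.symm (u i)) (E.ι.symm (v i)) = (E.comul hΓ (E.ι X) : E.Dia) := by
    rw [← hz]
    refine Eq.trans ?_ (map_sum (balRel _ _).mkQ _ _).symm
    refine Finset.sum_congr rfl fun i _ => ?_
    rw [dia_apply, LinearEquiv.apply_symm_apply, LinearEquiv.apply_symm_apply]
    rfl
  replace h := congrArg (E.barEquiv hΓ) h
  rw [comul_ι, LinearEquiv.apply_symm_apply, map_sum] at h
  simp only [barEquiv_dia] at h
  conv_rhs => rw [← Γ.translation_counit h]
  rw [map_sum, map_sum]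
  refine Finset.sum_congr rfl fun i _ => ?_
  obtain ⟨u', hu⟩ := E.ι.surjective (u i)
  obtain ⟨v', hv⟩ := E.ι.surjective (v i)
  simp [← hu, ← hv, E.ι_mul]

theorem diaMulLeft_barEquiv_symm (b : B) (z : H.TensorBar) :
    E.beRing.diaMulLeft (E.β b) 1 ((E.barEquiv hΓ).symm z)
      = (E.barEquiv hΓ).symm (Γ.starLeft (H.s b) z) := by
  have h : (E.barEquiv hΓ).toLinearMap ∘ₗ E.beRing.diaMulLeft (E.β b) 1
      = Γ.starLeft (H.s b) ∘ₗ (E.barEquiv hΓ).toLinearMap := by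
    apply E.dia_ext
    intro X Y
    have : E.beRing.diaMulLeft (E.β b) 1 (E.dia X Y) = E.dia (Γ.twistMul (H.s b) X) Y := by
      simp [dia_apply, E.ι_mul]
    simp only [LinearMap.comp_apply, this, LinearEquiv.coe_coe, barEquiv_dia,
      Γ.plusMinus_twistMul, LeftHopfAlgebroid.plusMinus_s, BarHom.insertStar_tbar, Γ.starRight_one,
      BarHom.starLeft_starRight]
  rw [LinearEquiv.eq_symm_apply]
  refine (LinearMap.congr_fun h _).trans ?_
  rw [LinearMap.comp_apply, LinearEquiv.coe_coe, LinearEquiv.apply_symm_apply]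

/-- The map `u ⊗ w ↦ u ⊗ z` from `R ⋄ R` to `R ⋄ R ⋄ R`, where `z` in `R ⋄ R` is the preimage of
`w ⊗ c` under `barEquiv`. -/
theorem exists_coassocMap : ∃ K : L →ₗ[k] E.Dia →ₗ[k] E.beRing.Diamond₃ E.beRing.regular,
    ∀ c u w, K c (E.dia u w)
      = E.beRing.diaHeadHom (E.ι u) ((E.barEquiv hΓ).symm (H.tbar w c)) := by
  obtain ⟨K, hK⟩ : ∃ K : L → E.Dia →ₗ[k] E.beRing.Diamond₃ E.beRing.regular,
      ∀ c u w, K c (E.dia u w)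
        = E.beRing.diaHeadHom (E.ι u) ((E.barEquiv hΓ).symm (H.tbar w c)) := by
    refine ⟨fun c => E.beRing.diaLift E.beRing.regular (E.beRing.diaHeadHom.compl₂
      ((E.barEquiv hΓ).symm.toLinearMap ∘ₗ H.tbar.flip c ∘ₗ E.ι.symm.toLinearMap)) ?_, ?_⟩
    · intro b x y
      obtain ⟨b, rfl⟩ := E.β.surjective b
      obtain ⟨Y, rfl⟩ := E.ι.surjective y
      have : E.ι.symm (E.beRing.regular.l (E.β b) (E.ι Y)) = Γ.star (H.s b) Y := by
        rw [BeRing.regular_l, s_β, ← E.ι_mul, LinearEquiv.symm_apply_apply, Γ.s_twistMul]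
      simp only [LinearMap.compl₂_apply, LinearMap.comp_apply, LinearEquiv.coe_coe, this,
        BeRing.diaHeadHom_t_mul, diaMulLeft_barEquiv_symm, LinearMap.flip_apply,
        BarHom.starLeft_tbar, LinearEquiv.symm_apply_apply]
    · intro c u w
      refine (E.beRing.diaLift_dia E.beRing.regular _ _ _ _).trans ?_
      simp only [LinearMap.compl₂_apply, LinearMap.comp_apply, LinearEquiv.coe_coe,
        LinearMap.flip_apply, LinearEquiv.symm_apply_apply]
  refine ⟨⟨⟨K, ?_⟩, ?_⟩, hK⟩
  · intro c c'
    apply E.dia_ext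
    simp [hK]
  · intro r c
    apply E.dia_ext
    simp [hK]

/-- Coassociativity follows from the translation formula for the map that sends `u ⊗ y ⊗ z` to
`u ⊗ w`, where `w` in `R ⋄ R` is the preimage of `y ⊗ z ∗ V` under `barEquiv`. -/
theorem coassoc (x : R) (z : R ⊗[k] R) (hz : (Submodule.Quotient.mk z : E.Dia) = E.comul hΓ x) :
    E.beRing.comulLeft E.beRing.regular (E.comul hΓ) z
      = E.beRing.coactRight E.beRing.regular (E.comul hΓ) z := by
  obtain ⟨X, rfl⟩ := E.ι.surjective x
  obtain ⟨K, hK⟩ := E.exists_coassocMap hΓ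
  have K_t : ∀ b c z, K (H.t (op b) * c) ((E.barEquiv hΓ).symm z)
      = K c ((E.barEquiv hΓ).symm (H.tbarMulRight (H.t (op b)) z)) := by
    intro b c z
    have : K (H.t (op b) * c) = K c ∘ₗ (E.barEquiv hΓ).symm.toLinearMap
        ∘ₗ H.tbarMulRight (H.t (op b)) ∘ₗ (E.barEquiv hΓ).toLinearMap := by
      apply E.dia_ext
      intro u w
      simp only [LinearMap.comp_apply, LinearEquiv.coe_coe, barEquiv_dia, ← Γ.starRight_mul_t]
      rw [← E.barEquiv_dia hΓ, LinearEquiv.symm_apply_apply, hK, hK, BeRing.tbar_balanced]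
    rw [this]
    simp only [LinearMap.comp_apply, LinearEquiv.coe_coe, LinearEquiv.apply_symm_apply]
  -- both sides of coassociativity are values of `K`: the right one at `1` and `Δ^Γ(X)`, the left
  -- one, through the map `T`, at `X ⊗ 1`
  obtain ⟨T, hT⟩ : ∃ T : H.TensorBar →ₗ[k] E.beRing.Diamond₃ E.beRing.regular, ∀ x c,
      T (H.tbar x c) = K c ((E.barEquiv hΓ).symm (H.tbar x 1)) :=
    ⟨H.tbarLift (K.flip ∘ₗ (E.barEquiv hΓ).symm.toLinearMap ∘ₗ H.tbar.flip 1) (by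
      intro b x c
      simp only [LinearMap.comp_apply, LinearEquiv.coe_coe, LinearMap.flip_apply, K_t,
        BeRing.tbarMulRight_tbar, BeRing.tbar_balanced, one_mul, mul_one]),
      fun x c => H.tbarLift_tbar _ _ x c⟩
  have hleft : ∀ U V, E.beRing.diaTail E.beRing.regular (E.comul hΓ (E.ι U)) (E.ι V)
      = T (Γ.starRight V (H.plusMinus U)) := by
    intro U V
    obtain ⟨m, a, c, hU⟩ := H.exists_tbar (H.plusMinus U)
    obtain ⟨n, u, v, huv, h⟩ := E.exists_comul hΓ U
    have := Γ.translation_apply h hU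
      (LinearMap.compl₂ (K ∘ₗ Γ.star.flip V) (E.barEquiv hΓ).symm.toLinearMap) ?_
      (fun u => E.beRing.diaHeadHom (E.ι u) ∘ₗ (E.barEquiv hΓ).symm.toLinearMap
        ∘ₗ Γ.starRight V) ?_
    · simp only [LinearMap.compl₂_apply, LinearMap.comp_apply, LinearEquiv.coe_coe,
        LinearMap.flip_apply, ← E.barEquiv_dia hΓ, LinearEquiv.symm_apply_apply] at this
      simp only [huv, hU, map_sum, LinearMap.sum_apply, BarHom.starRight_tbar, hT, ← this]
      exact Finset.sum_congr rfl fun i _ => (E.beRing.diaTail_dia E.beRing.regular _ _ _).trans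
        (E.beRing.diaHeadHom_dia _ _ _).symm
    · intro b y w
      simp only [LinearMap.compl₂_apply, LinearMap.comp_apply, LinearEquiv.coe_coe,
        LinearMap.flip_apply, BarHom.t_mul_star, K_t]
    · intro u y y'
      simp only [LinearMap.compl₂_apply, LinearMap.comp_apply, LinearEquiv.coe_coe,
        LinearMap.flip_apply, BarHom.starRight_tbar, ← E.barEquiv_dia hΓ,
        LinearEquiv.symm_apply_apply, hK]
  have h1 : E.beRing.comulLeft E.beRing.regular (E.comul hΓ)
      = T ∘ₗ (E.barEquiv hΓ).toLinearMap ∘ₗ (balRel _ _).mkQ := by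
    apply TensorProduct.ext'
    intro x y
    obtain ⟨U, rfl⟩ := E.ι.surjective x
    obtain ⟨V, rfl⟩ := E.ι.surjective y
    refine Eq.trans ?_ ((hleft U V).trans ?_)
    · exact TensorProduct.lift.tmul _ _
    · rw [← E.barEquiv_dia hΓ]
      rfl
  have h2 : E.beRing.coactRight E.beRing.regular (E.comul hΓ) = K 1 ∘ₗ (balRel _ _).mkQ := by
    apply TensorProduct.ext'
    intro x y
    obtain ⟨U, rfl⟩ := E.ι.surjective x
    obtain ⟨V, rfl⟩ := E.ι.surjective y
    have h := hK 1 U V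
    rw [← comul_ι] at h
    refine Eq.trans ?_ h.symm
    exact TensorProduct.lift.tmul _ _
  have h3 : E.barEquiv hΓ (Submodule.Quotient.mk z) = H.tbar X 1 := by
    rw [hz, comul_ι, LinearEquiv.apply_symm_apply]
  rw [h1, h2]
  refine (congrArg T h3).trans ((hT X 1).trans ?_)
  rw [← comul_ι, ← hz]
  rfl

/-! ### The cotwisted left Hopf algebroid -/

/-- The cotwisted left bialgebroid. -/
noncomputable def leftBialgebroid : LeftBialgebroid k C R where
  toBeRing := E.beRing
  Δ := E.comul hΓ
  ε := E.counit
  Δ_bimod := E.comul_bimod hΓ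
  ε_bimod := E.counit_bimod
  coassoc := E.coassoc hΓ
  counit_left := E.counit_left hΓ
  counit_right := E.counit_right hΓ
  Δ_one := E.comul_one hΓ
  Δ_mul := E.comul_mul hΓ
  ε_one := E.counit_one
  ε_mul_s := E.counit_mul_s
  ε_mul_t := E.counit_mul_t

/-- Under `barEquiv`, the canonical map is `X ⊗ Y ↦ X₊ ⊗ Y₊ t (Γ(Y₋, X₋))`, which is the bijection
of `exists_galois`. -/
theorem lam_bijective : Function.Bijective (E.leftBialgebroid hΓ).lam := by
  obtain ⟨e, he⟩ := E.exists_galois hΓ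
  have : (E.leftBialgebroid hΓ).lam = (e.trans (E.barEquiv hΓ).symm).toLinearMap := by
    apply (E.leftBialgebroid hΓ).tbar_ext
    intro x y
    obtain ⟨X, rfl⟩ := E.ι.surjective x
    obtain ⟨Y, rfl⟩ := E.ι.surjective y
    obtain ⟨m, a, c, hX⟩ := H.exists_tbar (H.plusMinus X)
    have h1 : (E.leftBialgebroid hΓ).lam ((E.leftBialgebroid hΓ).tbar (E.ι X) (E.ι Y))
        = E.beRing.diaMulRight₂ (E.ι 1) (E.ι Y) (E.comul hΓ (E.ι X)) := by
      rw [LeftBialgebroid.lam_tbar, E.ι_one]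
      rfl
    refine h1.trans (((E.barEquiv hΓ).eq_symm_apply).2 ?_)
    refine (E.barEquiv_comul_mul hΓ hX 1 Y).trans (Eq.trans ?_ (he X Y m a c hX).symm)
    simp [LeftHopfAlgebroid.plusMinus_one]
  rw [this]
  exact (e.trans (E.barEquiv hΓ).symm).bijective

/-- The cotwisted left Hopf algebroid. -/
noncomputable def leftHopfAlgebroid : LeftHopfAlgebroid k C R where
  toLeftBialgebroid := E.leftBialgebroid hΓ
  lam_bijective := E.lam_bijective hΓ

/-- The coproduct of the cotwisted left Hopf algebroid is `(Γ^#)⁻¹ ∘ Δ`, since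
`λ(X ⊗ 1) = Δ(X)`. -/
theorem exists_sharp_comul : ∃ e : E.Dia ≃ₗ[k] H.Diamond H.regular,
    (∀ X Y, e (E.dia X Y) = Γ.sharp X Y) ∧
      ∀ X, (E.comul hΓ (E.ι X) : E.Dia) = e.symm (H.Δ X) := by
  obtain ⟨e, he⟩ := E.exists_sharp hΓ
  refine ⟨e, he, fun X => ?_⟩
  have h : e.toLinearMap = H.lam ∘ₗ (E.barEquiv hΓ).toLinearMap := by
    apply E.dia_ext
    intro X Y
    simp only [LinearMap.comp_apply, LinearEquiv.coe_coe, barEquiv_dia, he, Γ.sharp_eq]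
  rw [LinearEquiv.eq_symm_apply, ← LinearEquiv.coe_coe, h, LinearMap.comp_apply,
    LinearEquiv.coe_coe, comul_ι, LinearEquiv.apply_symm_apply, LeftTwoCocycle.lam_tbar_one]

end Realization

/-- The vector space `B`, as the carrier of the algebra `B^Γ`. -/
def CotwistBase (_ : LeftTwoCocycle H.toLeftBialgebroid) : Type u := B

/-- The vector space `L`, as the carrier of the algebra `L^Γ`. -/
def CotwistAlg (_ : LeftTwoCocycle H.toLeftBialgebroid) : Type v := L

namespace LeftTwoCocycle

variable (Γ : LeftTwoCocycle H.toLeftBialgebroid)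

theorem baseMul_add (a b c : B) : Γ.baseMul a (b + c) = Γ.baseMul a b + Γ.baseMul a c := by
  simp [baseMul]

theorem add_baseMul (a b c : B) : Γ.baseMul (a + b) c = Γ.baseMul a c + Γ.baseMul b c := by
  simp [baseMul]

theorem baseMul_smul (r : k) (a b : B) : Γ.baseMul a (r • b) = r • Γ.baseMul a b := by
  simp [baseMul]

theorem smul_baseMul (r : k) (a b : B) : Γ.baseMul (r • a) b = r • Γ.baseMul a b := by
  simp [baseMul]

theorem twistMul_add (X Y Z : L) :
    Γ.twistMul X (Y + Z) = Γ.twistMul X Y + Γ.twistMul X Z := by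
  have : Γ.starCoshift (Y + Z) = Γ.starCoshift Y + Γ.starCoshift Z := by
    apply H.tbar_ext
    simp [BarHom.starCoshift_tbar]
  simp [twistMul_eq, this]

theorem twistMul_smul (r : k) (X Y : L) : Γ.twistMul X (r • Y) = r • Γ.twistMul X Y := by
  have : Γ.starCoshift (r • Y) = r • Γ.starCoshift Y := by
    apply H.tbar_ext
    simp [BarHom.starCoshift_tbar]
  simp [twistMul_eq, this]

theorem add_twistMul (X Y Z : L) :
    Γ.twistMul (X + Y) Z = Γ.twistMul X Z + Γ.twistMul Y Z := by
  simp [twistMul_eq]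

theorem smul_twistMul (r : k) (X Y : L) : Γ.twistMul (r • X) Y = r • Γ.twistMul X Y := by
  simp [twistMul_eq]

end LeftTwoCocycle

section Carriers

variable (Γ : LeftTwoCocycle H.toLeftBialgebroid)

instance : AddCommGroup (CotwistBase Γ) := inferInstanceAs (AddCommGroup B)

instance : Module k (CotwistBase Γ) := inferInstanceAs (Module k B)

instance : AddCommGroup (CotwistAlg Γ) := inferInstanceAs (AddCommGroup L)

instance : Module k (CotwistAlg Γ) := inferInstanceAs (Module k L)

noncomputable instance : Ring (CotwistBase Γ) :=
  { (inferInstance : AddCommGroup (CotwistBase Γ)) with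
    mul := Γ.baseMul
    one := (1 : B)
    mul_assoc := Γ.baseMul_assoc
    one_mul := Γ.one_baseMul
    mul_one := Γ.baseMul_one
    left_distrib := Γ.baseMul_add
    right_distrib := Γ.add_baseMul
    zero_mul := fun a => by
      have h := Γ.smul_baseMul 0 0 a
      rwa [zero_smul, zero_smul] at h
    mul_zero := fun a => by
      have h := Γ.baseMul_smul 0 a 0
      rwa [zero_smul, zero_smul] at h }

noncomputable instance : Ring (CotwistAlg Γ) :=
  { (inferInstance : AddCommGroup (CotwistAlg Γ)) with
    mul := Γ.twistMul
    one := (1 : L)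
    mul_assoc := Γ.twistMul_assoc
    one_mul := Γ.one_twistMul
    mul_one := Γ.twistMul_one
    left_distrib := Γ.twistMul_add
    right_distrib := Γ.add_twistMul
    zero_mul := fun X => by
      have h := Γ.smul_twistMul 0 0 X
      rwa [zero_smul, zero_smul] at h
    mul_zero := fun X => by
      have h := Γ.twistMul_smul 0 X 0
      rwa [zero_smul, zero_smul] at h }

noncomputable instance : Algebra k (CotwistBase Γ) :=
  Algebra.ofModule Γ.smul_baseMul fun r a b => Γ.baseMul_smul r a b

noncomputable instance : Algebra k (CotwistAlg Γ) :=
  Algebra.ofModule Γ.smul_twistMul fun r X Y => Γ.twistMul_smul r X Y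

/-- The identity maps, as identifications of `B` with `B^Γ` and of `L` with `L^Γ`. -/
noncomputable def LeftTwoCocycle.realization : Realization Γ (CotwistBase Γ) (CotwistAlg Γ) where
  β := LinearEquiv.refl k B
  ι := LinearEquiv.refl k L
  β_one := rfl
  β_mul _ _ := rfl
  ι_one := rfl
  ι_mul _ _ := rfl

end Carriers

end Cocycle
end Cotwist

theorem mainTheorem1 {k : Type w} {B : Type u} {L : Type v} [Field k] [Ring B] [Algebra k B]
    [Ring L] [Algebra k L] (H : Cotwist.LeftHopfAlgebroid k B L)
    (Γ : Cotwist.LeftTwoCocycle H.toLeftBialgebroid) (hΓ : Γ.IsInvertible) :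
    -- the algebra `B^Γ` and the algebra `L^Γ`, with the identifications `β : B ≃ B^Γ` and
    -- `ι : L ≃ L^Γ` of underlying vector spaces
    ∃ (BΓ : Type u) (LΓ : Type v) (_ : Ring BΓ) (_ : Algebra k BΓ) (_ : Ring LΓ) (_ : Algebra k LΓ)
      (β : B ≃ₗ[k] BΓ) (ι : L ≃ₗ[k] LΓ)
      (HΓ : Cotwist.LeftHopfAlgebroid k BΓ LΓ),
      (β 1 = 1 ∧ ∀ a b : B, β a * β b = β (Γ.baseMul a b)) ∧
      (ι 1 = 1 ∧ ∀ X Y : L, ι X * ι Y = ι (Γ.twistMul X Y)) ∧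
      (∀ b : B, HΓ.s (β b) = ι (H.s b)) ∧
      (∀ b : B, HΓ.t (MulOpposite.op (β b)) = ι (H.t (MulOpposite.op b))) ∧
      (∀ X : L, HΓ.ε (ι X) = β (Γ.twistCounit X)) ∧
      ∃ sharp : HΓ.Diamond HΓ.regular ≃ₗ[k] H.Diamond H.regular,
        (∀ X Y : L, sharp (HΓ.dia HΓ.regular (ι X) (ι Y)) = Γ.sharp X Y) ∧
        ∀ X : L, (HΓ.Δ (ι X) : HΓ.Diamond HΓ.regular) = sharp.symm (H.Δ X) := by
  let E := Γ.realization
  obtain ⟨e, he, he'⟩ := E.exists_sharp_comul hΓ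
  exact ⟨Cotwist.CotwistBase Γ, Cotwist.CotwistAlg Γ, inferInstance, inferInstance, inferInstance,
    inferInstance, E.β, E.ι, E.leftHopfAlgebroid hΓ,
    ⟨E.β_one, fun a b => (E.β_mul a b).symm⟩, ⟨E.ι_one, fun X Y => (E.ι_mul X Y).symm⟩,
    E.s_β, E.t_β, E.counit_ι, e, he, he'⟩
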